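/- Let $d\ge 3$ be an integer. For $x\in\mathbb{Z}^d$ let $|x|$ be the Euclidean norm and $\langle x\rangle=(1+|x|^2)^{1/2}$. For $u:\mathbb{Z}^d\to\mathbb{C}$ put $$H_0u(x)=-\sum_{|x-y|=1}(u(y)-u(x)),$$ and let $l^{2,s}(\mathbb{Z}^d)=\langle x\rangle^{-s}l^2(\mathbb{Z}^d)$. Let $0<\varepsilon\le 1$, let $V:\mathbb{Z}^d\to\mathbb{R}$ satisfy $|V(x)|\le C_0\langle x\rangle^{-2-\varepsilon}$ for all $x$ with some constant $C_0$, and let $u\in l^{2,-3/2}(\mathbb{Z}^d)$ satisfy $(H_0+V)u=0$ on $\mathbb{Z}^d$. Then: 1. There is $C>0$ such that $|u(x)|\le C\langle x\rangle^{-d+2}$ for all $x\in\mathbb{Z}^d$. 2. The series $\sum_{y\in\mathbb{Z}^d}V(y)u(y)$ converges absolutely and, with $c_d=\dfrac{\Gamma(\frac d2-1)}{4\pi^{d/2}}$, as $|x|\to\infty$, $$u(x)=-c_d|x|^{-d+2}\sum_{y\in\mathbb{Z}^d}V(y)u(y)+\begin{cases}O(|x|^{-d+2-\varepsilon}) & \text{if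 } 0<\varepsilon<1,\\ O(|x|^{-d+1}\log|x|) & \text{if }\varepsilon=1.\end{cases}$$ 3. If $\sum_{y\in\mathbb{Z}^d}V(y)u(y)\ne 0$, then there are $C>0$ and $R>0$ such that $|u(x)|\ge C|x|^{-d+2}$ for all $x\in\mathbb{Z}^d$ with $|x|\ge R$. All constants, including the implied ones, may depend on $d$, $\varepsilon$, $V$ and $u$. -/

import Mathlib

open Filter Topology Asymptotics
open scoped Real

noncomputable section

/-- The Euclidean norm of a point of the lattice `ℤ^d`. -/
def latNorm {d : ℕ} (x : Fin d → ℤ) : ℝ :=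
  Real.sqrt (∑ j, (x j : ℝ) ^ 2)

/-- The Japanese bracket `(1 + |x|^2)^(1/2)`. -/
def jap {d : ℕ} (x : Fin d → ℤ) : ℝ :=
  Real.sqrt (1 + latNorm x ^ 2)

/-- The filter of `|x| → ∞` on the lattice `ℤ^d`. -/
def latInfty (d : ℕ) : Filter (Fin d → ℤ) :=
  Filter.comap latNorm Filter.atTop

/-- The weighted space `l^{2,s}(ℤ^d) = ⟨x⟩^{-s} l^2(ℤ^d)`: the function `⟨x⟩^s u` is square summable. -/
def MemWeightedL2 {d : ℕ} (s : ℝ) (u : (Fin d → ℤ) → ℂ) : Prop :=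
  Memℓp (fun x => ((jap x ^ s : ℝ) : ℂ) * u x) 2

/-- The negative discrete Laplacian `H₀ u(x) = -∑_{|x-y|=1} (u(y) - u(x))`; the lattice points `y`
with `|x - y| = 1` are the `2d` points `x ± e_j`. -/
def discreteH0 {d : ℕ} (u : (Fin d → ℤ) → ℂ) (x : Fin d → ℤ) : ℂ :=
  -∑ j : Fin d, ((u (x + Pi.single j 1) - u x) + (u (x - Pi.single j 1) - u x))

/-- The constant `c_d = Γ(d/2 - 1) / (4 π^{d/2})`. -/
def greenConst (d : ℕ) : ℝ :=
  Real.Gamma ((d : ℝ) / 2 - 1) / (4 * π ^ ((d : ℝ) / 2))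

end

/-! The argument uses maximum principles and never constructs the lattice Green function. Write Δ =
-H₀ (`latLap` in the real case) and ρ = a + |x|².

Decay. By Kato's inequality (`neg_latLap_norm_le`), w = |u| satisfies -Δw ≤ |V| w. Testing this
against a truncated superharmonic function on a ball of radius about |x₀|/2 around x₀, then applying
Cauchy–Schwarz, bounds w(x₀)² by a constant times the sum of ⟨x⟩^{-3} w² over the ball. These balls
escape to infinity, so w → 0 (`tendsto_zero_of_subsolution`); the weight -3/2 is exactly what the
scaling in R permits. Comparison with explicit supersolutions built from powers of ρ then improves w
→ 0 to w = O(⟨x⟩^{2-d}) (`exists_le_jap_of_subsolution`).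

Asymptotics. Now Δu = Vu is O(⟨x⟩^{-d-ε}), hence summable. Let v = ρ^{-(d-2)/2} (`regPotential`),
whose Laplacian is summable too. The convolutions u * Δv and v * Δu have the same Laplacian Δu * Δv
and tend to zero, so they agree by Liouville's theorem. Each is close to a product: u * Δv = u ∑Δv +
error, and likewise with u and v exchanged. Hence u ∑Δv ≈ v ∑Δu (`exists_abs_mul_tsum_sub_le`). The
error comes from gradient bounds O(⟨x⟩^{1-d}), proved by a reflection barrier, and is ⟨x⟩^{1-d}
∑_{k<⟨x⟩} (k+1)^{-ε}; this sum is a power for ε < 1 and a logarithm for ε = 1.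

Constant. The same reciprocity for two values of a shows that ∑Δv does not depend on a. Its value is
then read off as a → ∞: Taylor expansion, a Gamma integral and Jacobi's theta inversion give
-d(d-2)π^{d/2}/Γ(d/2+1) = -1/c_d (`exists_tsum_latLap_regPotential`). The lower bound follows
because the error is o(|x|^{2-d}). -/

/-! ### Norms on the lattice. -/

/-- The squared Euclidean norm on the lattice. -/
noncomputable def latSq {d : ℕ} (x : Fin d → ℤ) : ℝ := ∑ j, (x j : ℝ) ^ 2

theorem latSq_nonneg {d : ℕ} (x : Fin d → ℤ) : 0 ≤ latSq x :=
  Finset.sum_nonneg fun _ _ => sq_nonneg _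

theorem latNorm_nonneg {d : ℕ} (x : Fin d → ℤ) : 0 ≤ latNorm x := Real.sqrt_nonneg _

theorem latNorm_sq {d : ℕ} (x : Fin d → ℤ) : latNorm x ^ 2 = latSq x :=
  Real.sq_sqrt (latSq_nonneg x)

theorem jap_sq {d : ℕ} (x : Fin d → ℤ) : jap x ^ 2 = 1 + latSq x := by
  rw [jap, Real.sq_sqrt (by positivity), latNorm_sq]

theorem one_le_jap {d : ℕ} (x : Fin d → ℤ) : 1 ≤ jap x := by
  rw [jap]; exact Real.one_le_sqrt.2 (by nlinarith [sq_nonneg (latNorm x)])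

theorem jap_pos {d : ℕ} (x : Fin d → ℤ) : 0 < jap x := lt_of_lt_of_le one_pos (one_le_jap x)

theorem latNorm_eq_norm {d : ℕ} (x : Fin d → ℤ) :
    latNorm x = ‖(WithLp.toLp 2 (fun j => (x j : ℝ)) : EuclideanSpace ℝ (Fin d))‖ := by
  rw [EuclideanSpace.norm_eq, latNorm]; simp

theorem latNorm_add_le {d : ℕ} (x y : Fin d → ℤ) : latNorm (x + y) ≤ latNorm x + latNorm y := by
  simp only [latNorm_eq_norm]
  refine le_of_eq_of_le (congrArg _ ?_) (norm_add_le _ _)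
  ext j; simp

theorem latNorm_neg {d : ℕ} (x : Fin d → ℤ) : latNorm (-x) = latNorm x := by
  simp [latNorm]

theorem latNorm_sub_le {d : ℕ} (x y : Fin d → ℤ) : latNorm (x - y) ≤ latNorm x + latNorm y := by
  rw [sub_eq_add_neg, ← latNorm_neg y]; exact latNorm_add_le _ _

theorem latNorm_le_sub_add {d : ℕ} (x y : Fin d → ℤ) :
    latNorm x ≤ latNorm (x - y) + latNorm y := by
  simpa using latNorm_add_le (x - y) y

theorem latNorm_single {d : ℕ} (j : Fin d) : latNorm (Pi.single j (1 : ℤ)) = 1 := by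
  rw [latNorm, Finset.sum_eq_single j]
  · simp
  · intro b _ hb; simp [hb]
  · simp

theorem abs_coord_le_latNorm {d : ℕ} (x : Fin d → ℤ) (j : Fin d) : |(x j : ℝ)| ≤ latNorm x := by
  rw [latNorm]
  refine Real.le_sqrt_of_sq_le ?_
  rw [sq_abs]
  exact Finset.single_le_sum (f := fun j => (x j : ℝ) ^ 2) (fun _ _ => sq_nonneg _)
    (Finset.mem_univ j)

theorem latNorm_lt_jap {d : ℕ} (x : Fin d → ℤ) : latNorm x < jap x := by
  refine lt_of_pow_lt_pow_left₀ 2 (jap_pos x).le ?_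
  rw [jap_sq, latNorm_sq]; linarith

theorem latNorm_mono {d : ℕ} {x y : Fin d → ℤ} (h : ∀ i, |x i| ≤ |y i|) :
    latNorm x ≤ latNorm y := by
  refine Real.sqrt_le_sqrt (Finset.sum_le_sum fun i _ => ?_)
  exact_mod_cast sq_le_sq.2 (h i)

/-- If `|y| ≥ c|x|` with `0 < c ≤ 1` then `⟨y⟩ ≥ c⟨x⟩`. -/
theorem jap_ge_of_latNorm_ge {d : ℕ} {x y : Fin d → ℤ} {c : ℝ} (hc0 : 0 ≤ c) (hc : c ≤ 1)
    (h : c * latNorm x ≤ latNorm y) : c * jap x ≤ jap y := by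
  refine le_of_sq_le_sq ?_ (jap_pos y).le
  have h1 : (c * latNorm x) ^ 2 ≤ latNorm y ^ 2 :=
    pow_le_pow_left₀ (mul_nonneg hc0 (latNorm_nonneg x)) h 2
  rw [mul_pow, latNorm_sq, latNorm_sq] at h1
  rw [mul_pow, jap_sq, jap_sq]
  nlinarith

theorem jap_le_one_add_latNorm {d : ℕ} (x : Fin d → ℤ) : jap x ≤ 1 + latNorm x := by
  rw [jap]
  exact Real.sqrt_le_iff.2 ⟨by linarith [latNorm_nonneg x], by nlinarith [latNorm_nonneg x]⟩

/-! ### Counting points on sup-norm shells, and sums of powers. -/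

/-- The sup norm on the lattice, as a natural number. -/
def supN {d : ℕ} (x : Fin d → ℤ) : ℕ := Finset.univ.sup fun j => (x j).natAbs

theorem natAbs_le_supN {d : ℕ} (x : Fin d → ℤ) (j : Fin d) : (x j).natAbs ≤ supN x :=
  Finset.le_sup (f := fun j => (x j).natAbs) (Finset.mem_univ j)

theorem supN_le_latNorm {d : ℕ} (x : Fin d → ℤ) : (supN x : ℝ) ≤ latNorm x := by
  rcases Nat.eq_zero_or_pos d with rfl | hd
  · simp [supN, latNorm_nonneg]
  · have : Nonempty (Fin d) := ⟨⟨0, hd⟩⟩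
    obtain ⟨j, -, hj⟩ := Finset.exists_mem_eq_sup Finset.univ Finset.univ_nonempty
      fun j => (x j).natAbs
    rw [supN, hj, Nat.cast_natAbs, Int.cast_abs]
    exact abs_coord_le_latNorm x j

theorem supN_add_one_le {d : ℕ} (x : Fin d → ℤ) : (supN x : ℝ) + 1 ≤ 2 * jap x := by
  linarith [supN_le_latNorm x, latNorm_lt_jap x, one_le_jap x]

theorem jap_le_supN {d : ℕ} (x : Fin d → ℤ) : jap x ≤ (d + 1) * ((supN x : ℝ) + 1) := by
  have h : latSq x ≤ d * (supN x : ℝ) ^ 2 := by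
    calc latSq x ≤ ∑ _j : Fin d, (supN x : ℝ) ^ 2 := by
          refine Finset.sum_le_sum fun j _ => ?_
          rw [← sq_abs, ← Int.cast_abs, Int.abs_eq_natAbs]
          exact pow_le_pow_left₀ (by positivity) (by exact_mod_cast natAbs_le_supN x j) 2
      _ = _ := by simp
  refine le_of_sq_le_sq ?_ (by positivity)
  rw [jap_sq]
  have : (0 : ℝ) ≤ d := Nat.cast_nonneg d
  have h2 : (0 : ℝ) ≤ supN x := Nat.cast_nonneg _
  nlinarith [mul_nonneg this (sq_nonneg (supN x : ℝ)), mul_nonneg this h2,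
    mul_nonneg this this, mul_nonneg (mul_nonneg this this) (sq_nonneg ((supN x : ℝ) + 1))]

/-- On the shell some coordinate equals ±k and the other d - 1 lie in [-k, k], so there are at most
d · 2 · (2k+1)^(d-1) points. -/
theorem card_supN_eq_le {d : ℕ} (hd : 1 ≤ d) (F : Finset (Fin d → ℤ)) (k : ℕ) :
    ((F.filter fun x => supN x = k).card : ℝ) ≤ (2 * d * 2 ^ (d - 1)) * ((k : ℝ) + 1) ^ (d - 1) := by
  have hne : Nonempty (Fin d) := ⟨⟨0, hd⟩⟩
  let A : Fin d → Finset (Fin d → ℤ) := fun j =>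
    Fintype.piFinset (Function.update (fun _ => Finset.Icc (-(k : ℤ)) k) j {(k : ℤ), -(k : ℤ)})
  have hsub : (F.filter fun x => supN x = k) ⊆ Finset.univ.biUnion A := by
    intro x hx
    have hk := (Finset.mem_filter.1 hx).2
    obtain ⟨j, -, hj⟩ := Finset.exists_mem_eq_sup Finset.univ Finset.univ_nonempty
      fun j => (x j).natAbs
    have hj' : (x j).natAbs = k := by rw [← hk, supN, hj]
    refine Finset.mem_biUnion.2 ⟨j, Finset.mem_univ _, ?_⟩
    rw [Fintype.mem_piFinset]
    intro i
    by_cases hij : i = j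
    · subst hij
      simp only [Function.update_self, Finset.mem_insert, Finset.mem_singleton]
      omega
    · have := natAbs_le_supN x i
      rw [Function.update_of_ne hij, Finset.mem_Icc]
      omega
  have hA : ∀ j, (A j).card ≤ 2 * (2 * k + 1) ^ (d - 1) := by
    intro j
    rw [Fintype.card_piFinset, ← Finset.mul_prod_erase _ _ (Finset.mem_univ j)]
    refine Nat.mul_le_mul ?_ ?_
    · rw [Function.update_self]; exact Finset.card_le_two
    · refine le_of_eq ?_
      rw [Finset.prod_congr rfl (g := fun _ => 2 * k + 1)]
      · simp
      · intro i hi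
        rw [Function.update_of_ne (Finset.ne_of_mem_erase hi), Int.card_Icc]
        omega
  have h1 : (F.filter fun x => supN x = k).card ≤ d * (2 * (2 * k + 1) ^ (d - 1)) := by
    refine (Finset.card_le_card hsub).trans (Finset.card_biUnion_le.trans ?_)
    exact (Finset.sum_le_sum fun j _ => hA j).trans (by simp)
  have h2 : ((2 * k + 1 : ℕ) : ℝ) ^ (d - 1) ≤ 2 ^ (d - 1) * ((k : ℝ) + 1) ^ (d - 1) := by
    rw [← mul_pow]; refine pow_le_pow_left₀ (by positivity) ?_ _
    push_cast; linarith
  calc ((F.filter fun x => supN x = k).card : ℝ)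
      ≤ ((d * (2 * (2 * k + 1) ^ (d - 1)) : ℕ) : ℝ) := by exact_mod_cast h1
    _ = 2 * d * ((2 * k + 1 : ℕ) : ℝ) ^ (d - 1) := by push_cast; ring
    _ ≤ 2 * d * (2 ^ (d - 1) * ((k : ℝ) + 1) ^ (d - 1)) := by gcongr
    _ = _ := by ring

theorem sum_supN_le {d : ℕ} (hd : 1 ≤ d) (F : Finset (Fin d → ℤ)) (φ : ℕ → ℝ) (hφ : ∀ k, 0 ≤ φ k) :
    ∑ x ∈ F, φ (supN x) ≤ (2 * d * 2 ^ (d - 1)) *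
      ∑ k ∈ F.image supN, ((k : ℝ) + 1) ^ (d - 1) * φ k := by
  rw [Finset.sum_comp, Finset.mul_sum]
  refine Finset.sum_le_sum fun k _ => ?_
  rw [nsmul_eq_mul, ← mul_assoc]
  exact mul_le_mul_of_nonneg_right (card_supN_eq_le hd F k) (hφ k)

theorem jap_rpow_neg_le {d : ℕ} (x : Fin d → ℤ) {p : ℝ} (hp : 0 ≤ p) :
    jap x ^ (-p) ≤ 2 ^ p * ((supN x : ℝ) + 1) ^ (-p) := by
  have h0 : (0 : ℝ) < (supN x : ℝ) + 1 := by positivity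
  calc jap x ^ (-p) ≤ (((supN x : ℝ) + 1) / 2) ^ (-p) :=
        Real.rpow_le_rpow_of_nonpos (by positivity) (by linarith [supN_add_one_le x]) (by linarith)
    _ = 2 ^ p * ((supN x : ℝ) + 1) ^ (-p) := by
        rw [Real.div_rpow h0.le (by norm_num), Real.rpow_neg (by norm_num : (0 : ℝ) ≤ 2)]
        field_simp

/-- The exponent is written as 1 - d - p so that the shell size (k+1)^(d-1) cancels and only
(k+1)^(-p) survives. Sums over balls use p = ε, tails use p = 1 + ε. -/
theorem sum_jap_rpow_le_sum_image {d : ℕ} (hd : 1 ≤ d) (F : Finset (Fin d → ℤ)) {p : ℝ}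
    (hp : 0 ≤ (d : ℝ) - 1 + p) :
    ∑ x ∈ F, jap x ^ (1 - (d : ℝ) - p) ≤ (2 * d * 2 ^ (d - 1) * 2 ^ ((d : ℝ) - 1 + p)) *
      ∑ k ∈ F.image supN, ((k : ℝ) + 1) ^ (-p) := by
  calc ∑ x ∈ F, jap x ^ (1 - (d : ℝ) - p)
      ≤ ∑ x ∈ F, 2 ^ ((d : ℝ) - 1 + p) * ((supN x : ℝ) + 1) ^ (-((d : ℝ) - 1 + p)) := by
        refine Finset.sum_le_sum fun x _ => ?_
        have e : 1 - (d : ℝ) - p = -((d : ℝ) - 1 + p) := by ring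
        rw [e]; exact jap_rpow_neg_le x hp
    _ ≤ _ := sum_supN_le hd F
        (fun k => 2 ^ ((d : ℝ) - 1 + p) * ((k : ℝ) + 1) ^ (-((d : ℝ) - 1 + p)))
        (fun k => by positivity)
    _ = _ := by
        rw [Finset.mul_sum, Finset.mul_sum]
        refine Finset.sum_congr rfl fun k _ => ?_
        have h0 : (0 : ℝ) < (k : ℝ) + 1 := by positivity
        have h1 : ((k : ℝ) + 1) ^ (-p) =
            ((k : ℝ) + 1) ^ (d - 1) * ((k : ℝ) + 1) ^ (-((d : ℝ) - 1 + p)) := by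
          rw [← Real.rpow_natCast, ← Real.rpow_add h0]
          congr 1; push_cast [Nat.cast_sub hd]; ring
        rw [h1]; ring

/-- `∑_{k < ⌈R⌉} (k+1)^{-ε}`. -/
noncomputable def powSum (ε R : ℝ) : ℝ := ∑ k ∈ Finset.range ⌈R⌉₊, ((k : ℝ) + 1) ^ (-ε)

theorem exists_sum_jap_rpow_le {d : ℕ} (hd : 1 ≤ d) {ε : ℝ} (hε : 0 ≤ ε) :
    ∃ C : ℝ, 0 < C ∧ ∀ (R : ℝ) (F : Finset (Fin d → ℤ)), (∀ y ∈ F, jap y ≤ R) →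
      ∑ y ∈ F, jap y ^ (1 - (d : ℝ) - ε) ≤ C * powSum ε R := by
  have hd' : (1 : ℝ) ≤ d := by exact_mod_cast hd
  refine ⟨2 * d * 2 ^ (d - 1) * 2 ^ ((d : ℝ) - 1 + ε), by positivity, fun R F hF => ?_⟩
  refine (sum_jap_rpow_le_sum_image hd F (by linarith)).trans ?_
  refine mul_le_mul_of_nonneg_left ?_ (by positivity)
  refine Finset.sum_le_sum_of_subset_of_nonneg ?_ fun _ _ _ => by positivity
  intro k hk
  obtain ⟨x, hx, rfl⟩ := Finset.mem_image.1 hk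
  rw [Finset.mem_range, Nat.lt_ceil]
  linarith [supN_le_latNorm x, latNorm_lt_jap x, hF x hx]

theorem powSum_zero_le {R : ℝ} (hR : 1 ≤ R) : powSum 0 R ≤ 2 * R := by
  simp only [powSum, neg_zero, Real.rpow_zero, Finset.sum_const, Finset.card_range, nsmul_eq_mul,
    mul_one]
  linarith [Nat.ceil_lt_add_one (by linarith : 0 ≤ R)]

/-- Each of the ⌈R⌉ terms is at least ⌈R⌉^(-ε). This lets `powSum` absorb pure power errors, so that
ε < 1 and ε = 1 are treated together until the very end. -/
theorem rpow_le_powSum {ε R : ℝ} (hε0 : 0 ≤ ε) (hε : ε ≤ 1) (hR : 1 ≤ R) :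
    R ^ (1 - ε) ≤ powSum ε R := by
  have hn : (0 : ℝ) < ⌈R⌉₊ := by exact_mod_cast Nat.ceil_pos.2 (by linarith)
  calc R ^ (1 - ε) ≤ (⌈R⌉₊ : ℝ) ^ (1 - ε) :=
        Real.rpow_le_rpow (by linarith) (Nat.le_ceil R) (by linarith)
    _ = ∑ _k ∈ Finset.range ⌈R⌉₊, (⌈R⌉₊ : ℝ) ^ (-ε) := by
        rw [Finset.sum_const, Finset.card_range, nsmul_eq_mul, sub_eq_add_neg,
          Real.rpow_add hn, Real.rpow_one]
    _ ≤ powSum ε R := by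
        refine Finset.sum_le_sum fun k hk => ?_
        refine Real.rpow_le_rpow_of_nonpos (by positivity) ?_ (by linarith)
        exact_mod_cast Finset.mem_range.1 hk

/-- Induction replaces the integral comparison: Bernoulli's inequality for the concave power 1 - ε
bounds n^(1-ε) by the tangent at n + 1. -/
theorem sum_range_rpow_neg_le {ε : ℝ} (hε0 : 0 ≤ ε) (hε : ε < 1) (n : ℕ) :
    ∑ k ∈ Finset.range n, ((k : ℝ) + 1) ^ (-ε) ≤ (n : ℝ) ^ (1 - ε) / (1 - ε) := by
  induction n with
  | zero =>
    have h3 : 0 < 1 - ε := by linarith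
    simp [Real.zero_rpow h3.ne']
  | succ n ih =>
    rw [Finset.sum_range_succ]
    have h0 : (0 : ℝ) < (n : ℝ) + 1 := by positivity
    have h1 : (n : ℝ) ^ (1 - ε) ≤ ((n : ℝ) + 1) ^ (1 - ε) * (1 - (1 - ε) / ((n : ℝ) + 1)) := by
      have e : (n : ℝ) = ((n : ℝ) + 1) * (1 + -(1 / ((n : ℝ) + 1))) := by field_simp; ring
      have hle : 1 / ((n : ℝ) + 1) ≤ 1 := by
        rw [div_le_one h0]; linarith [Nat.cast_nonneg (α := ℝ) n]
      calc (n : ℝ) ^ (1 - ε) = (((n : ℝ) + 1) * (1 + -(1 / ((n : ℝ) + 1)))) ^ (1 - ε) := by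
            rw [← e]
        _ = ((n : ℝ) + 1) ^ (1 - ε) * (1 + -(1 / ((n : ℝ) + 1))) ^ (1 - ε) :=
            Real.mul_rpow h0.le (by linarith)
        _ ≤ ((n : ℝ) + 1) ^ (1 - ε) * (1 + (1 - ε) * -(1 / ((n : ℝ) + 1))) := by
            gcongr
            exact rpow_one_add_le_one_add_mul_self (by linarith) (by linarith) (by linarith)
        _ = _ := by ring
    have h2 : ((n : ℝ) + 1) ^ (-ε) = ((n : ℝ) + 1) ^ (1 - ε) / ((n : ℝ) + 1) := by
      rw [← Real.rpow_sub_one h0.ne']; congr 1; ring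
    have h3 : 0 < 1 - ε := by linarith
    push_cast
    rw [h2]
    rw [le_div_iff₀ h3] at ih ⊢
    have h4 : ((n : ℝ) + 1) ^ (1 - ε) * (1 - (1 - ε) / ((n : ℝ) + 1)) =
      ((n : ℝ) + 1) ^ (1 - ε) - ((n : ℝ) + 1) ^ (1 - ε) / ((n : ℝ) + 1) * (1 - ε) := by ring
    rw [add_mul]; linarith

theorem exists_powSum_le_rpow {ε : ℝ} (hε0 : 0 ≤ ε) (hε : ε < 1) :
    ∃ C : ℝ, 0 < C ∧ ∀ R : ℝ, 1 ≤ R → powSum ε R ≤ C * R ^ (1 - ε) := by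
  have h3 : 0 < 1 - ε := by linarith
  refine ⟨2 ^ (1 - ε) / (1 - ε), by positivity, fun R hR => ?_⟩
  refine (sum_range_rpow_neg_le hε0 hε _).trans ?_
  rw [div_mul_eq_mul_div, ← Real.mul_rpow (by norm_num) (by linarith)]
  gcongr
  linarith [Nat.ceil_lt_add_one (by linarith : 0 ≤ R)]

theorem powSum_one_le {R : ℝ} (hR : 1 ≤ R) : powSum 1 R ≤ 1 + Real.log (2 * R) := by
  have h : powSum 1 R = (harmonic ⌈R⌉₊ : ℝ) := by
    simp [powSum, harmonic, Real.rpow_neg_one]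
  rw [h]
  have hn : (0 : ℝ) < ⌈R⌉₊ := by exact_mod_cast Nat.ceil_pos.2 (by linarith)
  refine (harmonic_le_one_add_log _).trans ?_
  gcongr
  linarith [Nat.ceil_lt_add_one (by linarith : 0 ≤ R)]

/-- Makes the tail sums telescope. The gain comes from Bernoulli's inequality for (m/(m+1))^ε with m
= k + 1; the factor 4 is a generous bound for (m+1)/m. -/
theorem rpow_neg_sub_rpow_neg_ge {ε : ℝ} (hε0 : 0 < ε) (hε : ε ≤ 1) (k : ℕ) :
    ((k : ℝ) + 1) ^ (-1 - ε) ≤ 4 / ε * (((k : ℝ) + 1) ^ (-ε) - ((k + 1 : ℕ) + 1 : ℝ) ^ (-ε)) := by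
  push_cast
  set m : ℝ := (k : ℝ) + 1 with hm
  have hm1 : 1 ≤ m := by rw [hm]; linarith [Nat.cast_nonneg (α := ℝ) k]
  have hm0 : 0 < m := by linarith
  have h1 : (m / (m + 1)) ^ ε ≤ 1 - ε / (m + 1) := by
    have e : m / (m + 1) = 1 + -(1 / (m + 1)) := by field_simp; ring
    have hle : 1 / (m + 1) ≤ 1 := by rw [div_le_one (by linarith)]; linarith
    rw [e]
    exact (rpow_one_add_le_one_add_mul_self (by linarith) hε0.le hε).trans (by ring_nf; rfl)
  have h2 : (m + 1) ^ (-ε) = m ^ (-ε) * (m / (m + 1)) ^ ε := by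
    rw [Real.div_rpow hm0.le (by linarith), Real.rpow_neg hm0.le, Real.rpow_neg (by linarith)]
    field_simp
  have h3 : m ^ (-1 - ε) = m ^ (-ε) / m := by
    rw [← Real.rpow_sub_one hm0.ne']; congr 1; ring
  have hp : 0 < m ^ (-ε) := by positivity
  rw [h2, h3]
  have h4 : m ^ (-ε) * (ε / (m + 1)) ≤ m ^ (-ε) - m ^ (-ε) * (m / (m + 1)) ^ ε := by nlinarith
  calc m ^ (-ε) / m ≤ 4 / ε * (m ^ (-ε) * (ε / (m + 1))) := by
        have : 4 / ε * (m ^ (-ε) * (ε / (m + 1))) = m ^ (-ε) * (4 / (m + 1)) := by field_simp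
        have h5 : 1 / m ≤ 4 / (m + 1) := by
          rw [div_le_div_iff₀ hm0 (by linarith)]; linarith
        rw [this, div_eq_mul_one_div]
        exact mul_le_mul_of_nonneg_left h5 hp.le
    _ ≤ _ := by gcongr

theorem sum_tail_rpow_le {ε : ℝ} (hε0 : 0 < ε) (hε : ε ≤ 1) {r : ℝ} (hr : 0 < r) (S : Finset ℕ)
    (hS : ∀ k ∈ S, r ≤ (k : ℝ) + 1) :
    ∑ k ∈ S, ((k : ℝ) + 1) ^ (-1 - ε) ≤ 4 / ε * r ^ (-ε) := by
  rcases S.eq_empty_or_nonempty with rfl | hne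
  · simp; positivity
  set m := S.min' hne
  set N := S.max' hne
  have hsub : S ⊆ Finset.Ico m (N + 1) := fun k hk =>
    Finset.mem_Ico.2 ⟨S.min'_le k hk, Nat.lt_succ_of_le (S.le_max' k hk)⟩
  have hmN : m ≤ N + 1 := (S.min'_le _ (S.max'_mem hne)).trans (Nat.le_succ _)
  calc ∑ k ∈ S, ((k : ℝ) + 1) ^ (-1 - ε)
      ≤ ∑ k ∈ Finset.Ico m (N + 1), ((k : ℝ) + 1) ^ (-1 - ε) :=
        Finset.sum_le_sum_of_subset_of_nonneg hsub fun _ _ _ => by positivity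
    _ ≤ ∑ k ∈ Finset.Ico m (N + 1),
          4 / ε * (((k : ℝ) + 1) ^ (-ε) - ((k + 1 : ℕ) + 1 : ℝ) ^ (-ε)) :=
        Finset.sum_le_sum fun k _ => rpow_neg_sub_rpow_neg_ge hε0 hε k
    _ = 4 / ε * (((m : ℝ) + 1) ^ (-ε) - ((N + 1 : ℕ) + 1 : ℝ) ^ (-ε)) := by
        rw [← Finset.mul_sum]
        congr 1
        have := Finset.sum_Ico_sub (fun k : ℕ => -((k : ℝ) + 1) ^ (-ε)) hmN
        rw [Finset.sum_congr rfl (g := fun k : ℕ => -(((k + 1 : ℕ) : ℝ) + 1) ^ (-ε) -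
          -((k : ℝ) + 1) ^ (-ε)) (fun k _ => by ring), this]
        ring
    _ ≤ 4 / ε * r ^ (-ε) := by
        gcongr
        have h1 : ((m : ℝ) + 1) ^ (-ε) ≤ r ^ (-ε) :=
          Real.rpow_le_rpow_of_nonpos hr (hS m (S.min'_mem hne)) (by linarith)
        have h2 : (0 : ℝ) ≤ ((N + 1 : ℕ) + 1 : ℝ) ^ (-ε) := by positivity
        linarith

theorem exists_sum_tail_jap_rpow_le {d : ℕ} (hd : 1 ≤ d) {ε : ℝ} (hε0 : 0 < ε) (hε : ε ≤ 1) :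
    ∃ C : ℝ, 0 < C ∧ ∀ (R : ℝ) (F : Finset (Fin d → ℤ)), 0 < R → (∀ y ∈ F, R ≤ jap y) →
      ∑ y ∈ F, jap y ^ (-(d : ℝ) - ε) ≤ C * R ^ (-ε) := by
  have hd' : (1 : ℝ) ≤ d := by exact_mod_cast hd
  refine ⟨2 * d * 2 ^ (d - 1) * 2 ^ ((d : ℝ) - 1 + (1 + ε)) * (4 / ε * ((d : ℝ) + 1) ^ ε),
    by positivity, fun R F hR hF => ?_⟩
  have h1 := sum_jap_rpow_le_sum_image hd F (p := 1 + ε) (by linarith)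
  have e : 1 - (d : ℝ) - (1 + ε) = -(d : ℝ) - ε := by ring
  have e' : -(1 + ε) = -1 - ε := by ring
  rw [e, e'] at h1
  refine h1.trans ?_
  rw [mul_assoc _ _ (R ^ (-ε))]
  refine mul_le_mul_of_nonneg_left ?_ (by positivity)
  refine (sum_tail_rpow_le hε0 hε (r := R / (d + 1)) (by positivity) _ ?_).trans ?_
  · intro k hk
    obtain ⟨x, hx, rfl⟩ := Finset.mem_image.1 hk
    rw [div_le_iff₀ (by positivity)]
    linarith [hF x hx, jap_le_supN x]
  · rw [Real.div_rpow hR.le (by positivity), Real.rpow_neg (by positivity : (0 : ℝ) ≤ (d : ℝ) + 1)]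
    rw [div_inv_eq_mul, mul_assoc]
    exact le_of_eq (by ring)

theorem summable_jap_rpow {d : ℕ} (hd : 1 ≤ d) {ε : ℝ} (hε0 : 0 < ε) (hε : ε ≤ 1) :
    Summable fun y : Fin d → ℤ => jap y ^ (-(d : ℝ) - ε) := by
  obtain ⟨C, -, hC⟩ := exists_sum_tail_jap_rpow_le hd hε0 hε
  exact summable_of_sum_le (fun y => Real.rpow_nonneg (jap_pos y).le _)
    fun F => hC 1 F one_pos fun y _ => one_le_jap y

/-! ### The limit |x| → ∞ as the cofinite filter. -/

theorem finite_latSq_le {d : ℕ} (R : ℝ) : {x : Fin d → ℤ | latSq x ≤ R}.Finite := by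
  have : {x : Fin d → ℤ | latSq x ≤ R} ⊆
      Set.pi Set.univ fun _ => Set.Icc (-(⌈R⌉₊ : ℤ)) ⌈R⌉₊ := by
    intro x hx j _
    have h1 : (x j : ℝ) ^ 2 ≤ latSq x := Finset.single_le_sum (f := fun j => (x j : ℝ) ^ 2)
      (fun _ _ => sq_nonneg _) (Finset.mem_univ j)
    have h2 : ((x j ^ 2 : ℤ) : ℝ) ≤ ((⌈R⌉₊ : ℤ) : ℝ) := by
      push_cast; exact (h1.trans hx).trans (Nat.le_ceil R)
    have h3 : x j ^ 2 ≤ (⌈R⌉₊ : ℤ) := by exact_mod_cast h2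
    constructor <;> nlinarith
  exact (Set.Finite.pi' fun _ => Set.finite_Icc _ _).subset
    (fun x hx j => this hx j (Set.mem_univ j))

theorem tendsto_latSq {d : ℕ} : Tendsto (latSq (d := d)) cofinite atTop := by
  refine tendsto_atTop.2 fun b => ?_
  rw [eventually_cofinite]
  exact (finite_latSq_le b).subset fun x hx => (not_le.1 hx).le

theorem tendsto_latNorm {d : ℕ} : Tendsto (latNorm (d := d)) cofinite atTop :=
  Real.tendsto_sqrt_atTop.comp tendsto_latSq

theorem tendsto_jap {d : ℕ} : Tendsto (jap (d := d)) cofinite atTop :=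
  tendsto_atTop_mono (fun x => (latNorm_lt_jap x).le) tendsto_latNorm

theorem latInfty_eq_cofinite (d : ℕ) : latInfty d = cofinite := by
  refine le_antisymm ?_ tendsto_latNorm.le_comap
  intro s hs
  have hfin : sᶜ.Finite := hs
  obtain ⟨B, hB⟩ := (hfin.image latNorm).bddAbove
  refine mem_comap.2 ⟨Set.Ioi B, Ioi_mem_atTop B, fun x hx => ?_⟩
  by_contra hxs
  exact absurd (hB (Set.mem_image_of_mem _ hxs)) (not_le.2 hx)

/-! ### The lattice Laplacian of powers of a + |x|². -/

/-- The lattice Laplacian of a real function. -/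
noncomputable def latLap {d : ℕ} (u : (Fin d → ℤ) → ℝ) (x : Fin d → ℤ) : ℝ :=
  ∑ j : Fin d, ((u (x + Pi.single j 1) - u x) + (u (x - Pi.single j 1) - u x))

theorem latSq_add_single {d : ℕ} (x : Fin d → ℤ) (j : Fin d) :
    latSq (x + Pi.single j 1) = latSq x + (1 + 2 * x j) := by
  have h : latSq (x + Pi.single j 1) - latSq x = 1 + 2 * x j := by
    rw [latSq, latSq, ← Finset.sum_sub_distrib, Finset.sum_eq_single j]
    · simp; ring
    · intro i _ hi; simp [hi]
    · simp
  linarith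

theorem latSq_sub_single {d : ℕ} (x : Fin d → ℤ) (j : Fin d) :
    latSq (x - Pi.single j 1) = latSq x + (1 - 2 * x j) := by
  have h := latSq_add_single (x - Pi.single j 1) j
  simp only [sub_add_cancel, Pi.sub_apply, Pi.single_eq_same] at h
  push_cast at h
  linarith

theorem coord_sq_le_latSq {d : ℕ} (x : Fin d → ℤ) (j : Fin d) : (x j : ℝ) ^ 2 ≤ latSq x :=
  Finset.single_le_sum (f := fun j => (x j : ℝ) ^ 2) (fun _ _ => sq_nonneg _) (Finset.mem_univ j)

/-- Third order Taylor expansion of `(1+t)^{-s}` at `0`. -/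
theorem exists_one_add_rpow_taylor (s : ℝ) : ∃ C δ : ℝ, 0 ≤ C ∧ 0 < δ ∧ δ < 1 ∧ ∀ t : ℝ, |t| ≤ δ →
    |(1 + t) ^ (-s) - (1 - s * t + s * (s + 1) / 2 * t ^ 2
      - s * (s + 1) * (s + 2) / 6 * t ^ 3)| ≤ C * t ^ 4 := by
  have h := (Real.one_add_rpow_hasFPowerSeriesAt_zero (a := -s)).isBigO_sub_partialSum_pow 4
  obtain ⟨C, hC0, hC⟩ := h.exists_nonneg
  rw [isBigOWith_iff, Metric.eventually_nhds_iff] at hC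
  obtain ⟨r, hr, hC⟩ := hC
  refine ⟨C, min (r / 2) (1 / 2), hC0, by positivity, ?_, fun t ht => ?_⟩
  · exact (min_le_right _ _).trans_lt (by norm_num)
  have ht' : dist t 0 < r := by
    rw [Real.dist_eq, sub_zero]
    linarith [min_le_left (r / 2) (1 / 2 : ℝ)]
  have := hC ht'
  have e4 : ‖‖t‖ ^ 4‖ = t ^ 4 := by
    rw [norm_pow, norm_norm, Real.norm_eq_abs]; exact Even.pow_abs (by decide) t
  rw [e4, Real.norm_eq_abs] at this
  convert this using 2
  simp only [zero_add, FormalMultilinearSeries.partialSum, binomialSeries_apply, smul_eq_mul,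
    Finset.sum_range_succ, Finset.sum_range_zero, Ring.choose_zero_right, Ring.choose_one_right,
    List.ofFn_const, List.prod_replicate]
  have c2 : Ring.choose (-s) 2 = s * (s + 1) / 2 := by
    rw [Ring.choose_eq_smul, ← Polynomial.aeval_eq_smeval]
    simp [descPochhammer_succ_right, Nat.factorial]
    ring
  have c3 : Ring.choose (-s) 3 = -(s * (s + 1) * (s + 2) / 6) := by
    rw [Ring.choose_eq_smul, ← Polynomial.aeval_eq_smeval]
    have h2 : Polynomial.aeval (-s) (2 : Polynomial ℤ) = 2 := map_ofNat _ 2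
    simp [descPochhammer_succ_right, Nat.factorial, h2]
    ring
  rw [c2, c3]
  ring

/-- A step ±e_j changes ρ = a + |x|² by 1 ± 2x_j. Insert this in the Taylor expansion: odd powers of
x_j cancel between the two signs, and |x|² = ρ - a in the quadratic term produces both displayed
terms. The rest is O(ρ^(-s-2)) with a constant free of a, which is why the term carrying a is kept
apart: for large a it dominates the error. -/
theorem latLap_rpow_aux {d : ℕ} {s C δ : ℝ} (hs : 0 < s) (hC : 0 ≤ C)
    (h : ∀ t : ℝ, |t| ≤ δ →
    |(1 + t) ^ (-s) - (1 - s * t + s * (s + 1) / 2 * t ^ 2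
      - s * (s + 1) * (s + 2) / 6 * t ^ 3)| ≤ C * t ^ 4) (hδ : δ < 1)
    {a : ℝ} (ha : 1 ≤ a) (x : Fin d → ℤ)
    (hx : ∀ j, |(1 + 2 * x j : ℝ)| ≤ δ * (a + latSq x) ∧ |(1 - 2 * x j : ℝ)| ≤ δ * (a + latSq x)) :
    |latLap (fun x => (a + latSq x) ^ (-s)) x -
      (2 * s * (2 * s + 2 - d) * (a + latSq x) ^ (-s - 1)
        - 4 * a * s * (s + 1) * (a + latSq x) ^ (-s - 2))| ≤
      (s * (s + 1) * d + s * (s + 1) * (s + 2) / 6 * (2 * d + 24) + C * (2 * d + 80)) *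
        (a + latSq x) ^ (-s - 2) := by
  have hq := latSq_nonneg x
  set q := latSq x with hqdef
  set ρ := a + q with hρ
  have hρ1 : 1 ≤ ρ := by linarith
  have hρ0 : 0 < ρ := by linarith
  have key : ∀ k : ℝ, |k| ≤ δ * ρ → |(ρ + k) ^ (-s) - ρ ^ (-s) * (1 - s * (k / ρ) +
      s * (s + 1) / 2 * (k / ρ) ^ 2 - s * (s + 1) * (s + 2) / 6 * (k / ρ) ^ 3)| ≤
      ρ ^ (-s) * (C * (k / ρ) ^ 4) := by
    intro k hk
    have h1 : |k / ρ| ≤ δ := by rw [abs_div, abs_of_pos hρ0]; exact (div_le_iff₀ hρ0).2 hk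
    have h2 : (ρ + k) = ρ * (1 + k / ρ) := by field_simp
    have h3 : 0 ≤ 1 + k / ρ := by linarith [(abs_le.1 h1).1]
    rw [h2, Real.mul_rpow hρ0.le h3, ← mul_sub, abs_mul, abs_of_pos (by positivity)]
    exact mul_le_mul_of_nonneg_left (h _ h1) (by positivity)
  have e1 : ρ ^ (-s - 1) = ρ ^ (-s) / ρ := Real.rpow_sub_one hρ0.ne' _
  have e2 : ρ ^ (-s - 2) = ρ ^ (-s) / ρ ^ 2 := by
    rw [Real.rpow_sub hρ0]; norm_num
  have hP : 0 < ρ ^ (-s) := by positivity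
  set P := ρ ^ (-s) with hPdef
  have hsum1 : ∑ j, (x j : ℝ) ^ 2 = q := rfl
  have hsum2 : ∑ j, (x j : ℝ) ^ 4 ≤ q ^ 2 := by
    calc ∑ j, (x j : ℝ) ^ 4 ≤ ∑ j, (x j : ℝ) ^ 2 * q := by
          refine Finset.sum_le_sum fun j _ => ?_
          nlinarith [mul_le_mul_of_nonneg_left (coord_sq_le_latSq x j) (sq_nonneg (x j : ℝ))]
      _ = q ^ 2 := by rw [← Finset.sum_mul, hsum1]; ring
  let M : Fin d → ℝ := fun j => P * (-s * (2 / ρ) + s * (s + 1) / 2 * ((2 + 8 * (x j : ℝ) ^ 2) / ρ ^ 2)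
    - s * (s + 1) * (s + 2) / 6 * ((2 + 24 * (x j : ℝ) ^ 2) / ρ ^ 3))
  let E : Fin d → ℝ := fun j => P * (C * ((2 + 48 * (x j : ℝ) ^ 2 + 32 * (x j : ℝ) ^ 4) / ρ ^ 4))
  have hterm : ∀ j, |(((a + latSq (x + Pi.single j 1)) ^ (-s) - P) +
      ((a + latSq (x - Pi.single j 1)) ^ (-s) - P)) - M j| ≤ E j := by
    intro j
    have r1 : a + latSq (x + Pi.single j 1) = ρ + (1 + 2 * x j) := by
      rw [latSq_add_single, hρ, ← hqdef]; ring
    have r2 : a + latSq (x - Pi.single j 1) = ρ + (1 - 2 * x j) := by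
      rw [latSq_sub_single, hρ, ← hqdef]; ring
    rw [r1, r2]
    have k1 := key _ (hx j).1
    have k2 := key _ (hx j).2
    rw [abs_le] at k1 k2 ⊢
    have hM : M j = P * (1 - s * ((1 + 2 * (x j : ℝ)) / ρ) +
      s * (s + 1) / 2 * ((1 + 2 * (x j : ℝ)) / ρ) ^ 2
      - s * (s + 1) * (s + 2) / 6 * ((1 + 2 * (x j : ℝ)) / ρ) ^ 3)
      + P * (1 - s * ((1 - 2 * (x j : ℝ)) / ρ) +
      s * (s + 1) / 2 * ((1 - 2 * (x j : ℝ)) / ρ) ^ 2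
      - s * (s + 1) * (s + 2) / 6 * ((1 - 2 * (x j : ℝ)) / ρ) ^ 3) - 2 * P := by
      simp only [M]; field_simp; ring
    have hE : E j = P * (C * ((1 + 2 * (x j : ℝ)) / ρ) ^ 4) +
      P * (C * ((1 - 2 * (x j : ℝ)) / ρ) ^ 4) := by
      simp only [E]; field_simp; ring
    rw [hM, hE]
    constructor <;> linarith [k1.1, k1.2, k2.1, k2.2]
  have hlap : |latLap (fun x => (a + latSq x) ^ (-s)) x - ∑ j, M j| ≤ ∑ j, E j := by
    rw [latLap, ← Finset.sum_sub_distrib]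
    exact (Finset.abs_sum_le_sum_abs _ _).trans (Finset.sum_le_sum fun j _ => hterm j)
  have hMs : ∑ j, M j = P * (-s * (2 * d / ρ) + s * (s + 1) / 2 * ((2 * d + 8 * q) / ρ ^ 2)
    - s * (s + 1) * (s + 2) / 6 * ((2 * d + 24 * q) / ρ ^ 3)) := by
    simp only [M, ← hsum1, Finset.sum_add_distrib, Finset.sum_sub_distrib,
      ← Finset.sum_div, mul_add, mul_sub, add_div, ← Finset.mul_sum, Finset.sum_const,
      Finset.card_univ, Fintype.card_fin, nsmul_eq_mul]
    ring
  have hEs : ∑ j, E j ≤ C * (2 * d + 80) * (P / ρ ^ 2) := by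
    have : ∑ j, E j = P * (C * ((2 * d + 48 * q + 32 * ∑ j, (x j : ℝ) ^ 4) / ρ ^ 4)) := by
      simp only [E, ← hsum1, Finset.sum_add_distrib,
      ← Finset.sum_div, mul_add, add_div, ← Finset.mul_sum, Finset.sum_const,
      Finset.card_univ, Fintype.card_fin, nsmul_eq_mul]
      ring
    rw [this]
    have hd0 : (0 : ℝ) ≤ d := Nat.cast_nonneg d
    have h1 : 2 * d + 48 * q + 32 * ∑ j, (x j : ℝ) ^ 4 ≤ (2 * d + 80) * ρ ^ 2 := by
      have hρ2 : 1 ≤ ρ ^ 2 := by nlinarith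
      have hqρ : q ≤ ρ ^ 2 := by nlinarith
      have hqρ2 : q ^ 2 ≤ ρ ^ 2 := pow_le_pow_left₀ hq (by linarith) 2
      nlinarith [mul_le_mul_of_nonneg_left hρ2 hd0]
    calc P * (C * ((2 * d + 48 * q + 32 * ∑ j, (x j : ℝ) ^ 4) / ρ ^ 4))
        ≤ P * (C * (((2 * d + 80) * ρ ^ 2) / ρ ^ 4)) := by gcongr
      _ = _ := by field_simp
  rw [e1, e2]
  have hmain : |∑ j, M j - (2 * s * (2 * s + 2 - d) * (P / ρ) - 4 * a * s * (s + 1) * (P / ρ ^ 2))|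
      ≤ (s * (s + 1) * d + s * (s + 1) * (s + 2) / 6 * (2 * d + 24)) * (P / ρ ^ 2) := by
    have hd0 : (0 : ℝ) ≤ d := Nat.cast_nonneg d
    have haq : a = ρ - q := by rw [hρ]; ring
    have : ∑ j, M j - (2 * s * (2 * s + 2 - d) * (P / ρ) - 4 * a * s * (s + 1) * (P / ρ ^ 2)) =
        s * (s + 1) * d * (P / ρ ^ 2) -
          s * (s + 1) * (s + 2) / 6 * (((2 * d + 24 * q) / ρ) * (P / ρ ^ 2)) := by
      rw [hMs, haq]; field_simp; ring
    rw [this]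
    have h1 : (2 * d + 24 * q) / ρ ≤ 2 * d + 24 := by
      rw [div_le_iff₀ hρ0]; nlinarith
    have h2 : 0 ≤ (2 * d + 24 * q) / ρ := by positivity
    have h3 : ((2 * d + 24 * q) / ρ) * (P / ρ ^ 2) ≤ (2 * d + 24) * (P / ρ ^ 2) := by gcongr
    have h4 : 0 ≤ s * (s + 1) * (s + 2) / 6 * (((2 * d + 24 * q) / ρ) * (P / ρ ^ 2)) := by positivity
    have h5 : s * (s + 1) * (s + 2) / 6 * (((2 * d + 24 * q) / ρ) * (P / ρ ^ 2)) ≤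
      s * (s + 1) * (s + 2) / 6 * ((2 * d + 24) * (P / ρ ^ 2)) := by gcongr
    have h6 : 0 ≤ s * (s + 1) * d * (P / ρ ^ 2) := by positivity
    rw [abs_le, add_mul]
    constructor <;> linarith
  calc _ ≤ |latLap (fun x => (a + latSq x) ^ (-s)) x - ∑ j, M j| +
        |∑ j, M j - (2 * s * (2 * s + 2 - d) * (P / ρ) - 4 * a * s * (s + 1) * (P / ρ ^ 2))| :=
        abs_sub_le _ _ _
    _ ≤ _ := by rw [add_mul _ (C * _)]; linarith

/-- The lattice Laplacian of `(a + |x|²)^{-s}`, with an error uniform in `a`. -/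
theorem exists_latLap_rpow (d : ℕ) {s : ℝ} (hs : 0 < s) : ∃ C A : ℝ, 0 < C ∧ 1 < A ∧
    ∀ a : ℝ, A ≤ a → ∀ x : Fin d → ℤ, |latLap (fun x => (a + latSq x) ^ (-s)) x -
      (2 * s * (2 * s + 2 - d) * (a + latSq x) ^ (-s - 1)
        - 4 * a * s * (s + 1) * (a + latSq x) ^ (-s - 2))| ≤ C * (a + latSq x) ^ (-s - 2) := by
  obtain ⟨C, δ, hC, hδ, hδ1, h⟩ := exists_one_add_rpow_taylor s
  refine ⟨s * (s + 1) * d + s * (s + 1) * (s + 2) / 6 * (2 * d + 24) + C * (2 * d + 80),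
    1 + (1 + 1 / δ) / δ, by positivity, by simp; positivity, fun a ha x => ?_⟩
  have hle : 0 < (1 + 1 / δ) / δ := by positivity
  -- For a above the threshold, δa ≥ 1 + 1/δ; with 2|k| ≤ δk² + 1/δ this keeps the Taylor variable
  -- (1 ± 2x_j)/ρ in [-δ, δ] at every lattice point, including those near the origin.
  have hb : ∀ k : ℝ, k ^ 2 ≤ latSq x → |1 + 2 * k| ≤ δ * (a + latSq x) := by
    intro k hk
    have h1 : 1 + 1 / δ ≤ δ * a := by
      have : (1 + 1 / δ) / δ ≤ a := by linarith
      rwa [div_le_iff₀ hδ, mul_comm] at this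
    have h2 : 2 * |k| ≤ δ * k ^ 2 + 1 / δ := by
      have : 0 ≤ (δ * |k| - 1) ^ 2 / δ := by positivity
      have e : (δ * |k| - 1) ^ 2 / δ = δ * k ^ 2 + 1 / δ - 2 * |k| := by
        rw [← sq_abs k]; field_simp; ring
      linarith
    have h3 : |1 + 2 * k| ≤ 1 + 2 * |k| := by
      refine (abs_add_le _ _).trans ?_
      rw [abs_mul]; norm_num
    nlinarith
  refine latLap_rpow_aux hs hC h hδ1 (by linarith) x fun j => ⟨hb _ (coord_sq_le_latSq x j), ?_⟩
  have := hb (-(x j : ℝ)) (by rw [neg_sq]; exact coord_sq_le_latSq x j)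
  rwa [mul_neg, ← sub_eq_add_neg] at this

/-! ### Comparison principle and Green-function decay of vanishing subsolutions. -/

theorem latLap_add {d : ℕ} (f g : (Fin d → ℤ) → ℝ) (x : Fin d → ℤ) :
    latLap (fun z => f z + g z) x = latLap f x + latLap g x := by
  simp only [latLap, ← Finset.sum_add_distrib]
  exact Finset.sum_congr rfl fun _ _ => by ring

theorem latLap_sub {d : ℕ} (f g : (Fin d → ℤ) → ℝ) (x : Fin d → ℤ) :
    latLap (fun z => f z - g z) x = latLap f x - latLap g x := by
  simp only [latLap, ← Finset.sum_sub_distrib]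
  exact Finset.sum_congr rfl fun _ _ => by ring

theorem latLap_const_mul {d : ℕ} (c : ℝ) (f : (Fin d → ℤ) → ℝ) (x : Fin d → ℤ) :
    latLap (fun z => c * f z) x = c * latLap f x := by
  simp only [latLap, Finset.mul_sum]
  exact Finset.sum_congr rfl fun _ _ => by ring

theorem latLap_const {d : ℕ} (c : ℝ) (x : Fin d → ℤ) : latLap (fun _ => c) x = 0 := by
  simp [latLap]

theorem latLap_comp_add {d : ℕ} (f : (Fin d → ℤ) → ℝ) (x₀ x : Fin d → ℤ) :
    latLap (fun z => f (x₀ + z)) x = latLap f (x₀ + x) := by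
  simp only [latLap, add_assoc, add_sub_assoc]

theorem latLap_le_of_touch {d : ℕ} {f g : (Fin d → ℤ) → ℝ} {p : Fin d → ℤ}
    (h : ∀ y, f y ≤ g y) (hp : f p = g p) : latLap f p ≤ latLap g p :=
  Finset.sum_le_sum fun j _ => by
    linarith [h (p + Pi.single j 1), h (p - Pi.single j 1)]

theorem eventually_rpow_lt_rpow {d : ℕ} (a K : ℝ) {c p q : ℝ} (hc : 0 < c) (hpq : q < p) :
    ∀ᶠ x : Fin d → ℤ in cofinite, K * (a + latSq x) ^ (-p) < c * (a + latSq x) ^ (-q) := by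
  have hρ : Tendsto (fun x : Fin d → ℤ => a + latSq x) cofinite atTop :=
    tendsto_atTop_add_const_left _ _ tendsto_latSq
  have h0 := ((tendsto_rpow_neg_atTop (sub_pos.2 hpq)).comp hρ).const_mul K
  rw [mul_zero] at h0
  filter_upwards [h0.eventually (gt_mem_nhds hc), hρ.eventually_gt_atTop 0] with x hx hx0
  have e : (a + latSq x) ^ (-p) = (a + latSq x) ^ (-(p - q)) * (a + latSq x) ^ (-q) := by
    rw [← Real.rpow_add hx0]; congr 1; ring
  rw [e, ← mul_assoc]
  exact mul_lt_mul_of_pos_right hx (by positivity)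

theorem jap_rpow_eq {d : ℕ} (x : Fin d → ℤ) (s : ℝ) : jap x ^ (2 * s) = (1 + latSq x) ^ s := by
  rw [← jap_sq, ← Real.rpow_natCast, ← Real.rpow_mul (jap_pos x).le]; norm_num

theorem rpow_neg_le_jap {d : ℕ} {a s : ℝ} (ha : 1 ≤ a) (hs : 0 ≤ s) (x : Fin d → ℤ) :
    (a + latSq x) ^ (-s) ≤ jap x ^ (-(2 * s)) := by
  rw [← mul_neg, jap_rpow_eq]
  have := latSq_nonneg x
  exact Real.rpow_le_rpow_of_nonpos (by linarith) (by linarith) (by linarith)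

theorem jap_le_rpow_neg {d : ℕ} {a s : ℝ} (ha : 1 ≤ a) (hs : 0 ≤ s) (x : Fin d → ℤ) :
    jap x ^ (-(2 * s)) ≤ a ^ s * (a + latSq x) ^ (-s) := by
  rw [← mul_neg, jap_rpow_eq]
  have h0 := latSq_nonneg x
  have h1 : a ^ s * (a + latSq x) ^ (-s) = ((a + latSq x) / a) ^ (-s) := by
    rw [Real.div_rpow (by linarith) (by linarith), Real.rpow_neg (by linarith : 0 ≤ a)]
    field_simp
  rw [h1]
  refine Real.rpow_le_rpow_of_nonpos (by positivity) ?_ (by linarith)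
  rw [div_le_iff₀ (by linarith)]
  nlinarith

/-- Comparison principle: a subsolution tending to zero lies below every positive strict
supersolution that is bounded below and dominates it off a set where the supersolution property
fails. -/
theorem le_of_subsolution_of_supersolution {d : ℕ} {w Θ P : (Fin d → ℤ) → ℝ} {δ : ℝ} (hδ : 0 < δ)
    (hlim : Tendsto w cofinite (𝓝 0)) (hΘ : ∀ x, δ ≤ Θ x)
    (hsub : ∀ x, -latLap w x ≤ P x * w x) (hsup : ∀ x, w x ≤ Θ x ∨ P x * Θ x < -latLap Θ x)
    (x : Fin d → ℤ) : w x ≤ Θ x := by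
  by_contra hx
  rw [not_le] at hx
  have hpos : ∀ x, 0 < Θ x := fun x => hδ.trans_le (hΘ x)
  -- Since w → 0 and Θ ≥ δ, only finitely many points have ratio at least 1, so a ratio exceeding 1
  -- somewhere has a maximum τ > 1, attained at some p. There τΘ touches w from above, and τ(-ΔΘ) ≤
  -- -Δw ≤ PτΘ at p contradicts strictness.
  have hfin : {x | 1 ≤ w x / Θ x}.Finite := by
    have := hlim.eventually (gt_mem_nhds hδ)
    rw [eventually_cofinite] at this
    refine this.subset fun y hy => ?_
    have hy' : 1 ≤ w y / Θ y := hy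
    rw [one_le_div (hpos y)] at hy'
    exact not_lt.2 ((hΘ y).trans hy')
  obtain ⟨p, hp, hmax⟩ := Set.exists_max_image _ (fun y => w y / Θ y) hfin
    ⟨x, ((one_lt_div (hpos x)).2 hx).le⟩
  set τ := w p / Θ p with hτ
  have hτ1 : 1 < τ := ((one_lt_div (hpos x)).2 hx).trans_le (hmax x ((one_lt_div (hpos x)).2 hx).le)
  have hwp : w p = τ * Θ p := by rw [hτ, div_mul_cancel₀ _ (hpos p).ne']
  have hle : ∀ y, w y ≤ τ * Θ y := by
    intro y
    rw [← div_le_iff₀ (hpos y)]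
    by_cases hy : 1 ≤ w y / Θ y
    · exact hmax y hy
    · linarith
  have h1 := latLap_le_of_touch (g := fun y => τ * Θ y) hle hwp
  rw [latLap_const_mul] at h1
  rcases hsup p with h | h
  · nlinarith [hpos p]
  · have h2 := hsub p
    rw [hwp] at h2
    nlinarith

/-- A subsolution of `H₀ - |V|` tending to zero decays like the Green function. -/
theorem exists_le_jap_of_subsolution {d : ℕ} (hd : 3 ≤ d) {ε : ℝ} (hε0 : 0 < ε) (hε1 : ε ≤ 1)
    {V w : (Fin d → ℤ) → ℝ} {C₀ : ℝ} (hV : ∀ x, |V x| ≤ C₀ * jap x ^ (-2 - ε))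
    (hlim : Tendsto w cofinite (𝓝 0)) (hsub : ∀ x, -latLap w x ≤ |V x| * w x) :
    ∃ C : ℝ, 0 < C ∧ ∀ x, w x ≤ C * jap x ^ (-(d : ℝ) + 2) := by
  have hd' : (3 : ℝ) ≤ d := by exact_mod_cast hd
  set α := ε / 2 with hα
  have hα0 : 0 < α := by positivity
  have hα1 : α ≤ 1 / 2 := by linarith
  -- At s₀ the leading coefficient 2s(2s+2-d) of Δρ^(-s) vanishes; at s₁ it is 2s₁α > 0, and at s₂
  -- it is negative. In terms of ρ the potential is O(ρ^(-1-α)).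
  set s₀ : ℝ := ((d : ℝ) - 2) / 2 with hs₀
  have hs₀0 : 0 < s₀ := by rw [hs₀]; linarith
  set s₁ : ℝ := s₀ + α / 2 with hs₁
  set s₂ : ℝ := α / 2 with hs₂
  have hs₁0 : 0 < s₁ := by positivity
  have hs₂0 : 0 < s₂ := by positivity
  obtain ⟨K₀, A₀, hK₀, hA₀, h₀⟩ := exists_latLap_rpow d hs₀0
  obtain ⟨K₁, A₁, hK₁, hA₁, h₁⟩ := exists_latLap_rpow d hs₁0
  obtain ⟨K₂, A₂, hK₂, hA₂, h₂⟩ := exists_latLap_rpow d hs₂0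
  set a := max A₀ (max A₁ A₂)
  have ha₀ : A₀ ≤ a := le_max_left _ _
  have ha₁ : A₁ ≤ a := (le_max_left _ _).trans (le_max_right _ _)
  have ha₂ : A₂ ≤ a := (le_max_right _ _).trans (le_max_right _ _)
  have ha : 1 < a := hA₀.trans_le ha₀
  have hρ1 : ∀ x : Fin d → ℤ, 1 < a + latSq x := fun x => by linarith [latSq_nonneg x]
  have hρ0 : ∀ x : Fin d → ℤ, 0 < a + latSq x := fun x => one_pos.trans (hρ1 x)
  have hC₀ : 0 ≤ C₀ := by
    by_contra hneg
    have h1 : 0 < jap (0 : Fin d → ℤ) ^ (-2 - ε) := Real.rpow_pos_of_pos (jap_pos _) _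
    nlinarith [hV 0, abs_nonneg (V 0)]
  set K := C₀ * a ^ (1 + α)
  have hVρ : ∀ x, |V x| ≤ K * (a + latSq x) ^ (-(1 + α)) := by
    intro x
    refine (hV x).trans ?_
    have := jap_le_rpow_neg ha.le (by linarith : 0 ≤ 1 + α) x
    have e : -(2 * (1 + α)) = -2 - ε := by rw [hα]; ring
    rw [e] at this
    rw [mul_assoc]
    exact mul_le_mul_of_nonneg_left this hC₀
  -- Subtracting ρ^(-s₁) makes -ΔΨ₁ about 2s₁α ρ^(-s₀-1-α/2), which for large |x| beats |V|Ψ₁ =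
  -- O(ρ^(-s₀-1-α)).
  set Ψ₁ : (Fin d → ℤ) → ℝ := fun x => (a + latSq x) ^ (-s₀) - (a + latSq x) ^ (-s₁) with hΨ₁
  -- Ψ₁ tends to zero, whereas the comparison principle needs a positive lower bound. A multiple δΨ₂
  -- supplies it, and δ → 0 at the end.
  set Ψ₂ : (Fin d → ℤ) → ℝ := fun x => 1 + (a + latSq x) ^ (-s₂) with hΨ₂
  have hΨ₁pos : ∀ x, 0 < Ψ₁ x := fun x => sub_pos.2
    (Real.rpow_lt_rpow_of_exponent_lt (hρ1 x) (by rw [hs₁]; linarith))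
  have hrpow_le : ∀ x : Fin d → ℤ, ∀ p q : ℝ, p ≤ q → (a + latSq x) ^ p ≤ (a + latSq x) ^ q :=
    fun x p q h => Real.rpow_le_rpow_of_exponent_le (hρ1 x).le h
  have hsup₁ : ∀ᶠ x in cofinite, |V x| * Ψ₁ x < -latLap Ψ₁ x := by
    have hc : 0 < 2 * s₁ * α := by positivity
    filter_upwards [eventually_rpow_lt_rpow (d := d) a
      (K + K₀ + (4 * a * s₁ * (s₁ + 1) + K₁)) hc (by rw [hs₁]; linarith : s₁ + 1 < s₀ + (1 + α))]
      with x hx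
    have b₀ := (abs_le.1 (h₀ a ha₀ x)).2
    have b₁ := (abs_le.1 (h₁ a ha₁ x)).1
    rw [hΨ₁, latLap_sub]
    have z0 : 2 * s₀ + 2 - d = 0 := by rw [hs₀]; ring
    have z1 : 2 * s₁ + 2 - d = α := by rw [hs₁, hs₀]; ring
    rw [z0] at b₀
    rw [z1] at b₁
    have n0 : 0 ≤ 4 * a * s₀ * (s₀ + 1) * (a + latSq x) ^ (-s₀ - 2) := by
      have := hρ0 x; positivity
    have m0 : (a + latSq x) ^ (-s₀ - 2) ≤ (a + latSq x) ^ (-(s₀ + (1 + α))) :=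
      hrpow_le x _ _ (by linarith)
    have m1 : (a + latSq x) ^ (-s₁ - 2) ≤ (a + latSq x) ^ (-(s₀ + (1 + α))) :=
      hrpow_le x _ _ (by rw [hs₁]; linarith)
    have m2 : |V x| * ((a + latSq x) ^ (-s₀) - (a + latSq x) ^ (-s₁)) ≤
        K * (a + latSq x) ^ (-(s₀ + (1 + α))) := by
      calc _ ≤ |V x| * (a + latSq x) ^ (-s₀) := by
            have := Real.rpow_pos_of_pos (hρ0 x) (-s₁)
            gcongr; linarith
        _ ≤ K * (a + latSq x) ^ (-(1 + α)) * (a + latSq x) ^ (-s₀) := by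
            have := hρ0 x
            gcongr; exact hVρ x
        _ = _ := by rw [mul_assoc, ← Real.rpow_add (hρ0 x)]; ring_nf
    have e1 : -s₁ - 1 = -(s₁ + 1) := by ring
    rw [e1] at b₁
    have m0' := mul_le_mul_of_nonneg_left m0 hK₀.le
    have m1' := mul_le_mul_of_nonneg_left m1
      (by positivity : 0 ≤ 4 * a * s₁ * (s₁ + 1) + K₁)
    linarith
  have hsup₂ : ∀ᶠ x in cofinite, |V x| * Ψ₂ x < -latLap Ψ₂ x := by
    have hc : 0 < 2 * s₂ * (d - 2 - 2 * s₂) := by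
      have : 0 < (d : ℝ) - 2 - 2 * s₂ := by rw [hs₂]; linarith
      positivity
    filter_upwards [eventually_rpow_lt_rpow (d := d) a (2 * K + K₂) hc
      (by rw [hs₂]; linarith : s₂ + 1 < 1 + α)] with x hx
    have b₂ := (abs_le.1 (h₂ a ha₂ x)).2
    rw [hΨ₂, latLap_add, latLap_const]
    have n0 : 0 ≤ 4 * a * s₂ * (s₂ + 1) * (a + latSq x) ^ (-s₂ - 2) := by
      have := hρ0 x; positivity
    have m0 : (a + latSq x) ^ (-s₂ - 2) ≤ (a + latSq x) ^ (-(1 + α)) :=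
      hrpow_le x _ _ (by linarith)
    have m2 : |V x| * (1 + (a + latSq x) ^ (-s₂)) ≤ 2 * K * (a + latSq x) ^ (-(1 + α)) := by
      have : (a + latSq x) ^ (-s₂) ≤ 1 :=
        Real.rpow_le_one_of_one_le_of_nonpos (hρ1 x).le (by linarith)
      calc _ ≤ |V x| * 2 := by gcongr; linarith
        _ ≤ _ := by linarith [hVρ x]
    have e1 : -s₂ - 1 = -(s₂ + 1) := by ring
    rw [e1] at b₂
    have m0' := mul_le_mul_of_nonneg_left m0 hK₂.le
    linarith
  have hT := hsup₁.and hsup₂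
  rw [eventually_cofinite] at hT
  -- On the finite set where a strict supersolution inequality fails, w ≤ BΨ₁ holds by the choice of
  -- B.
  obtain ⟨B, hB⟩ := (hT.image fun x => w x / Ψ₁ x).bddAbove
  refine ⟨max B 1, lt_max_of_lt_right one_pos, fun x => ?_⟩
  have hB0 : 0 < max B 1 := lt_max_of_lt_right one_pos
  have hkey : ∀ δ : ℝ, 0 < δ → w x ≤ max B 1 * Ψ₁ x + δ * Ψ₂ x := by
    intro δ hδ
    have hΨ₂1 : ∀ y, 1 ≤ Ψ₂ y := fun y => by
      have := Real.rpow_pos_of_pos (hρ0 y) (-s₂)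
      simp only [hΨ₂]; linarith
    refine le_of_subsolution_of_supersolution (Θ := fun y => max B 1 * Ψ₁ y + δ * Ψ₂ y)
      (P := fun x => |V x|) hδ hlim (fun y => ?_) hsub (fun y => ?_) x
    · nlinarith [mul_pos hB0 (hΨ₁pos y), hΨ₂1 y]
    · by_cases hy : |V y| * Ψ₁ y < -latLap Ψ₁ y ∧ |V y| * Ψ₂ y < -latLap Ψ₂ y
      · right
        rw [latLap_add, latLap_const_mul, latLap_const_mul]
        nlinarith [mul_lt_mul_of_pos_left hy.1 hB0, mul_lt_mul_of_pos_left hy.2 hδ]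
      · left
        have h1 : w y / Ψ₁ y ≤ B := hB (Set.mem_image_of_mem _ hy)
        rw [div_le_iff₀ (hΨ₁pos y)] at h1
        have h2 := mul_le_mul_of_nonneg_right (le_max_left B 1) (hΨ₁pos y).le
        nlinarith [hΨ₂1 y]
  have hlim0 : w x ≤ max B 1 * Ψ₁ x := by
    refine le_of_forall_pos_le_add fun η hη => ?_
    have hΨ₂0 : 0 < Ψ₂ x := by
      have := Real.rpow_pos_of_pos (hρ0 x) (-s₂)
      simp only [hΨ₂]; linarith
    have := hkey (η / Ψ₂ x) (by positivity)
    rwa [div_mul_cancel₀ _ hΨ₂0.ne'] at this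
  refine hlim0.trans (mul_le_mul_of_nonneg_left ?_ hB0.le)
  have h1 := rpow_neg_le_jap ha.le hs₀0.le x
  have e : -(2 * s₀) = -(d : ℝ) + 2 := by rw [hs₀]; ring
  rw [e] at h1
  have := Real.rpow_pos_of_pos (hρ0 x) (-s₁)
  simp only [hΨ₁]; linarith

/-! ### A localised mean value inequality: subsolutions in the weighted space vanish at infinity. -/

/-- At s = (d-2)/2 the leading term of the expansion vanishes, and once 4as(s+1) ≥ K + 1 the next
one exceeds the error constant K with a surplus of 1. -/
theorem exists_superharmonic_rpow {d : ℕ} (hd : 3 ≤ d) : ∃ A : ℝ, 1 < A ∧ ∀ a : ℝ, A ≤ a →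
    ∀ x : Fin d → ℤ, (a + latSq x) ^ (-(((d : ℝ) - 2) / 2) - 2) ≤
      -latLap (fun x => (a + latSq x) ^ (-(((d : ℝ) - 2) / 2))) x := by
  have hd' : (3 : ℝ) ≤ d := by exact_mod_cast hd
  set s : ℝ := ((d : ℝ) - 2) / 2 with hs
  have hs0 : 0 < s := by rw [hs]; linarith
  obtain ⟨K, A, hK, hA, h⟩ := exists_latLap_rpow d hs0
  refine ⟨max A ((K + 1) / (4 * s * (s + 1))), lt_max_of_lt_left hA, fun a ha x => ?_⟩
  have b := (abs_le.1 (h a ((le_max_left _ _).trans ha) x)).2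
  have z0 : 2 * s + 2 - d = 0 := by rw [hs]; ring
  rw [z0] at b
  have h1 := (le_max_right A _).trans ha
  rw [div_le_iff₀ (by positivity)] at h1
  have ha1 : 1 < a := hA.trans_le ((le_max_left _ _).trans ha)
  have hρ : 0 < a + latSq x := by linarith [latSq_nonneg x]
  have := mul_le_mul_of_nonneg_right h1 (Real.rpow_nonneg hρ.le (-s - 2))
  linarith

/-- The squared positive part is C^{1,1} with second derivative at most 2, hence lies below its
tangent parabolas. This bounds the Laplacian of the cutoff (1 - |x|²/R²)₊² from above. -/
theorem sq_max_add_le (a b : ℝ) : max 0 (a + b) ^ 2 ≤ max 0 a ^ 2 + 2 * max 0 a * b + b ^ 2 := by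
  rcases le_total 0 a with ha | ha <;> rcases le_total 0 (a + b) with hb | hb
  · rw [max_eq_right ha, max_eq_right hb]; nlinarith
  · rw [max_eq_right ha, max_eq_left hb]; nlinarith [sq_nonneg (a + b)]
  · rw [max_eq_left ha, max_eq_right hb]; nlinarith
  · rw [max_eq_left ha, max_eq_left hb]; nlinarith [sq_nonneg b]

theorem abs_sq_max_sub_le {a b : ℝ} (ha : a ≤ 1) (hb : a + b ≤ 1) :
    |max 0 (a + b) ^ 2 - max 0 a ^ 2| ≤ 2 * |b| := by
  have h1 : |max 0 (a + b) - max 0 a| ≤ |b| := by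
    have := abs_max_sub_max_le_abs (a + b) a 0
    rw [max_comm (a + b), max_comm a] at this
    simpa using this
  have h2 : |max 0 (a + b) + max 0 a| ≤ 2 := by
    rw [abs_of_nonneg (by positivity)]
    have : max 0 (a + b) ≤ 1 := max_le zero_le_one hb
    have : max 0 a ≤ 1 := max_le zero_le_one ha
    linarith
  have e : max 0 (a + b) ^ 2 - max 0 a ^ 2 =
    (max 0 (a + b) + max 0 a) * (max 0 (a + b) - max 0 a) := by ring
  rw [e, abs_mul]
  exact mul_le_mul h2 h1 (abs_nonneg _) (by norm_num)

theorem exists_one_add_rpow_lipschitz (s : ℝ) : ∃ C δ : ℝ, 0 ≤ C ∧ 0 < δ ∧ δ < 1 ∧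
    ∀ t : ℝ, |t| ≤ δ → |(1 + t) ^ (-s) - 1| ≤ C * |t| := by
  obtain ⟨C, δ, hC, hδ, hδ1, h⟩ := exists_one_add_rpow_taylor s
  refine ⟨|s| + |s * (s + 1) / 2| + |s * (s + 1) * (s + 2) / 6| + C, δ, by positivity, hδ, hδ1,
    fun t ht => ?_⟩
  have h1 : |t| ≤ 1 := ht.trans hδ1.le
  have h0 := abs_nonneg t
  have h2 : |t| ^ 2 ≤ |t| := by nlinarith
  have h3 : |t| ^ 3 ≤ |t| := by nlinarith
  have h4 : t ^ 4 ≤ |t| := by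
    have : t ^ 4 = |t| ^ 4 := (Even.pow_abs (by decide) t).symm
    rw [this]
    nlinarith [pow_nonneg h0 3]
  have e : (1 + t) ^ (-s) - 1 = ((1 + t) ^ (-s) - (1 - s * t + s * (s + 1) / 2 * t ^ 2
      - s * (s + 1) * (s + 2) / 6 * t ^ 3)) + (-(s * t) + s * (s + 1) / 2 * t ^ 2
      - s * (s + 1) * (s + 2) / 6 * t ^ 3) := by ring
  rw [e]
  refine (abs_add_le _ _).trans ?_
  have h5 : |-(s * t) + s * (s + 1) / 2 * t ^ 2 - s * (s + 1) * (s + 2) / 6 * t ^ 3| ≤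
      |s| * |t| + |s * (s + 1) / 2| * |t| ^ 2 + |s * (s + 1) * (s + 2) / 6| * |t| ^ 3 := by
    refine (abs_sub _ _).trans ?_
    refine add_le_add ((abs_add_le _ _).trans ?_) ?_
    · rw [abs_neg, abs_mul, abs_mul, abs_pow]
    · rw [abs_mul, abs_pow]
  have h6 := h t ht
  have k2 := mul_le_mul_of_nonneg_left h2 (abs_nonneg (s * (s + 1) / 2))
  have k3 := mul_le_mul_of_nonneg_left h3 (abs_nonneg (s * (s + 1) * (s + 2) / 6))
  have k4 := mul_le_mul_of_nonneg_left h4 hC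
  linarith

theorem exists_abs_one_add_le (δ : ℝ) (hδ : 0 < δ) : ∃ A : ℝ, ∀ a : ℝ, A ≤ a →
    ∀ q k : ℝ, k ^ 2 ≤ q → |1 + 2 * k| ≤ δ * (a + q) := by
  refine ⟨(1 + 1 / δ) / δ, fun a ha q k hk => ?_⟩
  have h1 : 1 + 1 / δ ≤ δ * a := by rwa [div_le_iff₀ hδ, mul_comm] at ha
  have h2 : 2 * |k| ≤ δ * k ^ 2 + 1 / δ := by
    have : 0 ≤ (δ * |k| - 1) ^ 2 / δ := by positivity
    have e : (δ * |k| - 1) ^ 2 / δ = δ * k ^ 2 + 1 / δ - 2 * |k| := by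
      rw [← sq_abs k]; field_simp; ring
    linarith
  have h3 : |1 + 2 * k| ≤ 1 + 2 * |k| := by
    refine (abs_add_le _ _).trans ?_
    rw [abs_mul]; norm_num
  nlinarith

/-- A truncated superharmonic function concentrated at the origin. -/
theorem exists_truncated_superharmonic {d : ℕ} (hd : 3 ≤ d) :
    ∃ (ψ : (Fin d → ℤ) → ℝ) (c C : ℝ), 0 < c ∧ 0 < C ∧
      (∀ z, 0 ≤ ψ z ∧ ψ z ≤ jap z ^ (2 - (d : ℝ))) ∧
      ∀ R : ℝ, 1 ≤ R → ∃ Φ : (Fin d → ℤ) → ℝ, (∀ z, 0 ≤ Φ z ∧ Φ z ≤ ψ z) ∧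
        (∀ z, R < latNorm z → Φ z = 0) ∧
        c ≤ -latLap Φ 0 + C / R ^ 2 * ψ 0 ∧
        (∀ z, latNorm z ≤ R + 1 → 0 ≤ -latLap Φ z + C / R ^ 2 * ψ z) := by
  have hd' : (3 : ℝ) ≤ d := by exact_mod_cast hd
  set s : ℝ := ((d : ℝ) - 2) / 2 with hs
  have hs0 : 0 < s := by rw [hs]; linarith
  obtain ⟨A₁, hA₁, hsuper⟩ := exists_superharmonic_rpow hd
  obtain ⟨K, δ, hK, hδ, hδ1, hlip⟩ := exists_one_add_rpow_lipschitz s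
  obtain ⟨A₂, hA₂⟩ := exists_abs_one_add_le δ hδ
  set a := max A₁ A₂
  have ha1 : 1 < a := hA₁.trans_le (le_max_left _ _)
  have hsup := hsuper a (le_max_left _ _)
  rw [← hs] at hsup
  have habs := hA₂ a (le_max_right _ _)
  have hρ1 : ∀ x : Fin d → ℤ, 1 < a + latSq x := fun x => by linarith [latSq_nonneg x]
  have hρ0 : ∀ x : Fin d → ℤ, 0 < a + latSq x := fun x => one_pos.trans (hρ1 x)
  set ψ : (Fin d → ℤ) → ℝ := fun x => (a + latSq x) ^ (-s) with hψ
  have hψ0 : ∀ z, 0 < ψ z := fun z => Real.rpow_pos_of_pos (hρ0 z) _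
  refine ⟨ψ, a ^ (-s - 2), 2 * d + 32 + d * (32 * K), by positivity, by positivity,
    fun z => ⟨(hψ0 z).le, ?_⟩, fun R hR => ?_⟩
  · have := rpow_neg_le_jap ha1.le hs0.le z
    have e : -(2 * s) = 2 - (d : ℝ) := by rw [hs]; ring
    rwa [e] at this
  have hR0 : 0 < R := by linarith
  set η : (Fin d → ℤ) → ℝ := fun x => max 0 (1 - latSq x / R ^ 2) ^ 2 with hη
  have hη1 : ∀ z : Fin d → ℤ, 1 - latSq z / R ^ 2 ≤ 1 := fun z =>
    sub_le_self _ (div_nonneg (latSq_nonneg z) (sq_nonneg R))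
  have hη0 : ∀ z, 0 ≤ η z := fun z => sq_nonneg _
  have hηle : ∀ z, η z ≤ 1 := fun z =>
    pow_le_one₀ (le_max_left _ _) (max_le zero_le_one (hη1 z))
  have hηstep : ∀ (y z : Fin d → ℤ) (k : ℝ), latSq y = latSq z + k →
      η y ≤ η z - 2 * max 0 (1 - latSq z / R ^ 2) * (k / R ^ 2) + (k / R ^ 2) ^ 2 ∧
      |η y - η z| ≤ 2 * (|k| / R ^ 2) := by
    intro y z k hyz
    have e : 1 - latSq y / R ^ 2 = (1 - latSq z / R ^ 2) + -(k / R ^ 2) := by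
      rw [hyz]; ring
    have h1 := sq_max_add_le (1 - latSq z / R ^ 2) (-(k / R ^ 2))
    have h2 := abs_sq_max_sub_le (hη1 z) (e ▸ hη1 y)
    rw [← e] at h1 h2
    refine ⟨by simp only [hη]; linarith, ?_⟩
    simpa [hη, abs_div] using h2
  have hψstep : ∀ (y z : Fin d → ℤ) (k : ℝ), latSq y = latSq z + k →
      |k| ≤ δ * (a + latSq z) → |ψ y - ψ z| ≤ K * ψ z * (|k| / (a + latSq z)) := by
    intro y z k hyz hk
    have h1 : |k / (a + latSq z)| ≤ δ := by
      rw [abs_div, abs_of_pos (hρ0 z)]; exact (div_le_iff₀ (hρ0 z)).2 hk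
    have h2 : a + latSq y = (a + latSq z) * (1 + k / (a + latSq z)) := by
      rw [hyz]; field_simp [(hρ0 z).ne']; ring
    have h3 : 0 ≤ 1 + k / (a + latSq z) := by linarith [(abs_le.1 h1).1]
    have h4 : ψ y = ψ z * (1 + k / (a + latSq z)) ^ (-s) := by
      simp only [hψ]; rw [h2, Real.mul_rpow (hρ0 z).le h3]
    have h5 := hlip _ h1
    rw [abs_div, abs_of_pos (hρ0 z)] at h5
    have e : ψ y - ψ z = ψ z * ((1 + k / (a + latSq z)) ^ (-s) - 1) := by rw [h4]; ring
    rw [e, abs_mul, abs_of_pos (hψ0 z)]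
    calc ψ z * _ ≤ ψ z * (K * (|k| / (a + latSq z))) :=
          mul_le_mul_of_nonneg_left h5 (hψ0 z).le
      _ = _ := by ring
  -- The step of ψ costs |k|/ρ and that of η costs |k|/R²; as k² = O(ρ), the product is O(ψ/R²).
  have hcross : ∀ (y z : Fin d → ℤ) (k : ℝ), latSq y = latSq z + k →
      |k| ≤ δ * (a + latSq z) → k ^ 2 ≤ 8 * (a + latSq z) →
      (ψ y - ψ z) * (η y - η z) ≤ 16 * K / R ^ 2 * ψ z := by
    intro y z k hyz hk hk2
    have h1 := hψstep y z k hyz hk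
    have h2 := (hηstep y z k hyz).2
    have := hρ0 z
    have := hψ0 z
    calc (ψ y - ψ z) * (η y - η z) ≤ |ψ y - ψ z| * |η y - η z| := by
          rw [← abs_mul]; exact le_abs_self _
      _ ≤ (K * ψ z * (|k| / (a + latSq z))) * (2 * (|k| / R ^ 2)) :=
          mul_le_mul h1 h2 (abs_nonneg _) (by positivity)
      _ = 2 * K * ψ z / R ^ 2 * (|k| ^ 2 / (a + latSq z)) := by field_simp
      _ ≤ 2 * K * ψ z / R ^ 2 * 8 := by
          gcongr
          rw [sq_abs, div_le_iff₀ (hρ0 z)]; exact hk2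
      _ = _ := by ring
  have hlapη : ∀ z, latNorm z ≤ R + 1 → latLap η z ≤ (2 * d + 32) / R ^ 2 := by
    intro z hz
    have hq : latSq z ≤ 4 * R ^ 2 := by
      rw [← latNorm_sq]; nlinarith [latNorm_nonneg z]
    have hm : 0 ≤ max 0 (1 - latSq z / R ^ 2) := le_max_left _ _
    have h1 : latLap η z ≤ ∑ j, (-4 * max 0 (1 - latSq z / R ^ 2) / R ^ 2
        + (2 + 8 * (z j : ℝ) ^ 2) / R ^ 4) := by
      refine Finset.sum_le_sum fun j _ => ?_
      have k1 := (hηstep _ z _ (latSq_add_single z j)).1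
      have k2 := (hηstep _ z _ (latSq_sub_single z j)).1
      have e : -4 * max 0 (1 - latSq z / R ^ 2) / R ^ 2 + (2 + 8 * (z j : ℝ) ^ 2) / R ^ 4 =
        (-2 * max 0 (1 - latSq z / R ^ 2) * ((1 + 2 * (z j : ℝ)) / R ^ 2)
          + ((1 + 2 * (z j : ℝ)) / R ^ 2) ^ 2) +
        (-2 * max 0 (1 - latSq z / R ^ 2) * ((1 - 2 * (z j : ℝ)) / R ^ 2)
          + ((1 - 2 * (z j : ℝ)) / R ^ 2) ^ 2) := by field_simp; ring
      rw [e]; linarith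
    refine h1.trans ?_
    have h2 : ∑ j, (2 + 8 * (z j : ℝ) ^ 2) / R ^ 4 = (2 * d + 8 * latSq z) / R ^ 4 := by
      rw [← Finset.sum_div, Finset.sum_add_distrib, ← Finset.mul_sum]
      simp [latSq, mul_comm]
    rw [Finset.sum_add_distrib, h2]
    have h3 : ∑ _j : Fin d, (-4 * max 0 (1 - latSq z / R ^ 2) / R ^ 2) ≤ 0 := by
      refine Finset.sum_nonpos fun _ _ => ?_
      rw [neg_mul, neg_div]; exact neg_nonpos.2 (by positivity)
    have h4 : (2 * d + 8 * latSq z) / R ^ 4 ≤ (2 * d + 32) / R ^ 2 := by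
      rw [div_le_div_iff₀ (by positivity) (by positivity)]
      have hR2 : 1 ≤ R ^ 2 := by nlinarith
      have : 2 * d + 8 * latSq z ≤ (2 * d + 32) * R ^ 2 := by nlinarith
      nlinarith [mul_le_mul_of_nonneg_right this (sq_nonneg R)]
    linarith
  -- Discrete product rule: ηΔψ has the good sign, ψΔη and the cross terms are O(ψ/R²). At the
  -- origin η = 1, so the gain a^(-s-2) there does not depend on R.
  have hmain : ∀ z, latNorm z ≤ R + 1 →
      η z * (a + latSq z) ^ (-s - 2) ≤ -latLap (fun y => ψ y * η y) z +
        (2 * d + 32 + d * (32 * K)) / R ^ 2 * ψ z := by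
    intro z hz
    have e : latLap (fun y => ψ y * η y) z = η z * latLap ψ z + ψ z * latLap η z +
        ∑ j, ((ψ (z + Pi.single j 1) - ψ z) * (η (z + Pi.single j 1) - η z) +
          (ψ (z - Pi.single j 1) - ψ z) * (η (z - Pi.single j 1) - η z)) := by
      simp only [latLap, Finset.mul_sum, ← Finset.sum_add_distrib]
      exact Finset.sum_congr rfl fun _ _ => by ring
    have hc : ∑ j, ((ψ (z + Pi.single j 1) - ψ z) * (η (z + Pi.single j 1) - η z) +
          (ψ (z - Pi.single j 1) - ψ z) * (η (z - Pi.single j 1) - η z)) ≤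
          d * (32 * K) / R ^ 2 * ψ z := by
      calc _ ≤ ∑ _j : Fin d, (32 * K) / R ^ 2 * ψ z := by
            refine Finset.sum_le_sum fun j _ => ?_
            have hj := coord_sq_le_latSq z j
            have k1 := hcross _ z _ (latSq_add_single z j) (habs _ _ hj)
              (by nlinarith [sq_nonneg (1 - 2 * (z j : ℝ))])
            have k2 := hcross _ z _ (latSq_sub_single z j)
              (by have := habs (latSq z) (-(z j : ℝ)) (by rw [neg_sq]; exact hj)
                  rwa [mul_neg, ← sub_eq_add_neg] at this)
              (by nlinarith [sq_nonneg (1 + 2 * (z j : ℝ))])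
            have : 32 * K / R ^ 2 * ψ z = 16 * K / R ^ 2 * ψ z + 16 * K / R ^ 2 * ψ z := by ring
            linarith
        _ = _ := by simp; ring
    have h1 := mul_le_mul_of_nonneg_left (hsup z) (hη0 z)
    have h2 := mul_le_mul_of_nonneg_left (hlapη z hz) (hψ0 z).le
    have e2 : (2 * d + 32 + d * (32 * K)) / R ^ 2 * ψ z =
      ψ z * ((2 * d + 32) / R ^ 2) + d * (32 * K) / R ^ 2 * ψ z := by ring
    rw [e, e2]
    linarith
  refine ⟨fun y => ψ y * η y, fun z => ⟨mul_nonneg (hψ0 z).le (hη0 z), ?_⟩, fun z hz => ?_, ?_,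
    fun z hz => ?_⟩
  · nlinarith [hηle z, hψ0 z]
  · have : 1 - latSq z / R ^ 2 ≤ 0 := by
      rw [sub_nonpos, one_le_div (by positivity), ← latNorm_sq]
      exact pow_le_pow_left₀ hR0.le hz.le 2
    simp [hη, max_eq_left this]
  · have h0 : latNorm (0 : Fin d → ℤ) = 0 := by simp [latNorm]
    have := hmain 0 (by rw [h0]; linarith)
    have hq0 : latSq (0 : Fin d → ℤ) = 0 := by simp [latSq]
    have hη00 : η 0 = 1 := by simp [hη, hq0]
    rwa [hη00, hq0, add_zero, one_mul] at this
  · refine le_trans ?_ (hmain z hz)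
    have := hρ0 z
    exact mul_nonneg (hη0 z) (by positivity)

theorem tsum_mul_latLap {d : ℕ} (W Φ : (Fin d → ℤ) → ℝ) (hΦ : Φ.support.Finite) :
    ∑' z, W z * latLap Φ z = ∑' z, Φ z * latLap W z := by
  have hs : ∀ (F : (Fin d → ℤ) → ℝ), Summable fun z => Φ z * F z := fun F =>
    summable_of_hasFiniteSupport (hΦ.subset (Function.support_mul_subset_left _ _))
  have hsh : ∀ (e : Fin d → ℤ), HasSum (fun z => W z * Φ (z + e)) (∑' z, Φ z * W (z - e)) := by
    intro e
    have h := (hs fun z => W (z - e)).hasSum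
    rw [← (Equiv.addRight e).hasSum_iff] at h
    convert h using 2 with z
    simp [mul_comm]
  have hsh' : ∀ e : Fin d → ℤ, HasSum (fun z => W z * Φ (z - e)) (∑' z, Φ z * W (z + e)) := by
    intro e
    simpa [sub_eq_add_neg] using hsh (-e)
  have h0 : HasSum (fun z => W z * Φ z) (∑' z, Φ z * W z) := by
    simpa [mul_comm] using (hs W).hasSum
  have hL : HasSum (fun z => W z * latLap Φ z)
      (∑ j : Fin d, (((∑' z, Φ z * W (z - Pi.single j 1)) - ∑' z, Φ z * W z) +
        ((∑' z, Φ z * W (z + Pi.single j 1)) - ∑' z, Φ z * W z))) := by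
    have := hasSum_sum (s := Finset.univ) fun (j : Fin d) _ =>
      ((hsh (Pi.single j 1)).sub h0).add ((hsh' (Pi.single j 1)).sub h0)
    refine (congrArg (HasSum · _) (funext fun z => ?_)).mpr this
    rw [latLap, Finset.mul_sum]
    exact Finset.sum_congr rfl fun _ _ => by ring
  have hR : HasSum (fun z => Φ z * latLap W z)
      (∑ j : Fin d, (((∑' z, Φ z * W (z - Pi.single j 1)) - ∑' z, Φ z * W z) +
        ((∑' z, Φ z * W (z + Pi.single j 1)) - ∑' z, Φ z * W z))) := by
    have := hasSum_sum (s := Finset.univ) fun (j : Fin d) _ =>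
      (((hs fun z => W (z - Pi.single j 1)).hasSum).sub (hs W).hasSum).add
        (((hs fun z => W (z + Pi.single j 1)).hasSum).sub (hs W).hasSum)
    refine (congrArg (HasSum · _) (funext fun z => ?_)).mpr this
    rw [latLap, Finset.mul_sum]
    exact Finset.sum_congr rfl fun _ _ => by ring
  rw [hL.tsum_eq, hR.tsum_eq]

theorem finite_latNorm_le {d : ℕ} (R : ℝ) : {x : Fin d → ℤ | latNorm x ≤ R}.Finite := by
  have := tendsto_latNorm (d := d).eventually_gt_atTop R
  rw [eventually_cofinite] at this
  exact this.subset fun x hx => not_lt.2 hx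

/-- A subsolution of `H₀ - |V|` in `l^{2,-3/2}` tends to zero. -/
theorem tendsto_zero_of_subsolution {d : ℕ} (hd : 3 ≤ d) {V w : (Fin d → ℤ) → ℝ} {C₀ : ℝ}
    (hV : ∀ x, |V x| ≤ C₀ * jap x ^ (-2 : ℝ)) (hw : ∀ x, 0 ≤ w x)
    (hsub : ∀ x, -latLap w x ≤ |V x| * w x)
    (hsum : Summable fun x => jap x ^ (-3 : ℝ) * w x ^ 2) : Tendsto w cofinite (𝓝 0) := by
  have hd' : (3 : ℝ) ≤ d := by exact_mod_cast hd
  obtain ⟨ψ, c, C, hc, hC, hψ, hΦ⟩ := exists_truncated_superharmonic hd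
  obtain ⟨C₁, hC₁, hsumψ⟩ := exists_sum_jap_rpow_le (d := d) (by omega) le_rfl
  have hC₀ : 0 ≤ C₀ := by
    by_contra hneg
    have h1 : 0 < jap (0 : Fin d → ℤ) ^ (-2 : ℝ) := Real.rpow_pos_of_pos (jap_pos _) _
    nlinarith [hV 0, abs_nonneg (V 0)]
  let B : ℝ → Finset (Fin d → ℤ) := fun R => (finite_latNorm_le (R + 1)).toFinset
  have hB : ∀ R z, z ∈ B R ↔ latNorm z ≤ R + 1 := fun R z => by simp [B]
  -- Pair w with -ΔΦ + (C/R²)ψ, both centred at x₀, and sum by parts. The condition 2(R+1) ≤ |x₀|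
  -- keeps the ball at distance at least R from the origin, where |V| ≤ C₀/R².
  have hmean : ∀ (x₀ : Fin d → ℤ) (R : ℝ), 1 ≤ R → 2 * (R + 1) ≤ latNorm x₀ →
      c * w x₀ ≤ (C + C₀) / R ^ 2 * ∑ z ∈ B R, ψ z * w (x₀ + z) := by
    intro x₀ R hR hx₀
    have hR0 : 0 < R := by linarith
    obtain ⟨Φ, hΦψ, hΦ0, hc0, hlap⟩ := hΦ R hR
    have hfin : Φ.support.Finite := (finite_latNorm_le R).subset fun z hz => by
      by_contra hcon
      exact hz (hΦ0 z (not_le.1 hcon))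
    have hparts := tsum_mul_latLap (fun z => w (x₀ + z)) Φ hfin
    have hout : ∀ z, z ∉ B R → Φ z = 0 ∧ latLap Φ z = 0 := by
      intro z hz
      rw [hB, not_le] at hz
      have h1 : Φ z = 0 := hΦ0 z (by linarith)
      refine ⟨h1, Finset.sum_eq_zero fun j _ => ?_⟩
      have h2 : Φ (z + Pi.single j 1) = 0 := hΦ0 _ (by
        have := latNorm_sub_le (z + Pi.single j 1) (Pi.single j 1)
        rw [add_sub_cancel_right, latNorm_single] at this; linarith)
      have h3 : Φ (z - Pi.single j 1) = 0 := hΦ0 _ (by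
        have := latNorm_le_sub_add z (Pi.single j 1)
        rw [latNorm_single] at this; linarith)
      rw [h1, h2, h3]; ring
    rw [tsum_eq_sum (s := B R) fun z hz => by rw [(hout z hz).2, mul_zero],
      tsum_eq_sum (s := B R) fun z hz => by rw [(hout z hz).1, zero_mul]] at hparts
    have h0mem : (0 : Fin d → ℤ) ∈ B R := by
      rw [hB]; simp [latNorm]; linarith
    have hlow : c * w x₀ ≤ ∑ z ∈ B R, w (x₀ + z) * (-latLap Φ z + C / R ^ 2 * ψ z) := by
      calc c * w x₀ ≤ w (x₀ + 0) * (-latLap Φ 0 + C / R ^ 2 * ψ 0) := by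
            rw [add_zero, mul_comm]; exact mul_le_mul_of_nonneg_left hc0 (hw _)
        _ ≤ _ := Finset.single_le_sum
            (f := fun z => w (x₀ + z) * (-latLap Φ z + C / R ^ 2 * ψ z))
            (fun z hz => mul_nonneg (hw _) (hlap z ((hB R z).1 hz))) h0mem
    have hup : -∑ z ∈ B R, Φ z * latLap (fun z => w (x₀ + z)) z ≤
        ∑ z ∈ B R, C₀ / R ^ 2 * (ψ z * w (x₀ + z)) := by
      rw [← Finset.sum_neg_distrib]
      refine Finset.sum_le_sum fun z hz => ?_
      have hz' := (hB R z).1 hz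
      rw [latLap_comp_add]
      have hVz : |V (x₀ + z)| ≤ C₀ / R ^ 2 := by
        refine (hV _).trans ?_
        rw [div_eq_mul_inv, Real.rpow_neg (jap_pos _).le]
        refine mul_le_mul_of_nonneg_left (inv_anti₀ (by positivity) ?_) hC₀
        have h1 := latNorm_sub_le (x₀ + z) z
        rw [add_sub_cancel_right] at h1
        have h2 := latNorm_lt_jap (x₀ + z)
        have : R ≤ jap (x₀ + z) := by linarith
        rw [Real.rpow_two]
        exact pow_le_pow_left₀ hR0.le this 2
      calc -(Φ z * latLap w (x₀ + z)) = Φ z * -latLap w (x₀ + z) := by ring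
        _ ≤ Φ z * (|V (x₀ + z)| * w (x₀ + z)) :=
            mul_le_mul_of_nonneg_left (hsub _) (hΦψ z).1
        _ ≤ ψ z * (C₀ / R ^ 2 * w (x₀ + z)) :=
            mul_le_mul (hΦψ z).2 (mul_le_mul_of_nonneg_right hVz (hw _))
              (mul_nonneg (abs_nonneg _) (hw _)) (hψ z).1
        _ = _ := by ring
    have e1 : ∑ z ∈ B R, w (x₀ + z) * (-latLap Φ z + C / R ^ 2 * ψ z) =
        -(∑ z ∈ B R, w (x₀ + z) * latLap Φ z) + C / R ^ 2 * ∑ z ∈ B R, ψ z * w (x₀ + z) := by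
      rw [← Finset.sum_neg_distrib, Finset.mul_sum, ← Finset.sum_add_distrib]
      exact Finset.sum_congr rfl fun _ _ => by ring
    rw [e1, hparts] at hlow
    rw [← Finset.mul_sum] at hup
    rw [add_div, add_mul]
    linarith
  -- Cauchy–Schwarz with the balance R^(-4) · R · R³ = 1: the factor R bounds ∑ψ², using 4 - 2d ≤ 1
  -- - d, and R³ undoes the weight ⟨x⟩^(-3). On the ball ⟨x₀+z⟩ ≤ 3R + 4 ≤ 7R, whence 343 = 7³.
  have hsq : ∀ (x₀ : Fin d → ℤ) (R : ℝ), 1 ≤ R → 2 * (R + 1) = latNorm x₀ →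
      (c * w x₀) ^ 2 ≤ (C + C₀) ^ 2 * C₁ * 6 * 343 *
        ∑ z ∈ B R, jap (x₀ + z) ^ (-3 : ℝ) * w (x₀ + z) ^ 2 := by
    intro x₀ R hR hx₀
    have hR0 : 0 < R := by linarith
    have h1 := hmean x₀ R hR hx₀.le
    have h2 := Finset.sum_mul_sq_le_sq_mul_sq (B R) ψ fun z => w (x₀ + z)
    have h3 : ∑ z ∈ B R, ψ z ^ 2 ≤ C₁ * 6 * R := by
      calc ∑ z ∈ B R, ψ z ^ 2 ≤ ∑ z ∈ B R, jap z ^ (1 - (d : ℝ) - 0) := by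
            refine Finset.sum_le_sum fun z _ => ?_
            calc ψ z ^ 2 ≤ (jap z ^ (2 - (d : ℝ))) ^ 2 :=
                  pow_le_pow_left₀ (hψ z).1 (hψ z).2 2
              _ = jap z ^ ((2 - (d : ℝ)) * 2) := by
                  rw [Real.rpow_mul (jap_pos z).le, Real.rpow_two]
              _ ≤ _ := Real.rpow_le_rpow_of_exponent_le (one_le_jap z) (by linarith)
        _ ≤ C₁ * powSum 0 (R + 2) := hsumψ _ _ fun z hz => by
            linarith [jap_le_one_add_latNorm z, (hB R z).1 hz]
        _ ≤ C₁ * (2 * (R + 2)) := by gcongr; exact powSum_zero_le (by linarith)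
        _ ≤ _ := by nlinarith
    have h4 : ∑ z ∈ B R, w (x₀ + z) ^ 2 ≤
        343 * R ^ 3 * ∑ z ∈ B R, jap (x₀ + z) ^ (-3 : ℝ) * w (x₀ + z) ^ 2 := by
      rw [Finset.mul_sum]
      refine Finset.sum_le_sum fun z hz => ?_
      have hj : jap (x₀ + z) ≤ 7 * R := by
        linarith [jap_le_one_add_latNorm (x₀ + z), latNorm_add_le x₀ z, (hB R z).1 hz]
      have hj0 := jap_pos (x₀ + z)
      have : 1 ≤ 343 * R ^ 3 * jap (x₀ + z) ^ (-3 : ℝ) := by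
        rw [Real.rpow_neg hj0.le, ← div_eq_mul_inv, one_le_div (by positivity)]
        calc jap (x₀ + z) ^ (3 : ℝ) = jap (x₀ + z) ^ 3 := by norm_cast
          _ ≤ (7 * R) ^ 3 := pow_le_pow_left₀ hj0.le hj 3
          _ = _ := by ring
      nlinarith [sq_nonneg (w (x₀ + z))]
    set S := ∑ z ∈ B R, jap (x₀ + z) ^ (-3 : ℝ) * w (x₀ + z) ^ 2 with hS
    have hS0 : 0 ≤ S := Finset.sum_nonneg fun z _ =>
      mul_nonneg (Real.rpow_nonneg (jap_pos _).le _) (sq_nonneg _)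
    calc (c * w x₀) ^ 2 ≤ ((C + C₀) / R ^ 2 * ∑ z ∈ B R, ψ z * w (x₀ + z)) ^ 2 :=
          pow_le_pow_left₀ (mul_nonneg hc.le (hw _)) h1 2
      _ = ((C + C₀) / R ^ 2) ^ 2 * (∑ z ∈ B R, ψ z * w (x₀ + z)) ^ 2 := by ring
      _ ≤ ((C + C₀) / R ^ 2) ^ 2 * ((C₁ * 6 * R) * (343 * R ^ 3 * S)) := by
          refine mul_le_mul_of_nonneg_left (h2.trans ?_) (sq_nonneg _)
          exact mul_le_mul h3 h4 (Finset.sum_nonneg fun _ _ => sq_nonneg _) (by positivity)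
      _ = _ := by field_simp
  set Q := (C + C₀) ^ 2 * C₁ * 6 * 343 with hQ
  have hQ0 : 0 < Q := by positivity
  have hlim2 : Tendsto (fun x => (c * w x) ^ 2) cofinite (𝓝 0) := by
    rw [Metric.tendsto_nhds]
    intro η hη
    -- With R = |x₀|/2 - 1 the ball around x₀ eventually avoids any fixed finite set, so Cauchy's
    -- criterion makes its weighted sum small.
    obtain ⟨s, hs⟩ := summable_iff_vanishing_norm.1 hsum (η / Q) (by positivity)
    have hev : ∀ᶠ x₀ : Fin d → ℤ in cofinite, ∀ y ∈ s, 2 * latNorm y < latNorm x₀ :=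
      (Finset.eventually_all s).2 fun y _ => tendsto_latNorm.eventually_gt_atTop _
    filter_upwards [hev, tendsto_latNorm.eventually_ge_atTop 4] with x₀ hx₀ hx4
    have h1 := hsq x₀ (latNorm x₀ / 2 - 1) (by linarith) (by ring)
    have h2 := hs ((B (latNorm x₀ / 2 - 1)).map (addLeftEmbedding x₀)) (by
      rw [Finset.disjoint_left]
      intro y hy hys
      obtain ⟨z, hz, rfl⟩ := Finset.mem_map.1 hy
      have hz' := (hB _ z).1 hz
      have h3 := hx₀ _ hys
      have h4 := latNorm_sub_le (x₀ + z) z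
      rw [add_sub_cancel_right] at h4
      simp only [addLeftEmbedding_apply] at h3
      linarith)
    rw [Finset.sum_map] at h2
    simp only [addLeftEmbedding_apply] at h2
    rw [Real.dist_eq, sub_zero, abs_of_nonneg (sq_nonneg _)]
    refine h1.trans_lt ?_
    have h3 := (le_abs_self _).trans_lt h2
    rw [lt_div_iff₀ hQ0] at h3
    linarith
  have h1 := (Real.continuous_sqrt.tendsto _).comp hlim2
  have h2 : Tendsto (fun x => c⁻¹ * Real.sqrt ((c * w x) ^ 2)) cofinite (𝓝 (c⁻¹ * Real.sqrt 0)) :=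
    h1.const_mul _
  rw [Real.sqrt_zero, mul_zero] at h2
  refine h2.congr fun x => ?_
  rw [Real.sqrt_sq (mul_nonneg hc.le (hw x)), inv_mul_cancel_left₀ hc.ne']

/-! ### Liouville's theorem. -/

theorem latLap_neg {d : ℕ} (f : (Fin d → ℤ) → ℝ) (x : Fin d → ℤ) :
    latLap (fun z => -f z) x = -latLap f x := by
  have := latLap_const_mul (-1) f x
  simpa using this

/-- Comparison with P = 0 and Θ = δ(1 + ψ), where ψ is strictly superharmonic and the constant 1
provides the lower bound. Taking δ = η/(1 + ψ x) makes Θ equal to η at x. -/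
theorem nonpos_of_harmonic_of_tendsto_zero {d : ℕ} (hd : 3 ≤ d) {u : (Fin d → ℤ) → ℝ}
    (hu : ∀ x, latLap u x = 0) (hlim : Tendsto u cofinite (𝓝 0)) (x : Fin d → ℤ) : u x ≤ 0 := by
  obtain ⟨A, hA, h⟩ := exists_superharmonic_rpow hd
  have hρ : ∀ x : Fin d → ℤ, 0 < A + latSq x := fun x => by linarith [latSq_nonneg x]
  set ψ : (Fin d → ℤ) → ℝ := fun x => (A + latSq x) ^ (-(((d : ℝ) - 2) / 2)) with hψ
  have hψ0 : ∀ x, 0 < ψ x := fun x => Real.rpow_pos_of_pos (hρ x) _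
  refine le_of_forall_pos_le_add fun η hη => ?_
  have hδ : 0 < η / (1 + ψ x) := div_pos hη (by linarith [hψ0 x])
  have key := le_of_subsolution_of_supersolution (w := u) (P := fun _ => 0)
    (Θ := fun y => η / (1 + ψ x) * (1 + ψ y)) hδ hlim
    (fun y => le_mul_of_one_le_right hδ.le (by linarith [hψ0 y])) (fun y => by simp [hu])
    (fun y => Or.inr ?_) x
  · rwa [div_mul_cancel₀ _ (by linarith [hψ0 x] : (1 + ψ x) ≠ 0), ← zero_add η] at key
  · rw [zero_mul, latLap_const_mul, latLap_add, latLap_const, zero_add, ← mul_neg]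
    exact mul_pos hδ ((Real.rpow_pos_of_pos (hρ y) _).trans_le (h A le_rfl y))

/-- Liouville theorem: a lattice harmonic function tending to zero vanishes. -/
theorem eq_zero_of_harmonic_of_tendsto_zero {d : ℕ} (hd : 3 ≤ d) {u : (Fin d → ℤ) → ℝ}
    (hu : ∀ x, latLap u x = 0) (hlim : Tendsto u cofinite (𝓝 0)) (x : Fin d → ℤ) : u x = 0 := by
  refine le_antisymm (nonpos_of_harmonic_of_tendsto_zero hd hu hlim x) ?_
  have := nonpos_of_harmonic_of_tendsto_zero hd (u := fun z => -u z)
    (fun x => by rw [latLap_neg, hu, neg_zero]) (by simpa using hlim.neg) x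
  linarith

/-! ### Interior gradient estimate by reflection and a quadratic barrier. -/

/-- Reflection of the lattice across the hyperplane `x_j = 1/2`. -/
def latReflect {d : ℕ} (j : Fin d) (z : Fin d → ℤ) : Fin d → ℤ := Function.update z j (1 - z j)

theorem latLap_comp_latReflect {d : ℕ} (j : Fin d) (u : (Fin d → ℤ) → ℝ) (z : Fin d → ℤ) :
    latLap (fun z => u (latReflect j z)) z = latLap u (latReflect j z) := by
  refine Finset.sum_congr rfl fun i _ => ?_
  by_cases hij : i = j
  · subst hij
    have h1 : latReflect i (z + Pi.single i 1) = latReflect i z - Pi.single i 1 := by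
      ext k; by_cases hk : k = i
      · subst hk; simp [latReflect]
      · simp [latReflect, hk]
    have h2 : latReflect i (z - Pi.single i 1) = latReflect i z + Pi.single i 1 := by
      ext k; by_cases hk : k = i
      · subst hk; simp [latReflect]; ring
      · simp [latReflect, hk]
    simp only [h1, h2]; ring
  · have hji : j ≠ i := fun h => hij h.symm
    have h1 : latReflect j (z + Pi.single i 1) = latReflect j z + Pi.single i 1 := by
      ext k; by_cases hk : k = j
      · subst hk; simp [latReflect, hji]
      · simp [latReflect, hk]
    have h2 : latReflect j (z - Pi.single i 1) = latReflect j z - Pi.single i 1 := by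
      ext k; by_cases hk : k = j
      · subst hk; simp [latReflect, hji]
      · simp [latReflect, hk]
    simp only [h1, h2]

/-- The quadratic barrier of the reflection argument. -/
noncomputable def gradBarrier {d : ℕ} (j : Fin d) (A₁ A₂ A₃ : ℝ) (z : Fin d → ℤ) : ℝ :=
  A₁ * (latSq z - (z j : ℝ) ^ 2) + A₂ * (2 * z j - 1) - A₃ * (2 * z j - 1) ^ 2 + A₃

theorem latLap_gradBarrier {d : ℕ} (j : Fin d) (A₁ A₂ A₃ : ℝ) (z : Fin d → ℤ) :
    latLap (gradBarrier j A₁ A₂ A₃) z = 2 * A₁ * (d - 1) - 8 * A₃ := by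
  have h : ∀ i : Fin d, ((gradBarrier j A₁ A₂ A₃ (z + Pi.single i 1) - gradBarrier j A₁ A₂ A₃ z) +
      (gradBarrier j A₁ A₂ A₃ (z - Pi.single i 1) - gradBarrier j A₁ A₂ A₃ z)) =
      2 * A₁ + if i = j then -8 * A₃ - 2 * A₁ else 0 := by
    intro i
    simp only [gradBarrier, latSq_add_single, latSq_sub_single]
    by_cases hij : i = j
    · subst hij; simp; ring
    · have hji : j ≠ i := fun h => hij h.symm
      simp [hij, hji]; ring
  rw [latLap, Finset.sum_congr rfl fun i _ => h i, Finset.sum_add_distrib]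
  simp; ring

theorem sq_add_sq_le_latSq {d : ℕ} (z : Fin d → ℤ) {i j : Fin d} (hij : i ≠ j) :
    (z i : ℝ) ^ 2 + (z j : ℝ) ^ 2 ≤ latSq z := by
  rw [← Finset.sum_pair (f := fun k => (z k : ℝ) ^ 2) hij]
  exact Finset.sum_le_sum_of_subset_of_nonneg (Finset.subset_univ _) fun _ _ _ => sq_nonneg _

/-- The reflection σ across x_j = 1/2 exchanges 0 and e_j, so the difference sought is the value at
e_j of the odd function w = u - u∘σ. On the half box 1 ≤ z_j ≤ n the maximum principle puts w below
a barrier B that is at least 2M on the outer faces; oddness takes the place of a boundary condition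
on the hyperplane. -/
theorem sub_le_of_abs_latLap_le {d : ℕ} (j : Fin d) {u : (Fin d → ℤ) → ℝ} {n : ℕ} (hn : 1 ≤ n)
    {M K : ℝ} (hM : ∀ z : Fin d → ℤ, (∀ i, |z i| ≤ n) → |u z| ≤ M)
    (hK : ∀ z : Fin d → ℤ, (∀ i, |z i| ≤ n) → |latLap u z| ≤ K) :
    u (Pi.single j 1) - u 0 ≤ (d + 1) * M / n + n * K / 2 := by
  have hn' : (1 : ℝ) ≤ n := by exact_mod_cast hn
  have hd1 : (1 : ℝ) ≤ d := by exact_mod_cast (Fin.pos j)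
  have hM0 : 0 ≤ M := (abs_nonneg _).trans (hM 0 (by simp))
  have hK0 : 0 ≤ K := (abs_nonneg _).trans (hK 0 (by simp))
  refine le_of_forall_pos_le_add fun η hη => ?_
  set δ := 2 * η / n with hδ
  have hδ0 : 0 < δ := by positivity
  set A₁ := 2 * M / n ^ 2 with hA₁
  -- A₁n² = 2M handles the side faces; A₃ gives ΔB = -2(K+δ), strictly below Δw ≥ -2K. With t = 2z_j
  -- - 1, A₂ ensures A₂t - A₃t² ≥ 2Mt/n for 0 ≤ t ≤ 2n, hence at least 2M at z_j = n. The constant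
  -- A₃ in B cancels -A₃t² at t = ±1, so B(e_j) = A₂.
  set A₃ := (d - 1) * A₁ / 4 + (K + δ) / 4 with hA₃
  set A₂ := 2 * n * A₃ + 2 * M / n with hA₂
  have hA₁0 : 0 ≤ A₁ := by positivity
  have hA₃0 : 0 ≤ A₃ := by
    have : 0 ≤ (d - 1) * A₁ / 4 := div_nonneg (mul_nonneg (by linarith) hA₁0) (by norm_num)
    positivity
  set B := gradBarrier j A₁ A₂ A₃ with hB
  have hLB : ∀ z, latLap B z = -2 * (K + δ) := fun z => by
    rw [hB, latLap_gradBarrier, hA₃]; ring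
  set w : (Fin d → ℤ) → ℝ := fun z => u z - u (latReflect j z) with hw
  have he : w (Pi.single j 1) = u (Pi.single j 1) - u 0 := by
    have : latReflect j (Pi.single j 1) = 0 := by
      ext k; by_cases hk : k = j
      · subst hk; simp [latReflect]
      · simp [latReflect, hk]
    simp only [hw, this]
  have hBe : B (Pi.single j 1) = (d + 1) * M / n + n * K / 2 + η := by
    have : latSq (Pi.single j 1 : Fin d → ℤ) = 1 := by rw [← latNorm_sq, latNorm_single]; norm_num
    simp only [hB, gradBarrier, this, Pi.single_eq_same, Int.cast_one]
    rw [hA₂, hA₃, hA₁, hδ]; field_simp; ring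
  rw [← he, ← hBe]
  by_contra hcon
  rw [not_le] at hcon
  let S : Finset (Fin d → ℤ) :=
    Fintype.piFinset fun i => if i = j then Finset.Icc 1 (n : ℤ) else Finset.Icc (-(n : ℤ)) n
  have hS : ∀ z, z ∈ S ↔ (∀ i, i ≠ j → |z i| ≤ n) ∧ 1 ≤ z j ∧ z j ≤ n := by
    intro z
    simp only [S, Fintype.mem_piFinset]
    constructor
    · intro h
      refine ⟨fun i hi => ?_, ?_⟩
      · have := h i; rw [if_neg hi, Finset.mem_Icc] at this; exact abs_le.2 this
      · have := h j; rwa [if_pos rfl, Finset.mem_Icc] at this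
    · rintro ⟨h1, h2⟩ i
      by_cases hi : i = j
      · subst hi; rw [if_pos rfl, Finset.mem_Icc]; exact h2
      · rw [if_neg hi, Finset.mem_Icc]; exact abs_le.1 (h1 i hi)
  have heS : (Pi.single j 1 : Fin d → ℤ) ∈ S := by
    rw [hS]
    refine ⟨fun i hi => ?_, ?_⟩
    · simp [hi]
    · simp; exact_mod_cast hn
  obtain ⟨p, hpS, hmax⟩ := S.exists_max_image (fun z => w z - B z) ⟨_, heS⟩
  have hpos : 0 < w p - B p := (sub_pos.2 hcon).trans_le (hmax _ heS)
  obtain ⟨hp1, hp2, hp3⟩ := (hS p).1 hpS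
  have hpbox : ∀ i, |p i| ≤ n := fun i => by
    by_cases hi : i = j
    · subst hi; rw [abs_le]; omega
    · exact hp1 i hi
  have hσbox : ∀ i, |latReflect j p i| ≤ n := fun i => by
    by_cases hi : i = j
    · subst hi; simp only [latReflect, Function.update_self]; rw [abs_le]; omega
    · simp only [latReflect, Function.update_of_ne hi]; exact hp1 i hi
  have hwp : w p ≤ 2 * M := by
    have h1 := (abs_le.1 (hM _ hpbox)).2
    have h2 := (abs_le.1 (hM _ hσbox)).1
    simp only [hw]; linarith
  have hp2' : (1 : ℝ) ≤ p j := by exact_mod_cast hp2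
  have hp3' : (p j : ℝ) ≤ n := by exact_mod_cast hp3
  have hlin : 2 * M / n * (2 * p j - 1) ≤ A₂ * (2 * p j - 1) - A₃ * (2 * p j - 1) ^ 2 := by
    rw [hA₂]
    nlinarith [mul_nonneg (mul_nonneg hA₃0 (by linarith : (0 : ℝ) ≤ 2 * p j - 1))
      (by linarith : (0 : ℝ) ≤ 2 * n - (2 * p j - 1))]
  have hlin0 : 0 ≤ 2 * M / n * (2 * p j - 1) := mul_nonneg (by positivity) (by linarith)
  have hqj : 0 ≤ A₁ * (latSq p - (p j : ℝ) ^ 2) :=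
    mul_nonneg hA₁0 (by linarith [coord_sq_le_latSq p j])
  have hBp : B p = A₁ * (latSq p - (p j : ℝ) ^ 2) +
    (A₂ * (2 * p j - 1) - A₃ * (2 * p j - 1) ^ 2) + A₃ := by
    simp only [hB, gradBarrier]; ring
  have hint1 : ∀ i, i ≠ j → |p i| < n := by
    intro i hi
    refine lt_of_le_of_ne (hp1 i hi) fun heq => ?_
    have h1 : (p i : ℝ) ^ 2 = n ^ 2 := by
      rw [← sq_abs, ← Int.cast_abs, heq]; simp
    have h2 := sq_add_sq_le_latSq p hi
    have h3 : 2 * M ≤ A₁ * (latSq p - (p j : ℝ) ^ 2) := by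
      calc 2 * M = A₁ * n ^ 2 := by rw [hA₁]; field_simp
        _ ≤ _ := mul_le_mul_of_nonneg_left (by linarith) hA₁0
    linarith
  have hint2 : p j < n := by
    refine lt_of_le_of_ne hp3 fun heq => ?_
    have h1 : (p j : ℝ) = n := by rw [heq]; simp
    have h2 : 2 * M ≤ 2 * M / n * (2 * p j - 1) := by
      rw [h1, div_mul_eq_mul_div, le_div_iff₀ (by linarith)]
      nlinarith
    linarith
  have hnbr : ∀ i, w (p + Pi.single i 1) - B (p + Pi.single i 1) ≤ w p - B p ∧
      w (p - Pi.single i 1) - B (p - Pi.single i 1) ≤ w p - B p := by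
    intro i
    by_cases hi : i = j
    · subst hi
      refine ⟨hmax _ ((hS _).2 ⟨fun k hk => ?_, ?_⟩), ?_⟩
      · simpa [hk] using hp1 k hk
      · simp; omega
      · rcases hp2.lt_or_eq with h2 | h2
        · refine hmax _ ((hS _).2 ⟨fun k hk => ?_, ?_⟩)
          · simpa [hk] using hp1 k hk
          · simp; omega
        -- When p_j = 1 the lower neighbour leaves the half box but is the mirror image of p. There
        -- w changes sign, while B(p) + B(p - e_j) ≥ 0 as the linear terms cancel, so the maximum
        -- survives.
        · have e1 : latReflect i p = p - Pi.single i 1 := by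
            ext k; by_cases hk : k = i
            · subst hk; simp [latReflect, ← h2]
            · simp [latReflect, hk]
          have e2 : latReflect i (p - Pi.single i 1) = p := by
            ext k; by_cases hk : k = i
            · subst hk; simp [latReflect, ← h2]
            · simp [latReflect, hk]
          have e3 : w (p - Pi.single i 1) = -w p := by simp only [hw, e1, e2]; ring
          have e4 : 0 ≤ B (p - Pi.single i 1) + B p := by
            have : (p i : ℝ) = 1 := by exact_mod_cast h2.symm
            rw [hBp]
            simp only [hB, gradBarrier, latSq_sub_single, Pi.sub_apply, Pi.single_eq_same]
            push_cast
            rw [this] at hqj ⊢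
            linarith
          rw [e3]; linarith
    · have hji : j ≠ i := fun h => hi h.symm
      have hlt := abs_lt.1 (hint1 i hi)
      refine ⟨hmax _ ((hS _).2 ⟨fun k hk => ?_, by simpa [hji] using ⟨hp2, hp3⟩⟩),
        hmax _ ((hS _).2 ⟨fun k hk => ?_, by simpa [hji] using ⟨hp2, hp3⟩⟩)⟩
      all_goals
        by_cases hki : k = i
        · subst hki; simp; rw [abs_le]; omega
        · simpa [hki] using hp1 k hk
  have hlap : latLap (fun z => w z - B z) p ≤ 0 :=
    Finset.sum_nonpos fun i _ => by linarith [(hnbr i).1, (hnbr i).2]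
  rw [latLap_sub, hLB, hw, latLap_sub, latLap_comp_latReflect] at hlap
  have h1 := (abs_le.1 (hK _ hpbox)).1
  have h2 := (abs_le.1 (hK _ hσbox)).2
  linarith

/-- Interior gradient estimate for the lattice Poisson equation. -/
theorem abs_sub_le_of_abs_latLap_le {d : ℕ} (j : Fin d) {u : (Fin d → ℤ) → ℝ} {n : ℕ} (hn : 1 ≤ n)
    {M K : ℝ} (x : Fin d → ℤ) (hM : ∀ z : Fin d → ℤ, (∀ i, |z i| ≤ n) → |u (x + z)| ≤ M)
    (hK : ∀ z : Fin d → ℤ, (∀ i, |z i| ≤ n) → |latLap u (x + z)| ≤ K) :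
    |u (x + Pi.single j 1) - u x| ≤ (d + 1) * M / n + n * K / 2 := by
  have h1 := sub_le_of_abs_latLap_le j (u := fun z => u (x + z)) hn hM
    (fun z hz => by rw [latLap_comp_add]; exact hK z hz)
  have h2 := sub_le_of_abs_latLap_le j (u := fun z => -u (x + z)) hn (M := M) (K := K)
    (fun z hz => by rw [abs_neg]; exact hM z hz)
    (fun z hz => by
      rw [latLap_neg (fun z => u (x + z)), abs_neg, latLap_comp_add]; exact hK z hz)
  rw [add_zero] at h1 h2
  rw [abs_le]
  constructor <;> linarith

theorem exists_forall_le_of_eventually_le {α : Type*} {f g : α → ℝ} {C : ℝ} (hg : ∀ x, 0 < g x)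
    (h : ∀ᶠ x in cofinite, f x ≤ C * g x) : ∃ C' : ℝ, 0 < C' ∧ ∀ x, f x ≤ C' * g x := by
  rw [eventually_cofinite] at h
  obtain ⟨B, hB⟩ := (h.image fun x => f x / g x).bddAbove
  refine ⟨max 1 (max B C), lt_max_of_lt_left one_pos, fun x => ?_⟩
  by_cases hx : f x ≤ C * g x
  · exact hx.trans (mul_le_mul_of_nonneg_right
      ((le_max_right _ _).trans (le_max_right _ _)) (hg x).le)
  · have h1 : f x / g x ≤ B := hB (Set.mem_image_of_mem _ hx)
    rw [div_le_iff₀ (hg x)] at h1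
    exact h1.trans (mul_le_mul_of_nonneg_right
      ((le_max_left _ _).trans (le_max_right _ _)) (hg x).le)

theorem jap_rpow_neg_le_of_le {d : ℕ} {x y : Fin d → ℤ} {c p : ℝ} (hc : 0 < c) (hp : 0 ≤ p)
    (h : c * jap x ≤ jap y) : jap y ^ (-p) ≤ c ^ (-p) * jap x ^ (-p) := by
  rw [← Real.mul_rpow hc.le (jap_pos x).le]
  exact Real.rpow_le_rpow_of_nonpos (mul_pos hc (jap_pos x)) h (by linarith)

/-- Apply the interior estimate on a box of size n comparable to |x|: then M/n and nK are both of
order ⟨x⟩^(1-d). -/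
theorem exists_abs_grad_le {d : ℕ} (hd : 3 ≤ d) {u : (Fin d → ℤ) → ℝ} {C₁ C₂ : ℝ}
    (hu : ∀ x, |u x| ≤ C₁ * jap x ^ (2 - (d : ℝ))) (hLu : ∀ x, |latLap u x| ≤ C₂ * jap x ^ (-(d : ℝ))) :
    ∃ C : ℝ, 0 < C ∧ ∀ x (j : Fin d), |u (x + Pi.single j 1) - u x| ≤ C * jap x ^ (1 - (d : ℝ)) := by
  have hd' : (3 : ℝ) ≤ d := by exact_mod_cast hd
  have hpos : ∀ (x : Fin d → ℤ) (p : ℝ), 0 < jap x ^ p := fun x p => Real.rpow_pos_of_pos (jap_pos x) p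
  have hC₁ : 0 ≤ C₁ := by
    by_contra hneg
    nlinarith [hu 0, abs_nonneg (u 0), hpos 0 (2 - (d : ℝ))]
  have hC₂ : 0 ≤ C₂ := by
    by_contra hneg
    nlinarith [hLu 0, abs_nonneg (latLap u 0), hpos 0 (-(d : ℝ))]
  set E : ℝ := (d + 1) * (C₁ * (1 / 2 : ℝ) ^ (-((d : ℝ) - 2))) * (8 * (d + 1)) +
    C₂ * (1 / 2 : ℝ) ^ (-(d : ℝ)) / 2
  have hev : ∀ᶠ x : Fin d → ℤ in cofinite, ∀ j : Fin d,
      |u (x + Pi.single j 1) - u x| ≤ E * jap x ^ (1 - (d : ℝ)) := by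
    filter_upwards [tendsto_latNorm.eventually_ge_atTop (12 * ((d : ℝ) + 1))] with x hx j
    set r := latNorm x with hr
    set D : ℝ := (d : ℝ) + 1 with hD
    have hD1 : 4 ≤ D := by rw [hD]; linarith
    -- Subtracting 2 gives D(n+2) ≤ r/2, so every z in the box has |z| ≤ r/2; the lower bound r ≥
    -- 12D keeps n ≥ r/(4D).
    set n := ⌊r / (2 * D)⌋₊ - 2 with hn
    have hfl : r / (2 * D) < ⌊r / (2 * D)⌋₊ + 1 := Nat.lt_floor_add_one _
    have hfl2 : (⌊r / (2 * D)⌋₊ : ℝ) ≤ r / (2 * D) := 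
      Nat.floor_le (div_nonneg (latNorm_nonneg x) (by linarith))
    have h6 : 6 ≤ r / (2 * D) := by rw [le_div_iff₀ (by linarith)]; linarith
    have h2le : 2 ≤ ⌊r / (2 * D)⌋₊ := Nat.le_floor (by push_cast; linarith)
    have hncast : (n : ℝ) = ⌊r / (2 * D)⌋₊ - 2 := by rw [hn, Nat.cast_sub h2le]; norm_num
    have hnlow : r / (4 * D) ≤ n := by
      have : r / (4 * D) = r / (2 * D) / 2 := by field_simp; ring
      rw [this, hncast]; linarith
    have hn1' : (1 : ℝ) ≤ n := by rw [hncast]; linarith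
    have hn1 : 1 ≤ n := by exact_mod_cast hn1'
    have hj2 : jap x ≤ 2 * r := by linarith [jap_le_one_add_latNorm x]
    have hnJ : jap x ≤ 8 * D * n := by
      rw [div_le_iff₀ (by linarith)] at hnlow; linarith
    have hnJ2 : (n : ℝ) ≤ jap x := by
      have : r / (2 * D) ≤ r := div_le_self (latNorm_nonneg x) (by linarith)
      have := latNorm_lt_jap x
      rw [hncast]; linarith
    have hbox : ∀ z : Fin d → ℤ, (∀ i, |z i| ≤ n) → 1 / 2 * jap x ≤ jap (x + z) := by
      intro z hz
      refine jap_ge_of_latNorm_ge (by norm_num) (by norm_num) ?_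
      have hsup : supN z ≤ n := Finset.sup_le fun i _ => by
        have := hz i
        rw [Int.abs_eq_natAbs] at this
        exact_mod_cast this
      have hsup' : (supN z : ℝ) ≤ n := by exact_mod_cast hsup
      have h1 : latNorm z ≤ D * (n + 2) := by
        refine (latNorm_lt_jap z).le.trans ((jap_le_supN z).trans ?_)
        exact mul_le_mul_of_nonneg_left (by linarith) (by linarith)
      have h2 : D * (n + 2) ≤ r / 2 := by
        have : (n : ℝ) + 2 ≤ r / (2 * D) := by rw [hncast]; linarith
        calc D * (n + 2) ≤ D * (r / (2 * D)) := mul_le_mul_of_nonneg_left this (by linarith)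
          _ = r / 2 := by field_simp
      have h3 := latNorm_sub_le (x + z) z
      rw [add_sub_cancel_right] at h3
      linarith
    have hM : ∀ z : Fin d → ℤ, (∀ i, |z i| ≤ n) → |u (x + z)| ≤
        C₁ * ((1 / 2 : ℝ) ^ (-((d : ℝ) - 2)) * jap x ^ (-((d : ℝ) - 2))) := fun z hz => by
      refine (hu _).trans (mul_le_mul_of_nonneg_left ?_ hC₁)
      have := jap_rpow_neg_le_of_le (p := (d : ℝ) - 2) (by norm_num) (by linarith) (hbox z hz)
      rwa [neg_sub] at this ⊢
    have hK : ∀ z : Fin d → ℤ, (∀ i, |z i| ≤ n) → |latLap u (x + z)| ≤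
        C₂ * ((1 / 2 : ℝ) ^ (-(d : ℝ)) * jap x ^ (-(d : ℝ))) := fun z hz =>
      (hLu _).trans (mul_le_mul_of_nonneg_left
        (jap_rpow_neg_le_of_le (by norm_num) (by linarith) (hbox z hz)) hC₂)
    refine (abs_sub_le_of_abs_latLap_le j hn1 x hM hK).trans ?_
    have hJ := jap_pos x
    have e1 : jap x ^ (-((d : ℝ) - 2)) = jap x ^ (1 - (d : ℝ)) * jap x := by
      rw [← Real.rpow_add_one hJ.ne']; congr 1; ring
    have e2 : jap x ^ (1 - (d : ℝ)) = jap x ^ (-(d : ℝ)) * jap x := by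
      rw [← Real.rpow_add_one hJ.ne']; congr 1; ring
    have b1 : (d + 1) * (C₁ * ((1 / 2 : ℝ) ^ (-((d : ℝ) - 2)) * jap x ^ (-((d : ℝ) - 2)))) / n ≤
        (d + 1) * (C₁ * (1 / 2 : ℝ) ^ (-((d : ℝ) - 2))) * (8 * (d + 1)) * jap x ^ (1 - (d : ℝ)) := by
      rw [div_le_iff₀ (by linarith), e1]
      have : 0 ≤ (d + 1) * (C₁ * (1 / 2 : ℝ) ^ (-((d : ℝ) - 2))) * jap x ^ (1 - (d : ℝ)) := by
        have := hpos x (1 - (d : ℝ)); positivity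
      calc _ = (d + 1) * (C₁ * (1 / 2 : ℝ) ^ (-((d : ℝ) - 2))) * jap x ^ (1 - (d : ℝ)) * jap x := by
            ring
        _ ≤ (d + 1) * (C₁ * (1 / 2 : ℝ) ^ (-((d : ℝ) - 2))) * jap x ^ (1 - (d : ℝ)) *
            (8 * D * n) := mul_le_mul_of_nonneg_left hnJ this
        _ = _ := by rw [hD]; ring
    have b2 : n * (C₂ * ((1 / 2 : ℝ) ^ (-(d : ℝ)) * jap x ^ (-(d : ℝ)))) / 2 ≤
        C₂ * (1 / 2 : ℝ) ^ (-(d : ℝ)) / 2 * jap x ^ (1 - (d : ℝ)) := by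
      have h0 : 0 ≤ C₂ * ((1 / 2 : ℝ) ^ (-(d : ℝ)) * jap x ^ (-(d : ℝ))) := by
        have := hpos x (-(d : ℝ)); positivity
      have := mul_le_mul_of_nonneg_right hnJ2 h0
      rw [e2]; linarith
    exact (add_le_add b1 b2).trans (le_of_eq (add_mul _ _ _).symm)
  have hev' : ∀ᶠ x : Fin d → ℤ in cofinite,
      ∑ j : Fin d, |u (x + Pi.single j 1) - u x| ≤ (d * E) * jap x ^ (1 - (d : ℝ)) := by
    filter_upwards [hev] with x hx
    refine (Finset.sum_le_sum fun j _ => hx j).trans (le_of_eq ?_)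
    simp; ring
  obtain ⟨C, hC, h⟩ := exists_forall_le_of_eventually_le (fun x => hpos x _) hev'
  exact ⟨C, hC, fun x j => (Finset.single_le_sum
    (f := fun j => |u (x + Pi.single j 1) - u x|) (fun _ _ => abs_nonneg _)
    (Finset.mem_univ j)).trans (h x)⟩

/-! ### Convolution estimates and the reciprocity u ∑Δv ≈ v ∑Δu. -/

/-- Move one coordinate of y at a time by one unit towards zero. All intermediate points stay in the
coordinate box of the fixed y₀, so the same D serves throughout the induction on the ℓ¹ norm. -/
theorem abs_sub_le_of_path {d : ℕ} {K : (Fin d → ℤ) → ℝ} {D : ℝ} (x y₀ : Fin d → ℤ)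
    (h : ∀ z : Fin d → ℤ, (∀ k, |z k| ≤ |y₀ k|) → ∀ i, |K (x - z + Pi.single i 1) - K (x - z)| ≤ D)
    (n : ℕ) : ∀ y : Fin d → ℤ, (∀ k, |y k| ≤ |y₀ k|) → ∑ k, (y k).natAbs = n →
      |K (x - y) - K x| ≤ n * D := by
  induction n with
  | zero =>
    intro y _ hy
    have : y = 0 := by
      ext k
      have := (Finset.sum_eq_zero_iff.1 hy) k (Finset.mem_univ k)
      simpa using this
    simp [this]
  | succ n ih =>
    intro y hy hsum
    obtain ⟨i, hi⟩ : ∃ i, y i ≠ 0 := by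
      by_contra hcon
      push Not at hcon
      simp [hcon] at hsum
    have hsum' : ∀ y' : Fin d → ℤ, (∀ k, k ≠ i → y' k = y k) → (y' i).natAbs + 1 = (y i).natAbs →
        ∑ k, (y' k).natAbs = n := by
      intro y' h1 h2
      rw [← Finset.add_sum_erase _ _ (Finset.mem_univ i)] at hsum ⊢
      have : ∑ k ∈ Finset.univ.erase i, (y' k).natAbs = ∑ k ∈ Finset.univ.erase i, (y k).natAbs :=
        Finset.sum_congr rfl fun k hk => by rw [h1 k (Finset.ne_of_mem_erase hk)]
      omega
    rcases lt_or_gt_of_ne hi with hneg | hpos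
    · set y' : Fin d → ℤ := y + Pi.single i 1 with hy'
      have hle : ∀ k, |y' k| ≤ |y₀ k| := fun k => by
        by_cases hk : k = i
        · subst hk
          refine le_trans ?_ (hy k)
          simp only [hy', Pi.add_apply, Pi.single_eq_same]
          rw [abs_le, abs_of_neg hneg]; omega
        · simpa [hy', hk] using hy k
      have hn := ih y' hle (hsum' y' (fun k hk => by simp [hy', hk]) (by simp [hy']; omega))
      have h1 := h y' hle i
      have e : x - y' + Pi.single i 1 = x - y := by rw [hy']; abel
      rw [e] at h1
      calc |K (x - y) - K x| ≤ |K (x - y) - K (x - y')| + |K (x - y') - K x| := abs_sub_le _ _ _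
        _ ≤ D + n * D := add_le_add h1 hn
        _ = _ := by push_cast; ring
    · set y' : Fin d → ℤ := y - Pi.single i 1 with hy'
      have hle : ∀ k, |y' k| ≤ |y₀ k| := fun k => by
        by_cases hk : k = i
        · subst hk
          refine le_trans ?_ (hy k)
          simp only [hy', Pi.sub_apply, Pi.single_eq_same]
          rw [abs_le, abs_of_pos hpos]; omega
        · simpa [hy', hk] using hy k
      have hn := ih y' hle (hsum' y' (fun k hk => by simp [hy', hk]) (by simp [hy']; omega))
      have h1 := h y hy i
      have e : x - y + Pi.single i 1 = x - y' := by rw [hy']; abel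
      rw [e, abs_sub_comm] at h1
      calc |K (x - y) - K x| ≤ |K (x - y) - K (x - y')| + |K (x - y') - K x| := abs_sub_le _ _ _
        _ ≤ D + n * D := add_le_add h1 hn
        _ = _ := by push_cast; ring

theorem sum_natAbs_le {d : ℕ} (y : Fin d → ℤ) : ((∑ k, (y k).natAbs : ℕ) : ℝ) ≤ d * jap y := by
  push_cast
  calc ∑ k, ((y k).natAbs : ℝ) ≤ ∑ _k : Fin d, jap y := by
        refine Finset.sum_le_sum fun k _ => ?_
        rw [Nat.cast_natAbs, Int.cast_abs]
        exact (abs_coord_le_latNorm y k).trans (latNorm_lt_jap y).le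
    _ = _ := by simp

theorem jap_mono_latNorm {d : ℕ} {x y : Fin d → ℤ} (h : latNorm x ≤ latNorm y) : jap x ≤ jap y := by
  simpa using jap_ge_of_latNorm_ge (c := 1) zero_le_one le_rfl (by simpa using h)

theorem powSum_nonneg (ε R : ℝ) : 0 ≤ powSum ε R :=
  Finset.sum_nonneg fun _ _ => by positivity

theorem powSum_le_two_mul {ε R : ℝ} (hε : 0 ≤ ε) (hR : 1 ≤ R) : powSum ε R ≤ 2 * R := by
  refine le_trans (Finset.sum_le_sum fun k _ => ?_) (powSum_zero_le hR)
  exact Real.rpow_le_rpow_of_exponent_le (by simp) (by linarith)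

/-- Three regions. For |y| ≤ |x|/2 a lattice path and the gradient bound give ⟨x⟩^(1-d) times the
sum of ⟨y⟩^(1-d-ε), which is the `powSum` factor. For larger y with ⟨x-y⟩ > ⟨x⟩ the tail of f
suffices. For larger y with ⟨x-y⟩ ≤ ⟨x⟩, f is O(⟨x⟩^(-d-ε)) and K sums to O(⟨x⟩²) over the ball. The
last two regions give ⟨x⟩^(2-d-ε). Bounding finite sums uniformly also yields summability. -/
theorem exists_sum_abs_conv_sub_le {d : ℕ} (hd : 3 ≤ d) {ε : ℝ} (hε0 : 0 < ε) (hε : ε ≤ 1)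
    {f K : (Fin d → ℤ) → ℝ} {Cf CK CG : ℝ}
    (hf : ∀ y, |f y| ≤ Cf * jap y ^ (-(d : ℝ) - ε)) (hK : ∀ x, |K x| ≤ CK * jap x ^ (2 - (d : ℝ)))
    (hG : ∀ x (j : Fin d), |K (x + Pi.single j 1) - K x| ≤ CG * jap x ^ (1 - (d : ℝ))) :
    ∃ C : ℝ, 0 ≤ C ∧ ∀ (x : Fin d → ℤ) (F : Finset (Fin d → ℤ)),
      ∑ y ∈ F, |f y * (K (x - y) - K x)| ≤ C * (jap x ^ (1 - (d : ℝ)) * powSum ε (jap x)) := by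
  have hd' : (3 : ℝ) ≤ d := by exact_mod_cast hd
  have hpos : ∀ (x : Fin d → ℤ) (p : ℝ), 0 < jap x ^ p := fun x p => Real.rpow_pos_of_pos (jap_pos x) p
  have hCf : 0 ≤ Cf := by
    by_contra hneg
    nlinarith [hf 0, abs_nonneg (f 0), hpos 0 (-(d : ℝ) - ε)]
  have hCK : 0 ≤ CK := by
    by_contra hneg
    nlinarith [hK 0, abs_nonneg (K 0), hpos 0 (2 - (d : ℝ))]
  have hCG : 0 ≤ CG := by
    by_contra hneg
    nlinarith [hG 0 ⟨0, by omega⟩, abs_nonneg (K (0 + Pi.single ⟨0, by omega⟩ 1) - K 0),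
      hpos 0 (1 - (d : ℝ))]
  obtain ⟨S₁, hS₁, hnear⟩ := exists_sum_jap_rpow_le (d := d) (by omega) hε0.le
  obtain ⟨S₀, hS₀, hball⟩ := exists_sum_jap_rpow_le (d := d) (by omega) le_rfl
  obtain ⟨S₂, hS₂, htail⟩ := exists_sum_tail_jap_rpow_le (d := d) (by omega) hε0 hε
  set E₁ := Cf * (d * (CG * (1 / 2 : ℝ) ^ (-((d : ℝ) - 1)))) * S₁ with hE₁
  set E₂ := Cf * (2 * CK) * (S₂ * (1 / 2 : ℝ) ^ (-ε)) with hE₂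
  set E₃ := Cf * (1 / 2 : ℝ) ^ (-((d : ℝ) + ε)) * (2 * CK) * (S₀ * 2) with hE₃
  refine ⟨E₁ + E₂ + E₃, by positivity, fun x F => ?_⟩
  have hJ := jap_pos x
  have hJ1 := one_le_jap x
  set J := jap x with hJdef
  have hT : J ^ (2 - (d : ℝ) - ε) ≤ J ^ (1 - (d : ℝ)) * powSum ε J := by
    calc J ^ (2 - (d : ℝ) - ε) = J ^ (1 - (d : ℝ)) * J ^ (1 - ε) := by
          rw [← Real.rpow_add hJ]; congr 1; ring
      _ ≤ _ := mul_le_mul_of_nonneg_left (rpow_le_powSum hε0.le hε hJ1) (hpos x _).le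
  have hfar : ∀ y : Fin d → ℤ, ¬ 2 * latNorm y ≤ latNorm x → 1 / 2 * J ≤ jap y := fun y hy =>
    jap_ge_of_latNorm_ge (by norm_num) (by norm_num) (by rw [not_le] at hy; linarith)
  have b₁ : ∑ y ∈ F with 2 * latNorm y ≤ latNorm x, |f y * (K (x - y) - K x)| ≤
      E₁ * (J ^ (1 - (d : ℝ)) * powSum ε J) := by
    have hterm : ∀ y : Fin d → ℤ, 2 * latNorm y ≤ latNorm x → |f y * (K (x - y) - K x)| ≤
        Cf * (d * (CG * (1 / 2 : ℝ) ^ (-((d : ℝ) - 1)))) * J ^ (1 - (d : ℝ)) *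
          jap y ^ (1 - (d : ℝ) - ε) := by
      intro y hy
      have hpath := abs_sub_le_of_path (K := K)
        (D := CG * ((1 / 2 : ℝ) ^ (-((d : ℝ) - 1)) * J ^ (-((d : ℝ) - 1)))) x y (fun z hz i => by
          refine (hG _ i).trans (mul_le_mul_of_nonneg_left ?_ hCG)
          have h1 : 1 / 2 * J ≤ jap (x - z) := by
            refine jap_ge_of_latNorm_ge (by norm_num) (by norm_num) ?_
            have := latNorm_mono hz
            linarith [latNorm_le_sub_add x z]
          have := jap_rpow_neg_le_of_le (p := (d : ℝ) - 1) (by norm_num) (by linarith) h1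
          rwa [neg_sub] at this ⊢) _ y (fun _ => le_rfl) rfl
      rw [abs_mul]
      have e1 : jap y ^ (1 - (d : ℝ) - ε) = jap y ^ (-(d : ℝ) - ε) * jap y := by
        rw [← Real.rpow_add_one (jap_pos y).ne']; congr 1; ring
      have e2 : J ^ (-((d : ℝ) - 1)) = J ^ (1 - (d : ℝ)) := by rw [neg_sub]
      have hD0 : 0 ≤ CG * ((1 / 2 : ℝ) ^ (-((d : ℝ) - 1)) * J ^ (-((d : ℝ) - 1))) := by positivity
      calc |f y| * |K (x - y) - K x| ≤ (Cf * jap y ^ (-(d : ℝ) - ε)) *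
          ((d * jap y) * (CG * ((1 / 2 : ℝ) ^ (-((d : ℝ) - 1)) * J ^ (-((d : ℝ) - 1))))) :=
            mul_le_mul (hf y) (hpath.trans (mul_le_mul_of_nonneg_right (sum_natAbs_le y) hD0))
              (abs_nonneg _) (mul_nonneg hCf (hpos y _).le)
        _ = _ := by rw [e1, e2]; ring
    calc _ ≤ ∑ y ∈ F with 2 * latNorm y ≤ latNorm x,
          Cf * (d * (CG * (1 / 2 : ℝ) ^ (-((d : ℝ) - 1)))) * J ^ (1 - (d : ℝ)) *
          jap y ^ (1 - (d : ℝ) - ε) :=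
          Finset.sum_le_sum fun y hy => hterm y (Finset.mem_filter.1 hy).2
      _ ≤ Cf * (d * (CG * (1 / 2 : ℝ) ^ (-((d : ℝ) - 1)))) * J ^ (1 - (d : ℝ)) *
          (S₁ * powSum ε J) := by
          rw [← Finset.mul_sum]
          refine mul_le_mul_of_nonneg_left (hnear _ _ fun y hy => ?_) (by positivity)
          exact jap_mono_latNorm (by linarith [(Finset.mem_filter.1 hy).2, latNorm_nonneg y])
      _ = _ := by rw [hE₁]; ring
  have b₂ : ∑ y ∈ (F.filter fun y => ¬ 2 * latNorm y ≤ latNorm x) with J < jap (x - y),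
      |f y * (K (x - y) - K x)| ≤ E₂ * (J ^ (1 - (d : ℝ)) * powSum ε J) := by
    have hterm : ∀ y : Fin d → ℤ, J < jap (x - y) → |f y * (K (x - y) - K x)| ≤
        Cf * (2 * CK) * J ^ (2 - (d : ℝ)) * jap y ^ (-(d : ℝ) - ε) := by
      intro y hy
      have h1 : jap (x - y) ^ (2 - (d : ℝ)) ≤ J ^ (2 - (d : ℝ)) :=
        Real.rpow_le_rpow_of_nonpos hJ hy.le (by linarith)
      have h2 : |K (x - y) - K x| ≤ 2 * CK * J ^ (2 - (d : ℝ)) := by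
        refine (abs_sub _ _).trans ?_
        have := (hK (x - y)).trans (mul_le_mul_of_nonneg_left h1 hCK)
        linarith [hK x]
      rw [abs_mul]
      calc |f y| * |K (x - y) - K x| ≤ (Cf * jap y ^ (-(d : ℝ) - ε)) *
          (2 * CK * J ^ (2 - (d : ℝ))) :=
            mul_le_mul (hf y) h2 (abs_nonneg _) (mul_nonneg hCf (hpos y _).le)
        _ = _ := by ring
    calc _ ≤ ∑ y ∈ (F.filter fun y => ¬ 2 * latNorm y ≤ latNorm x) with J < jap (x - y),
          Cf * (2 * CK) * J ^ (2 - (d : ℝ)) * jap y ^ (-(d : ℝ) - ε) :=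
          Finset.sum_le_sum fun y hy => hterm y (Finset.mem_filter.1 hy).2
      _ ≤ Cf * (2 * CK) * J ^ (2 - (d : ℝ)) * (S₂ * (1 / 2 * J) ^ (-ε)) := by
          rw [← Finset.mul_sum]
          refine mul_le_mul_of_nonneg_left (htail _ _ (by positivity) fun y hy => ?_)
            (by positivity)
          exact hfar y (Finset.mem_filter.1 (Finset.mem_filter.1 hy).1).2
      _ = E₂ * J ^ (2 - (d : ℝ) - ε) := by
          rw [Real.mul_rpow (by norm_num) hJ.le, sub_eq_add_neg (2 - (d : ℝ)) ε,
            Real.rpow_add hJ, hE₂]; ring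
      _ ≤ _ := mul_le_mul_of_nonneg_left hT (by positivity)
  have b₃ : ∑ y ∈ (F.filter fun y => ¬ 2 * latNorm y ≤ latNorm x) with ¬ J < jap (x - y),
      |f y * (K (x - y) - K x)| ≤ E₃ * (J ^ (1 - (d : ℝ)) * powSum ε J) := by
    have hterm : ∀ y : Fin d → ℤ, ¬ 2 * latNorm y ≤ latNorm x → ¬ J < jap (x - y) →
        |f y * (K (x - y) - K x)| ≤ Cf * ((1 / 2 : ℝ) ^ (-((d : ℝ) + ε)) * J ^ (-((d : ℝ) + ε))) *
          (2 * CK) * J * jap (x - y) ^ (1 - (d : ℝ) - 0) := by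
      intro y hy hxy
      rw [not_lt] at hxy
      have h1 : J ^ (2 - (d : ℝ)) ≤ jap (x - y) ^ (2 - (d : ℝ)) :=
        Real.rpow_le_rpow_of_nonpos (jap_pos _) hxy (by linarith)
      have h2 : |K (x - y) - K x| ≤ 2 * CK * jap (x - y) ^ (2 - (d : ℝ)) := by
        refine (abs_sub _ _).trans ?_
        have := (hK x).trans (mul_le_mul_of_nonneg_left h1 hCK)
        linarith [hK (x - y)]
      have h3 : jap (x - y) ^ (2 - (d : ℝ)) ≤ J * jap (x - y) ^ (1 - (d : ℝ) - 0) := by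
        have e : jap (x - y) ^ (2 - (d : ℝ)) = jap (x - y) * jap (x - y) ^ (1 - (d : ℝ) - 0) := by
          rw [mul_comm, ← Real.rpow_add_one (jap_pos _).ne']; congr 1; ring
        rw [e]; exact mul_le_mul_of_nonneg_right hxy (hpos _ _).le
      have h4 : |f y| ≤ Cf * ((1 / 2 : ℝ) ^ (-((d : ℝ) + ε)) * J ^ (-((d : ℝ) + ε))) := by
        refine (hf y).trans (mul_le_mul_of_nonneg_left ?_ hCf)
        have := jap_rpow_neg_le_of_le (p := (d : ℝ) + ε) (by norm_num) (by linarith) (hfar y hy)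
        rwa [neg_add'] at this ⊢
      rw [abs_mul]
      calc |f y| * |K (x - y) - K x| ≤
          (Cf * ((1 / 2 : ℝ) ^ (-((d : ℝ) + ε)) * J ^ (-((d : ℝ) + ε)))) *
            (2 * CK * (J * jap (x - y) ^ (1 - (d : ℝ) - 0))) :=
            mul_le_mul h4 (h2.trans (mul_le_mul_of_nonneg_left h3 (by positivity)))
              (abs_nonneg _) (by positivity)
        _ = _ := by ring
    calc _ ≤ ∑ y ∈ (F.filter fun y => ¬ 2 * latNorm y ≤ latNorm x) with ¬ J < jap (x - y),
          Cf * ((1 / 2 : ℝ) ^ (-((d : ℝ) + ε)) * J ^ (-((d : ℝ) + ε))) *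
          (2 * CK) * J * jap (x - y) ^ (1 - (d : ℝ) - 0) :=
          Finset.sum_le_sum fun y hy => hterm y
            (Finset.mem_filter.1 (Finset.mem_filter.1 hy).1).2 (Finset.mem_filter.1 hy).2
      _ ≤ Cf * ((1 / 2 : ℝ) ^ (-((d : ℝ) + ε)) * J ^ (-((d : ℝ) + ε))) * (2 * CK) * J *
          (S₀ * (2 * J)) := by
          rw [← Finset.mul_sum]
          refine mul_le_mul_of_nonneg_left ?_ (by positivity)
          rw [← Finset.sum_image (f := fun z => jap z ^ (1 - (d : ℝ) - 0)) (g := fun y => x - y)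
            (fun a _ b _ hab => sub_right_injective hab)]
          refine (hball J _ fun z hz => ?_).trans
            (mul_le_mul_of_nonneg_left (powSum_zero_le hJ1) hS₀.le)
          obtain ⟨y, hy, rfl⟩ := Finset.mem_image.1 hz
          exact not_lt.1 (Finset.mem_filter.1 hy).2
      _ = E₃ * J ^ (2 - (d : ℝ) - ε) := by
          have e : J ^ (2 - (d : ℝ) - ε) = J ^ (-((d : ℝ) + ε)) * J * J := by
            rw [← Real.rpow_add_one hJ.ne', ← Real.rpow_add_one hJ.ne']; congr 1; ring
          rw [e, hE₃]; ring
      _ ≤ _ := mul_le_mul_of_nonneg_left hT (by positivity)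
  rw [← Finset.sum_filter_add_sum_filter_not F fun y => 2 * latNorm y ≤ latNorm x,
    ← Finset.sum_filter_add_sum_filter_not (F.filter fun y => ¬ 2 * latNorm y ≤ latNorm x)
      fun y => J < jap (x - y)]
  rw [add_mul, add_mul]
  linarith

theorem summable_of_abs_le_jap {d : ℕ} (hd : 1 ≤ d) {ε : ℝ} (hε0 : 0 < ε) (hε : ε ≤ 1)
    {f : (Fin d → ℤ) → ℝ} {Cf : ℝ} (hf : ∀ y, |f y| ≤ Cf * jap y ^ (-(d : ℝ) - ε)) :
    Summable f :=
  Summable.of_norm_bounded ((summable_jap_rpow hd hε0 hε).mul_left Cf) hf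

theorem abs_tsum_le_of_sum_abs_le {α : Type*} {h : α → ℝ} {B : ℝ}
    (H : ∀ F : Finset α, ∑ y ∈ F, |h y| ≤ B) : Summable h ∧ |∑' y, h y| ≤ B := by
  have habs : Summable fun y => |h y| := summable_of_sum_le (fun _ => abs_nonneg _) H
  refine ⟨habs.of_abs, ?_⟩
  have h1 := norm_tsum_le_tsum_norm (f := h) habs
  simp only [Real.norm_eq_abs] at h1
  exact h1.trans (habs.tsum_le_of_sum_le H)

theorem exists_abs_conv_sub_le {d : ℕ} (hd : 3 ≤ d) {ε : ℝ} (hε0 : 0 < ε) (hε : ε ≤ 1)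
    {f K : (Fin d → ℤ) → ℝ} {Cf CK CG : ℝ}
    (hf : ∀ y, |f y| ≤ Cf * jap y ^ (-(d : ℝ) - ε)) (hK : ∀ x, |K x| ≤ CK * jap x ^ (2 - (d : ℝ)))
    (hG : ∀ x (j : Fin d), |K (x + Pi.single j 1) - K x| ≤ CG * jap x ^ (1 - (d : ℝ))) :
    (∀ x, Summable fun y => f y * K (x - y)) ∧ ∃ C : ℝ, 0 ≤ C ∧ ∀ x : Fin d → ℤ,
      |(∑' y, f y * K (x - y)) - K x * ∑' y, f y| ≤
        C * (jap x ^ (1 - (d : ℝ)) * powSum ε (jap x)) := by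
  obtain ⟨C, hC, h⟩ := exists_sum_abs_conv_sub_le hd hε0 hε hf hK hG
  have hfs := summable_of_abs_le_jap (by omega) hε0 hε hf
  have hs : ∀ x, Summable fun y => f y * K (x - y) := fun x => by
    have h2 := (abs_tsum_le_of_sum_abs_le (h x)).1.add (hfs.mul_right (K x))
    simpa only [mul_sub, sub_add_cancel] using h2
  refine ⟨hs, C, hC, fun x => ?_⟩
  have e := Summable.tsum_sub (hs x) (hfs.mul_right (K x))
  rw [tsum_mul_right] at e
  have h1 := (abs_tsum_le_of_sum_abs_le (h x)).2
  simp only [mul_sub] at h1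
  rw [e] at h1
  rwa [mul_comm (K x)]

theorem latLap_conv {d : ℕ} {g u : (Fin d → ℤ) → ℝ} (h : ∀ x, Summable fun y => g y * u (x - y))
    (x : Fin d → ℤ) : latLap (fun x => ∑' y, g y * u (x - y)) x = ∑' y, g y * latLap u (x - y) := by
  have h0 := (h x).hasSum
  have := hasSum_sum (s := Finset.univ) fun (j : Fin d) _ =>
    ((h (x + Pi.single j 1)).hasSum.sub h0).add ((h (x - Pi.single j 1)).hasSum.sub h0)
  rw [latLap, ← this.tsum_eq]
  refine tsum_congr fun y => ?_
  rw [latLap, Finset.mul_sum]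
  refine Finset.sum_congr rfl fun j _ => ?_
  rw [add_sub_right_comm, sub_right_comm]
  ring

theorem tendsto_zero_of_conv_bound {d : ℕ} (hd : 3 ≤ d) {ε : ℝ} (hε0 : 0 < ε)
    {F K : (Fin d → ℤ) → ℝ} {C CK S : ℝ} (hC : 0 ≤ C) (hK : ∀ x, |K x| ≤ CK * jap x ^ (2 - (d : ℝ)))
    (h : ∀ x, |F x - K x * S| ≤ C * (jap x ^ (1 - (d : ℝ)) * powSum ε (jap x))) :
    Tendsto F cofinite (𝓝 0) := by
  have hd' : (3 : ℝ) ≤ d := by exact_mod_cast hd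
  have hlim : Tendsto (fun x : Fin d → ℤ => (2 * C + CK * |S|) * jap x ^ (2 - (d : ℝ)))
      cofinite (𝓝 0) := by
    have := ((tendsto_rpow_neg_atTop (by linarith : 0 < (d : ℝ) - 2)).comp
      (tendsto_jap (d := d))).const_mul (2 * C + CK * |S|)
    rw [mul_zero] at this
    refine this.congr fun x => ?_
    simp
  refine squeeze_zero_norm (fun x => ?_) hlim
  have h1 : |F x| ≤ |F x - K x * S| + |K x| * |S| := by
    rw [← abs_mul]
    simpa using abs_add_le (F x - K x * S) (K x * S)
  have h2 := mul_le_mul_of_nonneg_left (powSum_le_two_mul hε0.le (one_le_jap x))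
    (Real.rpow_nonneg (jap_pos x).le (1 - (d : ℝ)))
  have e : jap x ^ (1 - (d : ℝ)) * (2 * jap x) = 2 * jap x ^ (2 - (d : ℝ)) := by
    have : jap x ^ (2 - (d : ℝ)) = jap x ^ (1 - (d : ℝ)) * jap x := by
      rw [← Real.rpow_add_one (jap_pos x).ne']; congr 1; ring
    rw [this]; ring
  rw [e] at h2
  have h3 := mul_le_mul_of_nonneg_left h2 hC
  have h4 := mul_le_mul_of_nonneg_right (hK x) (abs_nonneg S)
  rw [Real.norm_eq_abs]
  linarith [h x]

/-- Two decaying functions and the lattice Laplacians they generate: `(∑ H₀v) u ≈ (∑ H₀u) v`. -/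
theorem exists_abs_mul_tsum_sub_le {d : ℕ} (hd : 3 ≤ d) {ε : ℝ} (hε0 : 0 < ε) (hε : ε ≤ 1)
    {u v : (Fin d → ℤ) → ℝ} {Cu Cv Du Dv : ℝ}
    (hu : ∀ x, |u x| ≤ Cu * jap x ^ (2 - (d : ℝ)))
    (hLu : ∀ x, |latLap u x| ≤ Du * jap x ^ (-(d : ℝ) - ε))
    (hv : ∀ x, |v x| ≤ Cv * jap x ^ (2 - (d : ℝ)))
    (hLv : ∀ x, |latLap v x| ≤ Dv * jap x ^ (-(d : ℝ) - ε)) :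
    ∃ C : ℝ, 0 ≤ C ∧ ∀ x, |u x * (∑' y, latLap v y) - v x * ∑' y, latLap u y| ≤
      C * (jap x ^ (1 - (d : ℝ)) * powSum ε (jap x)) := by
  have hweak : ∀ {w : (Fin d → ℤ) → ℝ} {D : ℝ}, (∀ x, |latLap w x| ≤ D * jap x ^ (-(d : ℝ) - ε)) →
      ∀ x, |latLap w x| ≤ D * jap x ^ (-(d : ℝ)) := by
    intro w D h x
    have hD : 0 ≤ D := by
      by_contra hneg
      nlinarith [h 0, abs_nonneg (latLap w 0), Real.rpow_pos_of_pos (jap_pos (0 : Fin d → ℤ))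
        (-(d : ℝ) - ε)]
    exact (h x).trans (mul_le_mul_of_nonneg_left
      (Real.rpow_le_rpow_of_exponent_le (one_le_jap x) (by linarith)) hD)
  obtain ⟨Gu, -, hGu⟩ := exists_abs_grad_le hd hu (hweak hLu)
  obtain ⟨Gv, -, hGv⟩ := exists_abs_grad_le hd hv (hweak hLv)
  obtain ⟨hs₁, C₁, hC₁, h₁⟩ := exists_abs_conv_sub_le hd hε0 hε hLv hu hGu
  obtain ⟨hs₂, C₂, hC₂, h₂⟩ := exists_abs_conv_sub_le hd hε0 hε hLu hv hGv
  -- Both convolutions have Laplacian Δu * Δv and tend to zero, so Liouville's theorem applies to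
  -- their difference.
  have heq : ∀ x, (∑' y, latLap v y * u (x - y)) - (∑' y, latLap u y * v (x - y)) = 0 := by
    refine eq_zero_of_harmonic_of_tendsto_zero hd (fun x => ?_) ?_
    · rw [latLap_sub, latLap_conv hs₁, latLap_conv hs₂, sub_eq_zero,
        ← (Equiv.subLeft x).tsum_eq]
      refine tsum_congr fun y => ?_
      simp [mul_comm]
    · simpa using (tendsto_zero_of_conv_bound hd hε0 hC₁ hu h₁).sub
        (tendsto_zero_of_conv_bound hd hε0 hC₂ hv h₂)
  refine ⟨C₁ + C₂, by positivity, fun x => ?_⟩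
  have k1 := abs_le.1 (h₁ x)
  have k2 := abs_le.1 (h₂ x)
  have k3 := heq x
  rw [add_mul, abs_le]
  constructor <;> linarith [k1.1, k1.2, k2.1, k2.2]

/-! ### Theta sums and the limit of a ∑ (a + |x|²)^(-d/2-1). -/

/-- The theta sum `∑_{n ∈ ℤ} e^{-t n²}`. -/
noncomputable def thetaSum (t : ℝ) : ℝ := ∑' n : ℤ, Real.exp (-t * (n : ℝ) ^ 2)

theorem summable_exp_neg_mul_int_sq {t : ℝ} (ht : 0 < t) :
    Summable fun n : ℤ => Real.exp (-t * (n : ℝ) ^ 2) := by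
  have h := summable_pow_mul_jacobiTheta₂_term_bound 0 (T := t / π) (by positivity) 0
  refine h.congr fun n => ?_
  rw [pow_zero, one_mul]
  congr 1
  field_simp
  ring

theorem thetaSum_antitone {s t : ℝ} (hs : 0 < s) (hst : s ≤ t) : thetaSum t ≤ thetaSum s :=
  Summable.tsum_le_tsum (fun n => Real.exp_le_exp.2 (by nlinarith [sq_nonneg (n : ℝ)]))
    (summable_exp_neg_mul_int_sq (hs.trans_le hst)) (summable_exp_neg_mul_int_sq hs)

theorem one_le_thetaSum {t : ℝ} (ht : 0 < t) : 1 ≤ thetaSum t := by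
  have := (summable_exp_neg_mul_int_sq ht).le_tsum 0 fun n _ => (Real.exp_pos _).le
  simpa [thetaSum] using this

theorem thetaSum_le {t : ℝ} (ht : 1 ≤ t) : thetaSum t ≤ 1 + Real.exp (-(t - 1)) * thetaSum 1 := by
  have h1 : HasSum (fun n : ℤ => if n = 0 then (1 : ℝ) else 0) 1 := by
    simpa using hasSum_ite_eq (0 : ℤ) (1 : ℝ)
  have h2 := ((summable_exp_neg_mul_int_sq one_pos).hasSum.mul_left (Real.exp (-(t - 1))))
  refine hasSum_le (fun n => ?_)
    (summable_exp_neg_mul_int_sq (one_pos.trans_le ht)).hasSum (h1.add h2)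
  by_cases hn : n = 0
  · subst hn; simp; positivity
  · have hn1 : (1 : ℝ) ≤ (n : ℝ) ^ 2 := by
      have : (1 : ℤ) ≤ n ^ 2 := by have := sq_pos_of_ne_zero hn; omega
      exact_mod_cast this
    rw [if_neg hn, zero_add, ← Real.exp_add]
    exact Real.exp_le_exp.2 (by nlinarith)

/-- Jacobi's inversion formula, normalised so that t → 0 corresponds to the trivial limit θ → 1 at
infinity. -/
theorem sqrt_mul_thetaSum {t : ℝ} (ht : 0 < t) : √t * thetaSum t = √π * thetaSum (π ^ 2 / t) := by
  have h := Real.tsum_exp_neg_mul_int_sq (a := t / π) (by positivity)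
  have e1 : ∀ n : ℤ, Real.exp (-π * (t / π) * (n : ℝ) ^ 2) = Real.exp (-t * (n : ℝ) ^ 2) := by
    intro n; congr 1; field_simp
  have e2 : ∀ n : ℤ, Real.exp (-π / (t / π) * (n : ℝ) ^ 2) =
      Real.exp (-(π ^ 2 / t) * (n : ℝ) ^ 2) := by
    intro n; congr 1; field_simp
  simp only [e1, e2] at h
  rw [← Real.sqrt_eq_rpow, Real.sqrt_div ht.le] at h
  have h' : thetaSum t = 1 / (√t / √π) * thetaSum (π ^ 2 / t) := h
  rw [h']
  have : 0 < √t := Real.sqrt_pos.2 ht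
  field_simp

/-- Majorant for dominated convergence: monotonicity for t ≥ 1, inversion followed by monotonicity
for t ≤ 1. -/
theorem sqrt_mul_thetaSum_le {t : ℝ} (ht : 0 < t) : √t * thetaSum t ≤ thetaSum 1 * (√π + √t) := by
  have h1 := one_le_thetaSum one_pos
  have h2 := Real.sqrt_nonneg t
  have h3 := Real.sqrt_nonneg π
  rcases le_total 1 t with h | h
  · nlinarith [mul_le_mul_of_nonneg_left (thetaSum_antitone one_pos h) h2]
  · rw [sqrt_mul_thetaSum ht]
    have : 1 ≤ π ^ 2 / t := by
      rw [one_le_div ht]; nlinarith [Real.pi_gt_three]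
    nlinarith [mul_le_mul_of_nonneg_left (thetaSum_antitone one_pos this) h3]

theorem tendsto_sqrt_mul_thetaSum : Tendsto (fun t => √t * thetaSum t) (𝓝[>] 0) (𝓝 √π) := by
  have h1 : Tendsto thetaSum atTop (𝓝 1) := by
    have hup : Tendsto (fun t : ℝ => 1 + Real.exp (-(t - 1)) * thetaSum 1) atTop
        (𝓝 (1 + 0 * thetaSum 1)) := by
      refine tendsto_const_nhds.add (Tendsto.mul_const _ ?_)
      exact Real.tendsto_exp_neg_atTop_nhds_zero.comp (tendsto_atTop_add_const_right _ (-1) tendsto_id)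
    rw [zero_mul, add_zero] at hup
    refine tendsto_of_tendsto_of_tendsto_of_le_of_le' tendsto_const_nhds hup ?_ ?_
    · filter_upwards [eventually_gt_atTop 0] with t ht using one_le_thetaSum ht
    · filter_upwards [eventually_ge_atTop 1] with t ht using thetaSum_le ht
  have h2 : Tendsto (fun t : ℝ => π ^ 2 / t) (𝓝[>] 0) atTop :=
    tendsto_inv_nhdsGT_zero.const_mul_atTop (by positivity : (0 : ℝ) < π ^ 2)
  have h3 := (h1.comp h2).const_mul √π
  rw [mul_one] at h3
  refine h3.congr' ?_
  filter_upwards [self_mem_nhdsWithin] with t ht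
  exact (sqrt_mul_thetaSum ht).symm

theorem hasSum_exp_neg_mul_latSq {t : ℝ} (ht : 0 < t) (d : ℕ) :
    HasSum (fun x : Fin d → ℤ => Real.exp (-t * latSq x)) (thetaSum t ^ d) := by
  induction d with
  | zero =>
    have e : (fun x : Fin 0 → ℤ => Real.exp (-t * latSq x)) = fun _ => 1 := by
      funext x; simp [latSq]
    rw [e, pow_zero]
    exact hasSum_unique (fun _ : Fin 0 → ℤ => (1 : ℝ))
  | succ d ih =>
    have h1 : HasSum (fun n : ℤ => Real.exp (-t * (n : ℝ) ^ 2)) (thetaSum t) :=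
      (summable_exp_neg_mul_int_sq ht).hasSum
    have h2 := h1.mul ih (h1.summable.mul_of_nonneg ih.summable (fun _ => (Real.exp_pos _).le)
      fun _ => (Real.exp_pos _).le)
    have e : (fun x : Fin (d + 1) → ℤ => Real.exp (-t * latSq x)) ∘ (Fin.consEquiv fun _ => ℤ) =
        fun p : ℤ × (Fin d → ℤ) => Real.exp (-t * (p.1 : ℝ) ^ 2) * Real.exp (-t * latSq p.2) := by
      funext p
      simp only [Function.comp_apply]
      rw [← Real.exp_add]
      simp [latSq, Fin.consEquiv, Fin.sum_univ_succ, mul_add]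
    rw [pow_succ']
    refine (Fin.consEquiv fun _ => ℤ).hasSum_iff.1 ?_
    rw [e]
    exact h2

theorem summable_add_latSq_rpow {d : ℕ} (hd : 1 ≤ d) {a : ℝ} (ha : 1 ≤ a) :
    Summable fun x : Fin d → ℤ => (a + latSq x) ^ (-((d : ℝ) / 2 + 1)) := by
  refine Summable.of_nonneg_of_le (fun x => ?_) (fun x => ?_)
    (summable_jap_rpow (d := d) hd one_pos le_rfl)
  · have := latSq_nonneg x
    exact Real.rpow_nonneg (by linarith) _
  · refine (rpow_neg_le_jap ha (by positivity) x).trans ?_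
    exact Real.rpow_le_rpow_of_exponent_le (one_le_jap x) (by linarith)

/-- Write each power as a Gamma integral and exchange sum and integral: the Gaussian sum over the
lattice factorises into θ^d. Scaling the variable by a leaves e^(-τ) as the only weight. -/
theorem mul_tsum_rpow_eq_integral {d : ℕ} (hd : 1 ≤ d) {a : ℝ} (ha : 1 ≤ a) :
    a * (∑' x : Fin d → ℤ, (a + latSq x) ^ (-((d : ℝ) / 2 + 1))) * Real.Gamma ((d : ℝ) / 2 + 1) =
      ∫ τ in Set.Ioi (0 : ℝ), Real.exp (-τ) * (√(τ / a) * thetaSum (τ / a)) ^ d := by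
  have ha0 : 0 < a := by linarith
  set p : ℝ := (d : ℝ) / 2 + 1 with hp
  have hp0 : 0 < p := by positivity
  have hΓ : 0 < Real.Gamma p := Real.Gamma_pos_of_pos hp0
  have hρ : ∀ x : Fin d → ℤ, 0 < a + latSq x := fun x => by linarith [latSq_nonneg x]
  set F : (Fin d → ℤ) → ℝ → ℝ := fun x τ => τ ^ (p - 1) * Real.exp (-((a + latSq x) / a * τ))
    with hF
  have hint : ∀ x, ∫ τ in Set.Ioi (0 : ℝ), F x τ = a ^ p * Real.Gamma p * (a + latSq x) ^ (-p) := by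
    intro x
    rw [Real.integral_rpow_mul_exp_neg_mul_Ioi hp0 (div_pos (hρ x) ha0), one_div_div,
      Real.div_rpow ha0.le (hρ x).le, Real.rpow_neg (hρ x).le]
    ring
  -- A non-integrable function has integral 0 by convention, so a nonzero value certifies
  -- integrability.
  have hintpos : ∀ x, ∫ τ in Set.Ioi (0 : ℝ), F x τ ≠ 0 := fun x => by
    rw [hint]
    have := Real.rpow_pos_of_pos (hρ x) (-p)
    positivity
  have hnorm : ∀ x, ∫ τ in Set.Ioi (0 : ℝ), ‖F x τ‖ = ∫ τ in Set.Ioi (0 : ℝ), F x τ := by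
    intro x
    refine MeasureTheory.setIntegral_congr_fun measurableSet_Ioi fun τ hτ => ?_
    exact abs_of_nonneg (mul_nonneg (Real.rpow_nonneg (le_of_lt hτ) _) (Real.exp_pos _).le)
  have hsummable := (summable_add_latSq_rpow hd ha).mul_left (a ^ p * Real.Gamma p)
  have hsum := MeasureTheory.hasSum_integral_of_summable_integral_norm (F := F)
    (μ := MeasureTheory.volume.restrict (Set.Ioi 0))
    (fun x => MeasureTheory.Integrable.of_integral_ne_zero (hintpos x))
    (by simp only [hnorm, hint]; exact hsummable)
  simp only [hint] at hsum
  have h1 := hsum.tsum_eq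
  rw [tsum_mul_left] at h1
  have h2 : ∫ τ in Set.Ioi (0 : ℝ), ∑' x, F x τ =
      ∫ τ in Set.Ioi (0 : ℝ), a ^ (p - 1) * (Real.exp (-τ) * (√(τ / a) * thetaSum (τ / a)) ^ d) := by
    refine MeasureTheory.setIntegral_congr_fun measurableSet_Ioi fun τ hτ => ?_
    have hτ0 : 0 < τ := hτ
    have hθ := (hasSum_exp_neg_mul_latSq (div_pos hτ0 ha0) d).mul_left (τ ^ (p - 1) * Real.exp (-τ))
    have e : ∀ x : Fin d → ℤ, τ ^ (p - 1) * Real.exp (-τ) * Real.exp (-(τ / a) * latSq x) = F x τ := by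
      intro x
      rw [mul_assoc, ← Real.exp_add]
      simp only [hF]
      congr 2
      field_simp
      ring
    simp only [e] at hθ
    rw [hθ.tsum_eq, mul_pow]
    have e2 : √(τ / a) ^ d = τ ^ (p - 1) / a ^ (p - 1) := by
      rw [← Real.div_rpow hτ0.le ha0.le, Real.sqrt_eq_rpow, ← Real.rpow_natCast,
        ← Real.rpow_mul (by positivity)]
      congr 1
      rw [hp]; ring
    rw [e2]
    have : 0 < a ^ (p - 1) := by positivity
    field_simp
  rw [h2, MeasureTheory.integral_const_mul] at h1
  have e3 : a ^ p = a ^ (p - 1) * a := by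
    rw [← Real.rpow_add_one ha0.ne']; congr 1; ring
  have h4 : 0 < a ^ (p - 1) := by positivity
  rw [e3] at h1
  refine mul_left_cancel₀ h4.ne' ?_
  rw [← h1]; ring

theorem integrableOn_exp_neg_mul_sqrt_pow (c : ℝ) (hc : 0 ≤ c) (d : ℕ) :
    MeasureTheory.IntegrableOn (fun τ => Real.exp (-τ) * (c * (√π + √τ)) ^ d) (Set.Ioi 0) := by
  have h1 := Real.GammaIntegral_convergent (s := 1) one_pos
  have h2 := Real.GammaIntegral_convergent (s := (d : ℝ) + 1) (by positivity)
  have h3 := (h1.add h2).const_mul ((c * 4) ^ d)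
  refine MeasureTheory.Integrable.mono' h3 ?_ ?_
  · exact Continuous.aestronglyMeasurable (by fun_prop)
  · filter_upwards [MeasureTheory.ae_restrict_mem measurableSet_Ioi] with τ hτ
    have hτ0 : 0 < τ := hτ
    rw [Real.norm_of_nonneg (by positivity)]
    simp only [Pi.add_apply, sub_self, Real.rpow_zero, mul_one, add_sub_cancel_right,
      Real.rpow_natCast]
    have hπ : √π ≤ 2 := by
      rw [Real.sqrt_le_left (by norm_num)]; linarith [Real.pi_lt_four]
    have hs : √τ ≤ 1 + τ := by
      rw [Real.sqrt_le_left (by linarith)]; nlinarith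
    have hle : (√π + √τ) ^ d ≤ 4 ^ d * (1 + τ ^ d) := by
      have h0 : √π + √τ ≤ 4 * max 1 τ := by
        rcases le_total 1 τ with h | h
        · rw [max_eq_right h]; linarith
        · rw [max_eq_left h]
          have : √τ ≤ 1 := Real.sqrt_le_one.2 h
          linarith
      calc (√π + √τ) ^ d ≤ (4 * max 1 τ) ^ d := pow_le_pow_left₀ (by positivity) h0 d
        _ = 4 ^ d * max 1 τ ^ d := mul_pow _ _ _
        _ ≤ 4 ^ d * (1 + τ ^ d) := by
            refine mul_le_mul_of_nonneg_left ?_ (by positivity)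
            rcases le_total 1 τ with h | h
            · rw [max_eq_right h]; linarith
            · rw [max_eq_left h, one_pow]; linarith [pow_pos hτ0 d]
    calc Real.exp (-τ) * (c * (√π + √τ)) ^ d = Real.exp (-τ) * (c ^ d * (√π + √τ) ^ d) := by
          rw [mul_pow]
      _ ≤ Real.exp (-τ) * (c ^ d * (4 ^ d * (1 + τ ^ d))) := by gcongr
      _ = _ := by rw [mul_pow]; ring

/-- As a → ∞ the argument τ/a tends to 0, where √t θ(t) → √π, so the integrand converges to e^(-τ)
π^(d/2). -/
theorem tendsto_mul_tsum_rpow {d : ℕ} (hd : 1 ≤ d) :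
    Tendsto (fun a : ℝ => a * ∑' x : Fin d → ℤ, (a + latSq x) ^ (-((d : ℝ) / 2 + 1))) atTop
      (𝓝 (π ^ ((d : ℝ) / 2) / Real.Gamma ((d : ℝ) / 2 + 1))) := by
  have hΓ : 0 < Real.Gamma ((d : ℝ) / 2 + 1) := Real.Gamma_pos_of_pos (by positivity)
  have hθ0 : ∀ t, 0 ≤ thetaSum t := fun t => tsum_nonneg fun _ => (Real.exp_pos _).le
  have hlim : Tendsto (fun a : ℝ => ∫ τ in Set.Ioi (0 : ℝ),
      Real.exp (-τ) * (√(τ / a) * thetaSum (τ / a)) ^ d) atTop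
      (𝓝 (∫ τ in Set.Ioi (0 : ℝ), Real.exp (-τ) * √π ^ d)) := by
    refine MeasureTheory.tendsto_integral_filter_of_dominated_convergence
      (fun τ => Real.exp (-τ) * (thetaSum 1 * (√π + √τ)) ^ d) ?_ ?_
      (integrableOn_exp_neg_mul_sqrt_pow _ (hθ0 1) d) ?_
    · filter_upwards [eventually_gt_atTop 0] with a ha
      have h1 : AEMeasurable (fun τ => thetaSum (τ / a))
          (MeasureTheory.volume.restrict (Set.Ioi (0 : ℝ))) := by
        refine aemeasurable_restrict_of_antitoneOn measurableSet_Ioi fun s hs t _ hst => ?_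
        exact thetaSum_antitone (div_pos hs ha) (div_le_div_of_nonneg_right hst ha.le)
      have h2 : AEMeasurable (fun τ => √(τ / a))
          (MeasureTheory.volume.restrict (Set.Ioi (0 : ℝ))) :=
        (by fun_prop : Continuous fun τ => √(τ / a)).measurable.aemeasurable
      have h3 : AEMeasurable (fun τ => Real.exp (-τ))
          (MeasureTheory.volume.restrict (Set.Ioi (0 : ℝ))) :=
        (by fun_prop : Continuous fun τ => Real.exp (-τ)).measurable.aemeasurable
      exact (h3.mul ((h2.mul h1).pow_const d)).aestronglyMeasurable
    · filter_upwards [eventually_ge_atTop 1] with a ha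
      filter_upwards [MeasureTheory.ae_restrict_mem measurableSet_Ioi] with τ hτ
      have hτ0 : 0 < τ := hτ
      have h0 := hθ0 (τ / a)
      rw [Real.norm_of_nonneg (by positivity)]
      refine mul_le_mul_of_nonneg_left (pow_le_pow_left₀ (by positivity) ?_ d) (Real.exp_pos _).le
      refine (sqrt_mul_thetaSum_le (by positivity)).trans
        (mul_le_mul_of_nonneg_left ?_ (hθ0 1))
      gcongr
      exact div_le_self hτ0.le ha
    · filter_upwards [MeasureTheory.ae_restrict_mem measurableSet_Ioi] with τ hτ
      have hτ0 : 0 < τ := hτ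
      have h1 : Tendsto (fun a : ℝ => τ / a) atTop (𝓝[>] 0) := by
        refine tendsto_nhdsWithin_iff.2 ⟨tendsto_const_nhds.div_atTop tendsto_id, ?_⟩
        filter_upwards [eventually_gt_atTop 0] with a ha using div_pos hτ0 ha
      exact ((tendsto_sqrt_mul_thetaSum.comp h1).pow d).const_mul _
  rw [MeasureTheory.integral_mul_const, integral_exp_neg_Ioi_zero, one_mul] at hlim
  have e : √π ^ d = π ^ ((d : ℝ) / 2) := by
    rw [Real.sqrt_eq_rpow, ← Real.rpow_natCast, ← Real.rpow_mul Real.pi_pos.le]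
    congr 1; ring
  rw [e] at hlim
  refine (hlim.div_const (Real.Gamma ((d : ℝ) / 2 + 1))).congr' ?_
  filter_upwards [eventually_ge_atTop 1] with a ha
  rw [← mul_tsum_rpow_eq_integral hd ha, mul_div_assoc, div_self hΓ.ne', mul_one]

/-! ### The total charge of the regularised potential. -/

/-- The regularised Newtonian potential `(a + |x|²)^{-(d-2)/2}`. -/
noncomputable def regPotential (d : ℕ) (a : ℝ) (x : Fin d → ℤ) : ℝ :=
  (a + latSq x) ^ (-(((d : ℝ) - 2) / 2))

theorem abs_regPotential_le {d : ℕ} (hd : 3 ≤ d) {a : ℝ} (ha : 1 ≤ a) (x : Fin d → ℤ) :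
    |regPotential d a x| ≤ 1 * jap x ^ (2 - (d : ℝ)) := by
  have hd' : (3 : ℝ) ≤ d := by exact_mod_cast hd
  have hρ : 0 < a + latSq x := by linarith [latSq_nonneg x]
  rw [regPotential, abs_of_pos (Real.rpow_pos_of_pos hρ _), one_mul]
  have h := rpow_neg_le_jap ha (by linarith : 0 ≤ ((d : ℝ) - 2) / 2) x
  have e : -(2 * (((d : ℝ) - 2) / 2)) = 2 - (d : ℝ) := by ring
  rwa [e] at h

/-- The leading term drops out at s = (d-2)/2 and 4s(s+1) = d(d-2). What remains is an explicit
density, with an error smaller by a factor of order 1/a. -/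
theorem exists_latLap_regPotential {d : ℕ} (hd : 3 ≤ d) : ∃ C A : ℝ, 0 < C ∧ 1 < A ∧
    ∀ a : ℝ, A ≤ a → ∀ x : Fin d → ℤ, |latLap (regPotential d a) x +
      (d * (d - 2)) * (a * (a + latSq x) ^ (-((d : ℝ) / 2 + 1)))| ≤
        C * (a + latSq x) ^ (-((d : ℝ) / 2 + 1)) := by
  have hd' : (3 : ℝ) ≤ d := by exact_mod_cast hd
  obtain ⟨C, A, hC, hA, h⟩ := exists_latLap_rpow d (s := ((d : ℝ) - 2) / 2) (by linarith)
  refine ⟨C, A, hC, hA, fun a ha x => ?_⟩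
  have h1 := h a ha x
  have e : -(((d : ℝ) - 2) / 2) - 2 = -((d : ℝ) / 2 + 1) := by ring
  rw [e] at h1
  convert h1 using 2
  change latLap (regPotential d a) x + _ = latLap (regPotential d a) x - _
  ring

theorem abs_latLap_regPotential_le {d : ℕ} {C a : ℝ} (hC : 0 < C) (ha : 1 < a) (hd : 3 ≤ d)
    (h : ∀ x : Fin d → ℤ, |latLap (regPotential d a) x +
      (d * (d - 2)) * (a * (a + latSq x) ^ (-((d : ℝ) / 2 + 1)))| ≤
        C * (a + latSq x) ^ (-((d : ℝ) / 2 + 1))) {ε : ℝ} (hε : ε ≤ 1) (x : Fin d → ℤ) :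
    |latLap (regPotential d a) x| ≤ (C + d * (d - 2) * a) * jap x ^ (-(d : ℝ) - ε) := by
  have hd' : (3 : ℝ) ≤ d := by exact_mod_cast hd
  have hd2 : 0 ≤ (d : ℝ) * (d - 2) := mul_nonneg (by linarith) (by linarith)
  have hρ : 0 < a + latSq x := by linarith [latSq_nonneg x]
  have h0 := Real.rpow_pos_of_pos hρ (-((d : ℝ) / 2 + 1))
  have h1 := abs_le.1 (h x)
  have h2 : |latLap (regPotential d a) x| ≤
      (C + d * (d - 2) * a) * (a + latSq x) ^ (-((d : ℝ) / 2 + 1)) := by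
    have h3 : 0 ≤ d * (d - 2) * (a * (a + latSq x) ^ (-((d : ℝ) / 2 + 1))) := by positivity
    rw [abs_le]
    constructor <;> nlinarith [h1.1, h1.2]
  refine h2.trans (mul_le_mul_of_nonneg_left ?_ (by positivity))
  refine (rpow_neg_le_jap ha.le (by positivity) x).trans ?_
  exact Real.rpow_le_rpow_of_exponent_le (one_le_jap x) (by linarith)

theorem tendsto_regPotential_mul_jap {d : ℕ} (a : ℝ) :
    Tendsto (fun x : Fin d → ℤ => regPotential d a x * jap x ^ ((d : ℝ) - 2)) cofinite (𝓝 1) := by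
  have h1 : Tendsto (fun x : Fin d → ℤ => a + latSq x) cofinite atTop :=
    tendsto_atTop_add_const_left _ _ tendsto_latSq
  have h2 : Tendsto (fun x : Fin d → ℤ => 1 + (1 - a) / (a + latSq x)) cofinite (𝓝 (1 + 0)) :=
    tendsto_const_nhds.add (tendsto_const_nhds.div_atTop h1)
  rw [add_zero] at h2
  have h3 := h2.rpow_const (p := ((d : ℝ) - 2) / 2) (Or.inl one_ne_zero)
  rw [Real.one_rpow] at h3
  refine h3.congr' ?_
  filter_upwards [h1.eventually_gt_atTop 0] with x hx
  have e : 1 + (1 - a) / (a + latSq x) = (1 + latSq x) / (a + latSq x) := by field_simp; ring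
  have hq := latSq_nonneg x
  have e2 : jap x ^ ((d : ℝ) - 2) = (1 + latSq x) ^ (((d : ℝ) - 2) / 2) := by
    rw [← jap_rpow_eq]; congr 1; ring
  rw [e, e2, regPotential, Real.div_rpow (by linarith) hx.le, Real.rpow_neg hx.le]
  field_simp

/-- Both potentials are asymptotic to ⟨x⟩^(2-d) with coefficient 1, so reciprocity between them
forces equal charges. The choice ε = 1/2 is arbitrary in (0, 1). -/
theorem tsum_latLap_regPotential_eq {d : ℕ} (hd : 3 ≤ d) {C A : ℝ} (hC : 0 < C) (hA : 1 < A)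
    (h : ∀ a : ℝ, A ≤ a → ∀ x : Fin d → ℤ, |latLap (regPotential d a) x +
      (d * (d - 2)) * (a * (a + latSq x) ^ (-((d : ℝ) / 2 + 1)))| ≤
        C * (a + latSq x) ^ (-((d : ℝ) / 2 + 1))) {a b : ℝ} (ha : A ≤ a) (hb : A ≤ b) :
    ∑' x, latLap (regPotential d a) x = ∑' x, latLap (regPotential d b) x := by
  have hd' : (3 : ℝ) ≤ d := by exact_mod_cast hd
  have ha1 := hA.trans_le ha
  have hb1 := hA.trans_le hb
  obtain ⟨K, hK, hbound⟩ := exists_abs_mul_tsum_sub_le hd (ε := 1 / 2) (by norm_num) (by norm_num)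
    (abs_regPotential_le hd ha1.le) (abs_latLap_regPotential_le hC ha1 hd (h a ha) (by norm_num))
    (abs_regPotential_le hd hb1.le) (abs_latLap_regPotential_le hC hb1 hd (h b hb) (by norm_num))
  obtain ⟨T, hT, hpow⟩ := exists_powSum_le_rpow (ε := 1 / 2) (by norm_num) (by norm_num)
  set Sa := ∑' x, latLap (regPotential d a) x
  set Sb := ∑' x, latLap (regPotential d b) x
  have hlim : Tendsto (fun x : Fin d → ℤ => (regPotential d a x * jap x ^ ((d : ℝ) - 2)) * Sb -
      (regPotential d b x * jap x ^ ((d : ℝ) - 2)) * Sa) cofinite (𝓝 (1 * Sb - 1 * Sa)) :=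
    ((tendsto_regPotential_mul_jap a).mul_const Sb).sub
      ((tendsto_regPotential_mul_jap b).mul_const Sa)
  have hzero : Tendsto (fun x : Fin d → ℤ => (regPotential d a x * jap x ^ ((d : ℝ) - 2)) * Sb -
      (regPotential d b x * jap x ^ ((d : ℝ) - 2)) * Sa) cofinite (𝓝 0) := by
    have h0 := ((tendsto_rpow_neg_atTop (by norm_num : (0 : ℝ) < 1 / 2)).comp
      (tendsto_jap (d := d))).const_mul (K * T)
    rw [mul_zero] at h0
    refine squeeze_zero_norm (fun x => ?_) h0
    have hJ := jap_pos x
    have e : (regPotential d a x * jap x ^ ((d : ℝ) - 2)) * Sb -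
      (regPotential d b x * jap x ^ ((d : ℝ) - 2)) * Sa =
      (regPotential d a x * Sb - regPotential d b x * Sa) * jap x ^ ((d : ℝ) - 2) := by ring
    rw [e, Real.norm_eq_abs, abs_mul, abs_of_pos (Real.rpow_pos_of_pos hJ _)]
    have h1 := mul_le_mul_of_nonneg_right (hbound x) (Real.rpow_pos_of_pos hJ ((d : ℝ) - 2)).le
    refine h1.trans ?_
    have h2 := mul_le_mul_of_nonneg_left (hpow _ (one_le_jap x))
      (Real.rpow_pos_of_pos hJ (1 - (d : ℝ))).le
    have h3 := mul_le_mul_of_nonneg_right (mul_le_mul_of_nonneg_left h2 hK)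
      (Real.rpow_pos_of_pos hJ ((d : ℝ) - 2)).le
    refine h3.trans (le_of_eq ?_)
    simp only [Function.comp_apply]
    have e1 : jap x ^ (-(1 / 2 : ℝ)) =
        jap x ^ (1 - (d : ℝ)) * jap x ^ (1 - 1 / 2 : ℝ) * jap x ^ ((d : ℝ) - 2) := by
      rw [← Real.rpow_add hJ, ← Real.rpow_add hJ]; congr 1; ring
    rw [e1]; ring
  have : (cofinite : Filter (Fin d → ℤ)).NeBot := by
    have : Nonempty (Fin d) := ⟨⟨0, by omega⟩⟩
    infer_instance
  have := tendsto_nhds_unique hlim hzero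
  linarith

/-- Identifies 1/c_d with d(d-2) times the volume of the unit ball, by applying Γ(s+1) = sΓ(s)
twice. -/
theorem mul_greenConst {d : ℕ} (hd : 3 ≤ d) :
    d * (d - 2) * (π ^ ((d : ℝ) / 2) / Real.Gamma ((d : ℝ) / 2 + 1)) * greenConst d = 1 := by
  have hd' : (3 : ℝ) ≤ d := by exact_mod_cast hd
  have h1 : Real.Gamma ((d : ℝ) / 2 + 1) =
      (d : ℝ) / 2 * (((d : ℝ) / 2 - 1) * Real.Gamma ((d : ℝ) / 2 - 1)) := by
    rw [Real.Gamma_add_one (by positivity)]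
    congr 1
    have := Real.Gamma_add_one (s := (d : ℝ) / 2 - 1) (by linarith)
    rwa [sub_add_cancel] at this
  have h2 : 0 < Real.Gamma ((d : ℝ) / 2 - 1) := Real.Gamma_pos_of_pos (by linarith)
  have h3 : 0 < π ^ ((d : ℝ) / 2) := Real.rpow_pos_of_pos Real.pi_pos _
  have h4 : (d : ℝ) - 2 ≠ 0 := by linarith
  have h5 : (d : ℝ) / 2 - 1 ≠ 0 := by linarith
  have h6 : (d : ℝ) ≠ 0 := by linarith
  rw [h1, greenConst]
  generalize Real.Gamma ((d : ℝ) / 2 - 1) = G at h2 ⊢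
  generalize π ^ ((d : ℝ) / 2) = P at h3 ⊢
  have h7 : (d : ℝ) * (d - 2) = 4 * ((d : ℝ) / 2 * ((d : ℝ) / 2 - 1)) := by ring
  have h8 : (d : ℝ) / 2 * ((d : ℝ) / 2 - 1) ≠ 0 := mul_ne_zero (by positivity) h5
  rw [h7, ← mul_assoc ((d : ℝ) / 2)]
  generalize (d : ℝ) / 2 * ((d : ℝ) / 2 - 1) = k at h8 ⊢
  field_simp

/-- The total charge of the regularised potential. -/
theorem exists_tsum_latLap_regPotential {d : ℕ} (hd : 3 ≤ d) : ∃ a D : ℝ, 1 < a ∧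
    (∀ ε : ℝ, ε ≤ 1 → ∀ x, |latLap (regPotential d a) x| ≤ D * jap x ^ (-(d : ℝ) - ε)) ∧
    greenConst d * ∑' x, latLap (regPotential d a) x = -1 := by
  have hd' : (3 : ℝ) ≤ d := by exact_mod_cast hd
  obtain ⟨C, A, hC, hA, h⟩ := exists_latLap_regPotential hd
  refine ⟨A, C + d * (d - 2) * A, hA, fun ε hε =>
    abs_latLap_regPotential_le hC hA hd (h A le_rfl) hε, ?_⟩
  set L := π ^ ((d : ℝ) / 2) / Real.Gamma ((d : ℝ) / 2 + 1) with hL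
  let T : ℝ → ℝ := fun a => ∑' x : Fin d → ℤ, (a + latSq x) ^ (-((d : ℝ) / 2 + 1))
  have hT : Tendsto (fun a => a * T a) atTop (𝓝 L) := tendsto_mul_tsum_rpow (by omega)
  have hT0 : Tendsto T atTop (𝓝 0) := by
    have := hT.mul tendsto_inv_atTop_zero
    rw [mul_zero] at this
    refine this.congr' ?_
    filter_upwards [eventually_gt_atTop 0] with a ha
    field_simp
  have hdiff : ∀ a, A ≤ a →
      |(∑' x, latLap (regPotential d a) x) + d * (d - 2) * (a * T a)| ≤ C * T a := by
    intro a ha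
    have ha1 := hA.trans_le ha
    have hs := summable_add_latSq_rpow (d := d) (by omega) ha1.le
    have hs1 : Summable (latLap (regPotential d a)) := summable_of_abs_le_jap (by omega) one_pos
      le_rfl (abs_latLap_regPotential_le hC ha1 hd (h a ha) le_rfl)
    have e : (∑' x, latLap (regPotential d a) x) + d * (d - 2) * (a * T a) =
        ∑' x : Fin d → ℤ, (latLap (regPotential d a) x +
          (d * (d - 2)) * (a * (a + latSq x) ^ (-((d : ℝ) / 2 + 1)))) := by
      rw [hs1.tsum_add ((hs.mul_left a).mul_left _), tsum_mul_left, tsum_mul_left]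
    rw [e, ← tsum_mul_left]
    have hb := abs_tsum_le_of_sum_abs_le
      (h := fun x : Fin d → ℤ => latLap (regPotential d a) x +
          (d * (d - 2)) * (a * (a + latSq x) ^ (-((d : ℝ) / 2 + 1))))
      (B := ∑' x : Fin d → ℤ, C * (a + latSq x) ^ (-((d : ℝ) / 2 + 1))) fun F =>
        (Finset.sum_le_sum fun x _ => h a ha x).trans
          ((hs.mul_left C).sum_le_tsum F fun x _ => by
            have : 0 < a + latSq x := by linarith [latSq_nonneg x]
            positivity)
    exact hb.2
  have hlim : Tendsto (fun a => (∑' x, latLap (regPotential d a) x) + d * (d - 2) * (a * T a))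
      atTop (𝓝 0) := by
    have h0 := hT0.const_mul C
    rw [mul_zero] at h0
    refine squeeze_zero_norm' ?_ h0
    filter_upwards [eventually_ge_atTop A] with a ha using hdiff a ha
  -- The charge does not depend on a, so it may be frozen at A while a → ∞ in the explicit density;
  -- the error C T(a) vanishes in this limit.
  have hlim2 : Tendsto (fun a => (∑' x, latLap (regPotential d A) x) + d * (d - 2) * (a * T a))
      atTop (𝓝 0) := by
    refine hlim.congr' ?_
    filter_upwards [eventually_ge_atTop A] with a ha
    rw [tsum_latLap_regPotential_eq hd hC hA h ha le_rfl]
  have hlim3 := tendsto_const_nhds (x := ∑' x, latLap (regPotential d A) x)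
    (f := (atTop : Filter ℝ)) |>.add (hT.const_mul ((d : ℝ) * (d - 2)))
  have heq := tendsto_nhds_unique hlim3 hlim2
  have := mul_greenConst hd
  rw [← hL] at this
  have h5 : ∑' x, latLap (regPotential d A) x = -(d * (d - 2) * L) := by linarith
  rw [h5]; linarith

/-! ### Newtonian asymptotics. -/

/-- Asymptotics of a decaying function from the total mass of its lattice Laplacian. -/
theorem exists_abs_add_greenConst_le {d : ℕ} (hd : 3 ≤ d) {ε : ℝ} (hε0 : 0 < ε) (hε : ε ≤ 1)
    {u : (Fin d → ℤ) → ℝ} {Cu Du : ℝ}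
    (hu : ∀ x, |u x| ≤ Cu * jap x ^ (2 - (d : ℝ)))
    (hLu : ∀ x, |latLap u x| ≤ Du * jap x ^ (-(d : ℝ) - ε)) :
    ∃ a C : ℝ, 1 < a ∧ 0 ≤ C ∧ ∀ x, |u x + greenConst d * regPotential d a x * ∑' y, latLap u y| ≤
      C * (jap x ^ (1 - (d : ℝ)) * powSum ε (jap x)) := by
  obtain ⟨a, D, ha, hD, hS⟩ := exists_tsum_latLap_regPotential hd
  obtain ⟨C, hC, h⟩ := exists_abs_mul_tsum_sub_le hd hε0 hε hu hLu
    (abs_regPotential_le hd ha.le) (hD ε hε)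
  refine ⟨a, |greenConst d| * C, ha, by positivity, fun x => ?_⟩
  have e : u x + greenConst d * regPotential d a x * ∑' y, latLap u y =
      -(greenConst d * (u x * (∑' y, latLap (regPotential d a) y) -
        regPotential d a x * ∑' y, latLap u y)) := by
    linear_combination u x * hS
  rw [e, abs_neg, abs_mul, mul_assoc]
  exact mul_le_mul_of_nonneg_left (h x) (abs_nonneg _)

theorem exists_abs_regPotential_sub_le {d : ℕ} {a : ℝ} (ha : 0 < a) : ∃ C : ℝ, 0 ≤ C ∧
    ∀ᶠ x : Fin d → ℤ in cofinite, |regPotential d a x - latNorm x ^ (-(d : ℝ) + 2)| ≤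
      C * latNorm x ^ (1 - (d : ℝ)) := by
  obtain ⟨C, δ, hC, hδ, -, h⟩ := exists_one_add_rpow_lipschitz (((d : ℝ) - 2) / 2)
  refine ⟨C * a, by positivity, ?_⟩
  have h1 : Tendsto (fun x : Fin d → ℤ => a / latSq x) cofinite (𝓝 0) :=
    tendsto_const_nhds.div_atTop tendsto_latSq
  filter_upwards [h1.eventually (gt_mem_nhds hδ), tendsto_latNorm.eventually_ge_atTop 1]
    with x hx hN
  have hN0 : 0 < latNorm x := by linarith
  have hq : 0 < latSq x := by rw [← latNorm_sq]; positivity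
  have e1 : latNorm x ^ (-(d : ℝ) + 2) = latSq x ^ (-(((d : ℝ) - 2) / 2)) := by
    rw [← latNorm_sq, ← Real.rpow_natCast, ← Real.rpow_mul hN0.le]
    congr 1; push_cast; ring
  have e2 : regPotential d a x = latSq x ^ (-(((d : ℝ) - 2) / 2)) *
      (1 + a / latSq x) ^ (-(((d : ℝ) - 2) / 2)) := by
    rw [regPotential, ← Real.mul_rpow hq.le (by positivity)]
    congr 1; field_simp; ring
  have ht : 0 ≤ a / latSq x := by positivity
  have h2 := h (a / latSq x) (by rw [abs_of_nonneg ht]; exact hx.le)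
  rw [abs_of_nonneg ht] at h2
  have e3 : latNorm x ^ (1 - (d : ℝ)) = latSq x ^ (-(((d : ℝ) - 2) / 2)) * (latNorm x)⁻¹ := by
    rw [← e1, ← Real.rpow_neg_one (latNorm x), ← Real.rpow_add hN0]
    congr 1; ring
  rw [e1, e2, e3, ← mul_sub_one, abs_mul, abs_of_pos (Real.rpow_pos_of_pos hq _)]
  have h3 : a / latSq x ≤ a * (latNorm x)⁻¹ := by
    rw [← latNorm_sq, div_eq_mul_inv]
    gcongr
    nlinarith
  have h4 := Real.rpow_pos_of_pos hq (-(((d : ℝ) - 2) / 2))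
  calc _ ≤ latSq x ^ (-(((d : ℝ) - 2) / 2)) * (C * (a * (latNorm x)⁻¹)) := by
        gcongr
        exact h2.trans (mul_le_mul_of_nonneg_left h3 hC)
    _ = _ := by ring

theorem one_le_powSum {ε R : ℝ} (hε0 : 0 ≤ ε) (hε : ε ≤ 1) (hR : 1 ≤ R) : 1 ≤ powSum ε R :=
  (Real.one_le_rpow hR (by linarith)).trans (rpow_le_powSum hε0 hε hR)

theorem exists_abs_add_newton_le {d : ℕ} (hd : 3 ≤ d) {ε : ℝ} (hε0 : 0 < ε) (hε : ε ≤ 1)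
    {u : (Fin d → ℤ) → ℝ} {Cu Du : ℝ}
    (hu : ∀ x, |u x| ≤ Cu * jap x ^ (2 - (d : ℝ)))
    (hLu : ∀ x, |latLap u x| ≤ Du * jap x ^ (-(d : ℝ) - ε)) :
    ∃ C : ℝ, 0 ≤ C ∧ ∀ᶠ x in cofinite,
      |u x + greenConst d * latNorm x ^ (-(d : ℝ) + 2) * ∑' y, latLap u y| ≤
        C * (latNorm x ^ (1 - (d : ℝ)) * powSum ε (jap x)) := by
  have hd' : (3 : ℝ) ≤ d := by exact_mod_cast hd
  obtain ⟨a, C, ha, hC, h⟩ := exists_abs_add_greenConst_le hd hε0 hε hu hLu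
  obtain ⟨K, hK, h2⟩ := exists_abs_regPotential_sub_le (d := d) (by linarith : 0 < a)
  set S := ∑' y, latLap u y
  refine ⟨C + |greenConst d * S| * K, by positivity, ?_⟩
  filter_upwards [h2, tendsto_latNorm.eventually_ge_atTop 1] with x hx hN
  have hN0 : 0 < latNorm x := by linarith
  have hp := one_le_powSum hε0.le hε (one_le_jap x)
  have hNp := Real.rpow_pos_of_pos hN0 (1 - (d : ℝ))
  have hJ : jap x ^ (1 - (d : ℝ)) ≤ latNorm x ^ (1 - (d : ℝ)) :=
    Real.rpow_le_rpow_of_nonpos hN0 (latNorm_lt_jap x).le (by linarith)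
  have e : u x + greenConst d * latNorm x ^ (-(d : ℝ) + 2) * S =
      (u x + greenConst d * regPotential d a x * S) -
        greenConst d * S * (regPotential d a x - latNorm x ^ (-(d : ℝ) + 2)) := by ring
  rw [e]
  refine (abs_sub _ _).trans ?_
  rw [abs_mul (greenConst d * S), add_mul]
  refine add_le_add ((h x).trans ?_) ?_
  · gcongr
  · rw [mul_assoc]
    refine mul_le_mul_of_nonneg_left (hx.trans ?_) (abs_nonneg _)
    exact mul_le_mul_of_nonneg_left (le_mul_of_one_le_right hNp.le hp) hK

/-- The Newtonian asymptotics for complex valued functions. -/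
theorem exists_norm_add_newton_le {d : ℕ} (hd : 3 ≤ d) {ε : ℝ} (hε0 : 0 < ε) (hε : ε ≤ 1)
    {u f : (Fin d → ℤ) → ℂ} {Cu Du : ℝ}
    (hu : ∀ x, ‖u x‖ ≤ Cu * jap x ^ (2 - (d : ℝ)))
    (hf : ∀ x, ‖f x‖ ≤ Du * jap x ^ (-(d : ℝ) - ε)) (hsum : Summable f)
    (heq : ∀ x, discreteH0 u x + f x = 0) :
    ∃ C : ℝ, 0 ≤ C ∧ ∀ᶠ x in cofinite,
      ‖u x + (greenConst d * latNorm x ^ (-(d : ℝ) + 2) : ℝ) * ∑' y, f y‖ ≤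
        C * (latNorm x ^ (1 - (d : ℝ)) * powSum ε (jap x)) := by
  have hre : ∀ x, latLap (fun y => (u y).re) x = (f x).re := fun x => by
    have := congrArg Complex.re (heq x)
    simp only [discreteH0, Complex.add_re, Complex.neg_re, Complex.re_sum, Complex.sub_re,
      Complex.zero_re] at this
    simp only [latLap]; linarith
  have him : ∀ x, latLap (fun y => (u y).im) x = (f x).im := fun x => by
    have := congrArg Complex.im (heq x)
    simp only [discreteH0, Complex.add_im, Complex.neg_im, Complex.im_sum, Complex.sub_im,
      Complex.zero_im] at this
    simp only [latLap]; linarith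
  obtain ⟨C₁, hC₁, h₁⟩ := exists_abs_add_newton_le hd hε0 hε
    (u := fun y => (u y).re) (fun x => (Complex.abs_re_le_norm _).trans (hu x))
    (fun x => by rw [hre]; exact (Complex.abs_re_le_norm _).trans (hf x))
  obtain ⟨C₂, hC₂, h₂⟩ := exists_abs_add_newton_le hd hε0 hε
    (u := fun y => (u y).im) (fun x => (Complex.abs_im_le_norm _).trans (hu x))
    (fun x => by rw [him]; exact (Complex.abs_im_le_norm _).trans (hf x))
  simp only [hre, ← Complex.re_tsum hsum] at h₁
  simp only [him, ← Complex.im_tsum hsum] at h₂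
  refine ⟨C₁ + C₂, by positivity, ?_⟩
  filter_upwards [h₁, h₂] with x hx₁ hx₂
  refine (Complex.norm_le_abs_re_add_abs_im _).trans ?_
  rw [add_mul, Complex.add_re, Complex.add_im, Complex.re_ofReal_mul, Complex.im_ofReal_mul]
  exact add_le_add hx₁ hx₂

/-! ### Kato's inequality, the error terms, and the theorem. -/

/-- Discrete Kato inequality: the triangle inequality in 2d u(x) = ∑ (neighbouring values) -
V(x)u(x). -/
theorem neg_latLap_norm_le {d : ℕ} {u : (Fin d → ℤ) → ℂ} {V : (Fin d → ℤ) → ℝ}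
    (heq : ∀ x, discreteH0 u x + (V x : ℂ) * u x = 0) (x : Fin d → ℤ) :
    -latLap (fun y => ‖u y‖) x ≤ |V x| * ‖u x‖ := by
  have h1 : (2 * d : ℂ) * u x = (∑ j, (u (x + Pi.single j 1) + u (x - Pi.single j 1))) -
      (V x : ℂ) * u x := by
    have h2 : discreteH0 u x =
        (2 * d : ℂ) * u x - ∑ j, (u (x + Pi.single j 1) + u (x - Pi.single j 1)) := by
      have : ∀ j, (u (x + Pi.single j 1) - u x) + (u (x - Pi.single j 1) - u x) =
        (u (x + Pi.single j 1) + u (x - Pi.single j 1)) - 2 * u x := fun j => by ring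
      simp only [discreteH0, this, Finset.sum_sub_distrib, Finset.sum_const, Finset.card_univ,
        Fintype.card_fin, nsmul_eq_mul]
      ring
    linear_combination heq x - h2
  have h3 : 2 * d * ‖u x‖ ≤ (∑ j, (‖u (x + Pi.single j 1)‖ + ‖u (x - Pi.single j 1)‖)) +
      |V x| * ‖u x‖ := by
    have h4 := congrArg norm h1
    rw [norm_mul, norm_mul, Complex.norm_natCast, Complex.norm_two] at h4
    rw [h4]
    refine (norm_sub_le _ _).trans (add_le_add ?_ ?_)
    · exact (norm_sum_le _ _).trans (Finset.sum_le_sum fun j _ => norm_add_le _ _)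
    · rw [norm_mul, Complex.norm_real, Real.norm_eq_abs]
  have h5 : latLap (fun y => ‖u y‖) x =
      (∑ j, (‖u (x + Pi.single j 1)‖ + ‖u (x - Pi.single j 1)‖)) - 2 * d * ‖u x‖ := by
    have : ∀ j, (‖u (x + Pi.single j 1)‖ - ‖u x‖) + (‖u (x - Pi.single j 1)‖ - ‖u x‖) =
      (‖u (x + Pi.single j 1)‖ + ‖u (x - Pi.single j 1)‖) - 2 * ‖u x‖ := fun j => by ring
    simp only [latLap, this, Finset.sum_sub_distrib, Finset.sum_const, Finset.card_univ,
      Fintype.card_fin, nsmul_eq_mul]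
    ring
  linarith

theorem summable_sq_of_memWeightedL2 {d : ℕ} {u : (Fin d → ℤ) → ℂ}
    (hu : MemWeightedL2 (-3 / 2) u) : Summable fun x => jap x ^ (-3 : ℝ) * ‖u x‖ ^ 2 := by
  have h := (memℓp_gen_iff (by norm_num)).1 hu
  refine h.congr fun x => ?_
  have hJ := jap_pos x
  simp only [ENNReal.toReal_ofNat, Real.rpow_ofNat, norm_mul, Complex.norm_real, Real.norm_eq_abs,
    abs_of_pos (Real.rpow_pos_of_pos hJ _), mul_pow]
  rw [← Real.rpow_natCast (jap x ^ _), ← Real.rpow_mul hJ.le]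
  norm_num

theorem greenConst_pos {d : ℕ} (hd : 3 ≤ d) : 0 < greenConst d := by
  have hd' : (3 : ℝ) ≤ d := by exact_mod_cast hd
  have h1 : 0 < Real.Gamma ((d : ℝ) / 2 - 1) := Real.Gamma_pos_of_pos (by linarith)
  rw [greenConst]
  positivity

/-- Zero solutions in `l^{2,-3/2}` decay like the Green function. -/
theorem exists_norm_le_jap_of_memWeightedL2 {d : ℕ} (hd : 3 ≤ d) {ε : ℝ} (hε0 : 0 < ε) (hε : ε ≤ 1)
    {V : (Fin d → ℤ) → ℝ} {C₀ : ℝ} (hC₀ : 0 ≤ C₀) (hV : ∀ x, |V x| ≤ C₀ * jap x ^ (-2 - ε))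
    {u : (Fin d → ℤ) → ℂ} (hu : MemWeightedL2 (-3 / 2) u)
    (heq : ∀ x, discreteH0 u x + (V x : ℂ) * u x = 0) :
    ∃ C : ℝ, 0 < C ∧ ∀ x, ‖u x‖ ≤ C * jap x ^ (-(d : ℝ) + 2) := by
  have hsub := neg_latLap_norm_le heq
  refine exists_le_jap_of_subsolution hd hε0 hε (w := fun x => ‖u x‖) hV ?_ hsub
  refine tendsto_zero_of_subsolution hd (C₀ := C₀) (fun x => (hV x).trans ?_)
    (fun x => norm_nonneg _) hsub (summable_sq_of_memWeightedL2 hu)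
  exact mul_le_mul_of_nonneg_left
    (Real.rpow_le_rpow_of_exponent_le (one_le_jap x) (by linarith)) hC₀

theorem isBigO_powSum_of_lt {d : ℕ} {ε : ℝ} (hε0 : 0 < ε) (hε : ε < 1) :
    (fun x : Fin d → ℤ => latNorm x ^ (1 - (d : ℝ)) * powSum ε (jap x))
      =O[cofinite] fun x => latNorm x ^ (-(d : ℝ) + 2 - ε) := by
  obtain ⟨T, hT, h⟩ := exists_powSum_le_rpow hε0.le hε
  refine IsBigO.of_bound (T * 2 ^ (1 - ε)) ?_
  filter_upwards [tendsto_latNorm.eventually_ge_atTop 1] with x hN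
  have hN0 : 0 < latNorm x := by linarith
  rw [Real.norm_of_nonneg (mul_nonneg (by positivity) (powSum_nonneg _ _)),
    Real.norm_of_nonneg (by positivity)]
  have h1 : jap x ^ (1 - ε) ≤ (2 * latNorm x) ^ (1 - ε) :=
    Real.rpow_le_rpow (jap_pos x).le (by linarith [jap_le_one_add_latNorm x]) (by linarith)
  have e : latNorm x ^ (-(d : ℝ) + 2 - ε) = latNorm x ^ (1 - (d : ℝ)) * latNorm x ^ (1 - ε) := by
    rw [← Real.rpow_add hN0]; congr 1; ring
  rw [Real.mul_rpow two_pos.le hN0.le] at h1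
  rw [e]
  calc _ ≤ latNorm x ^ (1 - (d : ℝ)) * (T * (2 ^ (1 - ε) * latNorm x ^ (1 - ε))) := by
        gcongr
        exact (h _ (one_le_jap x)).trans (mul_le_mul_of_nonneg_left h1 hT.le)
    _ = _ := by ring

theorem isBigO_powSum_one {d : ℕ} :
    (fun x : Fin d → ℤ => latNorm x ^ (1 - (d : ℝ)) * powSum 1 (jap x))
      =O[cofinite] fun x => latNorm x ^ (-(d : ℝ) + 1) * Real.log (latNorm x) := by
  refine IsBigO.of_bound 4 ?_
  filter_upwards [tendsto_latNorm.eventually_ge_atTop 4] with x hN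
  have hN0 : 0 < latNorm x := by linarith
  have e : -(d : ℝ) + 1 = 1 - d := by ring
  have h1 : 1 ≤ Real.log (latNorm x) := by
    rw [Real.le_log_iff_exp_le hN0]
    linarith [Real.exp_one_lt_d9]
  rw [Real.norm_of_nonneg (mul_nonneg (by positivity) (powSum_nonneg _ _)),
    Real.norm_of_nonneg (by positivity), e]
  have h2 : Real.log (2 * jap x) ≤ 2 * Real.log (latNorm x) := by
    rw [← Real.log_rpow hN0 2]
    refine Real.log_le_log (by linarith [jap_pos x]) ?_
    rw [Real.rpow_two]
    nlinarith [jap_le_one_add_latNorm x]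
  calc _ ≤ latNorm x ^ (1 - (d : ℝ)) * (4 * Real.log (latNorm x)) := by
        gcongr
        linarith [powSum_one_le (one_le_jap x)]
    _ = _ := by ring

theorem isLittleO_powSum {d : ℕ} {ε : ℝ} (hε0 : 0 < ε) (hε : ε ≤ 1) :
    (fun x : Fin d → ℤ => latNorm x ^ (1 - (d : ℝ)) * powSum ε (jap x))
      =o[cofinite] fun x => latNorm x ^ (-(d : ℝ) + 2) := by
  rcases hε.lt_or_eq with h | rfl
  · refine (isBigO_powSum_of_lt hε0 h).trans_isLittleO ?_
    refine isLittleO_of_tendsto' ?_ (((tendsto_rpow_neg_atTop hε0).comp tendsto_latNorm).congr' ?_)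
    · filter_upwards [tendsto_latNorm.eventually_gt_atTop 0] with x hx h0
      exact absurd h0 (Real.rpow_pos_of_pos hx _).ne'
    · filter_upwards [tendsto_latNorm.eventually_gt_atTop 0] with x hx
      rw [Function.comp_apply, ← Real.rpow_sub hx]
      congr 1; ring
  · refine isBigO_powSum_one.trans_isLittleO ?_
    have h1 := ((isBigO_refl (fun t : ℝ => t ^ (-(d : ℝ) + 1)) atTop).mul_isLittleO
      Real.isLittleO_log_id_atTop).comp_tendsto (tendsto_latNorm (d := d))
    refine h1.congr' EventuallyEq.rfl ?_
    filter_upwards [tendsto_latNorm.eventually_gt_atTop 0] with x hx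
    simp only [Function.comp_apply, id]
    nth_rewrite 2 [← Real.rpow_one (latNorm x)]
    rw [← Real.rpow_add hx]
    congr 1; ring

theorem theorem1p2 (d : ℕ) (hd : 3 ≤ d) (ε : ℝ) (hε0 : 0 < ε) (hε1 : ε ≤ 1)
    (V : (Fin d → ℤ) → ℝ) (hV : ∃ C : ℝ, ∀ x, |V x| ≤ C * jap x ^ (-2 - ε))
    (u : (Fin d → ℤ) → ℂ) (hu : MemWeightedL2 (-3 / 2) u)
    (heq : ∀ x, discreteH0 u x + (V x : ℂ) * u x = 0) :
    (∃ C : ℝ, 0 < C ∧ ∀ x, ‖u x‖ ≤ C * jap x ^ (-(d : ℝ) + 2)) ∧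
    Summable (fun y => (V y : ℂ) * u y) ∧
    (ε < 1 →
      (fun x => u x - (-(greenConst d * latNorm x ^ (-(d : ℝ) + 2) : ℝ) *
          ∑' y, (V y : ℂ) * u y))
        =O[latInfty d] (fun x => latNorm x ^ (-(d : ℝ) + 2 - ε))) ∧
    (ε = 1 →
      (fun x => u x - (-(greenConst d * latNorm x ^ (-(d : ℝ) + 2) : ℝ) *
          ∑' y, (V y : ℂ) * u y))
        =O[latInfty d] (fun x => latNorm x ^ (-(d : ℝ) + 1) * Real.log (latNorm x))) ∧
    (∑' y, (V y : ℂ) * u y ≠ 0 →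
      ∃ C : ℝ, 0 < C ∧ ∀ᶠ x in latInfty d, C * latNorm x ^ (-(d : ℝ) + 2) ≤ ‖u x‖) := by
  obtain ⟨C₀, hV⟩ := hV
  have hC₀ : 0 ≤ C₀ := by
    have h := (abs_nonneg _).trans (hV 0)
    exact nonneg_of_mul_nonneg_left h (Real.rpow_pos_of_pos (jap_pos _) _)
  obtain ⟨C, hC, hbound⟩ := exists_norm_le_jap_of_memWeightedL2 hd hε0 hε1 hC₀ hV hu heq
  have hVu : ∀ x, ‖(V x : ℂ) * u x‖ ≤ C₀ * C * jap x ^ (-(d : ℝ) - ε) := fun x => by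
    rw [norm_mul, Complex.norm_real, Real.norm_eq_abs]
    refine (mul_le_mul (hV x) (hbound x) (norm_nonneg _)
      (mul_nonneg hC₀ (Real.rpow_nonneg (jap_pos x).le _))).trans (le_of_eq ?_)
    rw [mul_mul_mul_comm, ← Real.rpow_add (jap_pos x)]
    congr 2; ring
  have hsum : Summable fun y => (V y : ℂ) * u y := by
    refine Summable.of_norm (summable_of_abs_le_jap (Cf := C₀ * C) (by omega) hε0 hε1
      fun x => ?_)
    rw [abs_norm]
    exact hVu x
  obtain ⟨K, hK, hmain⟩ := exists_norm_add_newton_le hd hε0 hε1 (Cu := C)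
    (fun x => (hbound x).trans_eq (by rw [neg_add_eq_sub])) hVu hsum heq
  set S := ∑' y, (V y : ℂ) * u y
  have hO : (fun x => u x - (-(greenConst d * latNorm x ^ (-(d : ℝ) + 2) : ℝ) * S))
      =O[cofinite] fun x => latNorm x ^ (1 - (d : ℝ)) * powSum ε (jap x) := by
    refine IsBigO.of_bound K ?_
    filter_upwards [hmain] with x hx
    rw [Real.norm_of_nonneg
      (mul_nonneg (Real.rpow_nonneg (latNorm_nonneg x) _) (powSum_nonneg _ _))]
    simpa [sub_neg_eq_add] using hx
  rw [latInfty_eq_cofinite]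
  refine ⟨⟨C, hC, hbound⟩, hsum, fun h => hO.trans (isBigO_powSum_of_lt hε0 h), ?_, fun hS => ?_⟩
  · rintro rfl
    exact hO.trans isBigO_powSum_one
  · have hg := greenConst_pos hd
    have hS' : 0 < ‖S‖ := norm_pos_iff.2 hS
    -- Half the leading coefficient: the o(|x|^(2-d)) error eventually takes at most the other half.
    refine ⟨greenConst d * ‖S‖ / 2, by positivity, ?_⟩
    have ho := (hO.trans_isLittleO (isLittleO_powSum hε0 hε1)).bound
      (by positivity : 0 < greenConst d * ‖S‖ / 2)
    filter_upwards [ho] with x hx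
    have hp : 0 ≤ latNorm x ^ (-(d : ℝ) + 2) := Real.rpow_nonneg (latNorm_nonneg x) _
    rw [Real.norm_of_nonneg hp] at hx
    have h1 := norm_sub_norm_le (-(greenConst d * latNorm x ^ (-(d : ℝ) + 2) : ℝ) * S) (u x)
    rw [norm_sub_rev, norm_mul, norm_neg, Complex.norm_real,
      Real.norm_of_nonneg (mul_nonneg hg.le hp)] at h1
    nlinarith
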